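/- Let $\Omega$ be the countable set of functions $h:\mathbb{Z}_{\ge 0}^2\to\mathbb{Z}_{\ge 0}$ with $h(i+1,j)\le h(i,j)$ and $h(i,j+1)\le h(i,j)$ for all $i,j$, and $h(i,j)\to 0$ as $(i,j)\to\infty$ (that is, $h(i,j)=0$ for all but finitely many $(i,j)$), and let $V(h)=\sum_{i,j\ge 0}h(i,j)$. For real $T>1$ the partition function $Z_T=\sum_{h\in\Omega}(1-\tfrac1T)^{V(h)}$ is finite and positive, so that $$\mathbb{P}_T(\{h\})=\frac{1}{Z_T}\Big(1-\frac1T\Big)^{V(h)},\qquad h\in\Omega,$$ defines a probability measure on $\Omega$. Let $h_T$ be a random height function with law $\mathbb{P}_T$ and let $b_T(t)=h_T(0,t)$, $t\in\mathbb{Z}_{\ge 0}$, be its border step. Put $b_\infty(u)=-2\ln(1-e^{-u/2})$ for $u>0$. Then for all $\delta>0$, $c>0$ and $0<u_-<u_+<\infty$, $$\lim_{T\to\infty}\mathbb{P}_T\Big(\big|T^{-1}b_T([uT])-b_\infty(u)\big|\ge c\,T^{-2/3+\delta}\ \text{ for some } u\in[u_-,u_+]\Big)=0,$$ where $[\,\cdot\,]$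 denotes the integer part. -/

import Mathlib

open Filter Topology MeasureTheory

noncomputable section

/-- Height functions of crystal corner configurations: functions on the quadrant of pairs of
nonnegative integers, with nonnegative integer values, nonincreasing in each coordinate, and
tending to `0` as `(i, j) → ∞`, that is, as `(i, j)` leaves every finite set. -/
structure CrystalHeight where
  /-- The height over the column `(i, j)`. -/
  height : ℕ → ℕ → ℕ
  height_succ_left : ∀ i j, height (i + 1) j ≤ height i j
  height_succ_right : ∀ i j, height i (j + 1) ≤ height i j
  tendsto_height : Tendsto (fun p : ℕ × ℕ => height p.1 p.2) cofinite (𝓝 0)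

namespace CrystalHeight

/-- The set of height functions is countable and carries the discrete σ-algebra. -/
instance : MeasurableSpace CrystalHeight := ⊤

/-- The volume below the height function. The support is finite because integer heights that tend
to `0` along the cofinite filter vanish outside a finite set. -/
def vol (h : CrystalHeight) : ℕ := ∑ᶠ p : ℕ × ℕ, h.height p.1 p.2

/-- The border step `t ↦ h(0, t)`. -/
def borderStep (h : CrystalHeight) (t : ℕ) : ℕ := h.height 0 t

/-- The measure with density `q ^ V(h)`, `q = 1 - 1 / T`, relative to the counting measure. -/
def weightMeasure (T : ℝ) : Measure CrystalHeight :=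
  Measure.count.withDensity fun h => ENNReal.ofReal ((1 - 1 / T) ^ h.vol)

/-- The partition function `Z_T`, the sum of all weights. -/
def partitionFunction (T : ℝ) : ENNReal := weightMeasure T Set.univ

/-- The law of the random height function `h_T`: weight `q ^ V(h) / Z_T`, `q = 1 - 1 / T`. -/
def law (T : ℝ) : Measure CrystalHeight := (partitionFunction T)⁻¹ • weightMeasure T

end CrystalHeight

/-- The limiting shape of the border step, `b_∞(τ) = -2 ln (1 - e^{-τ/2})`, used for `τ > 0`. -/
def borderLimit (τ : ℝ) : ℝ := -2 * Real.log (1 - Real.exp (-τ / 2))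

end

/-! The border step h(0,t) is the first part of the partition read along the diagonal through (0,t).
Consecutive diagonals interlace. Moving strip-removing operators past strip-adding ones
(`Par.down_up`) shows that in a box with M rows and M+t columns this partition l has weight
proportional to s_l(a)², a Schur measure with a_i = q^((t+1)/2+i), q = 1 - 1/T
(`CrystalHeight.tsum_inBox_eq`). By the dual Jacobi–Trudi formula the part of the Cauchy sum with
l_0 ≤ n is the Toeplitz determinant D_n of |A|² on the unit circle, A = ∏ (1 + a_i z)
(`Par.tsum_schur_sq_eq_det`). So both tails of the border step reduce to quotients D_n / D_N, that
is, to products of ratios r_k = D_k / D_(k+1) ∈ [0,1]; boxes then exhaust the quadrant.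

The ratio r_k is p(0) for the polynomial p of degree at most k with pA biorthogonal to A, zA, …, z^k
A. Two one-sided estimates pin it down around the edge n* = 2 ∑ a_i/(1-a_i). Above the edge,
shifting a contour from radius 1 to e^(-ε) shows that 1 - r_k is of size e^(-2ε(k-n*))
(`one_sub_coeff_zero_le`, `circleRatio_exp_le`). Below the edge, a Jensen inequality for a
probability density on the circle with a dip of width d near z = -1, where |A| is small, gives r_k ≤
exp(-(d²(n*-k)/32 - d/4)) (`coeff_zero_le_exp_neg_wellGain`, `wellGain_ge`). Both hold up to
shifting the edge by O(ε² ∑ a_i/(1-a_i)³), respectively O(d² ∑ a_i/(1-a_i)³), where the sum is O(T).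

With ε = d = T^(-1/3) that shift is O(T^(1/3)), the scale on which the estimates become effective.
Hence a deviation of order T^(1/3) y has probability at most 2 T^(1/3) e^(-y/64)
(`CrystalHeight.law_abs_borderStep_sub_le`). Telescoping a Riemann sum gives n* = -2T log(1 -
q^((t+1)/2)) + O(1) = T b_∞(u) + O(1). With y = c T^δ, a union bound over the O(T) values of t
finishes the proof. -/

noncomputable section

/-! ### Means over the unit circle: Parseval, dilation, Cauchy–Schwarz. -/

section CircleMean

open Complex ComplexConjugate Metric

lemma circleIntegrable_of_continuousOn_sphere {E : Type*} [NormedAddCommGroup E]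
    {f : ℂ → E} (hf : ContinuousOn f (sphere 0 1)) : CircleIntegrable f 0 1 :=
  hf.circleIntegrable zero_le_one

lemma circleAverage_conj {f : ℂ → ℂ} (hf : ContinuousOn f (sphere 0 1)) :
    Real.circleAverage (fun z => conj (f z)) 0 1 = conj (Real.circleAverage f 0 1) :=
  (conjCLE : ℂ →L[ℝ] ℂ).circleAverage_comp_comm (circleIntegrable_of_continuousOn_sphere hf)

lemma circleAverage_re {f : ℂ → ℂ} (hf : ContinuousOn f (sphere 0 1)) :
    Real.circleAverage (fun z => (f z).re) 0 1 = (Real.circleAverage f 0 1).re :=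
  reCLM.circleAverage_comp_comm (circleIntegrable_of_continuousOn_sphere hf)

lemma circleAverage_ofReal {f : ℂ → ℝ} (hf : ContinuousOn f (sphere 0 1)) :
    Real.circleAverage (fun z => (f z : ℂ)) 0 1 = (Real.circleAverage f 0 1 : ℝ) :=
  ofRealCLM.circleAverage_comp_comm (circleIntegrable_of_continuousOn_sphere hf)

lemma mul_conj_of_mem_sphere {z : ℂ} (hz : z ∈ sphere (0 : ℂ) 1) : z * conj z = 1 := by
  have : ‖z‖ = 1 := by simpa using hz
  simp [mul_conj, normSq_eq_norm_sq, this]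

lemma circleAverage_pow_succ (n : ℕ) : Real.circleAverage (fun z : ℂ => z ^ (n + 1)) 0 1 = 0 := by
  have h : DiffContOnCl ℂ (fun z : ℂ => z ^ (n + 1)) (ball 0 |(1 : ℝ)|) :=
    (differentiable_id.pow (n + 1)).diffContOnCl
  simpa using h.circleAverage

lemma circleAverage_pow_mul_conj_pow (m l : ℕ) :
    Real.circleAverage (fun z : ℂ => z ^ m * conj (z ^ l)) 0 1 = if m = l then 1 else 0 := by
  have key : ∀ a b : ℕ, Real.circleAverage (fun z : ℂ => z ^ (a + (b + 1)) * conj (z ^ a)) 0 1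
      = 0 := by
    intro a b
    refine (Real.circleAverage_congr_sphere fun z hz => ?_).trans (circleAverage_pow_succ b)
    have h := mul_conj_of_mem_sphere (by simpa using hz)
    simp only [pow_add, map_pow]
    calc z ^ a * (z ^ b * z ^ 1) * conj z ^ a = (z * conj z) ^ a * (z ^ b * z ^ 1) := by
          rw [mul_pow]; ring
      _ = _ := by rw [h]; simp
  rcases lt_trichotomy m l with h | h | h
  · obtain ⟨b, rfl⟩ := Nat.exists_eq_add_of_lt h
    rw [if_neg h.ne]
    have h1 := key m b
    have h2 := circleAverage_conj (f := fun z : ℂ => z ^ (m + (b + 1)) * conj (z ^ m))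
      (by fun_prop)
    rw [h1, map_zero] at h2
    refine (Real.circleAverage_congr_sphere fun z _ => ?_).trans h2
    simp [add_assoc, mul_comm]
  · subst h
    rw [if_pos rfl]
    refine (Real.circleAverage_congr_sphere fun z hz => ?_).trans
      (Real.circleAverage_const (1 : ℂ) 0 1)
    have h := mul_conj_of_mem_sphere (by simpa using hz)
    simp only [map_pow]
    rw [← mul_pow, h, one_pow]
  · obtain ⟨b, rfl⟩ := Nat.exists_eq_add_of_lt h
    rw [if_neg h.ne']
    exact key l b

lemma norm_pow_of_mem_sphere {z : ℂ} (hz : z ∈ sphere (0 : ℂ) 1) (n : ℕ) : ‖z ^ n‖ = 1 := by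
  have : ‖z‖ = 1 := by simpa using hz
  simp [this]

lemma continuousOn_of_hasSum_pow {d : ℕ → ℂ} (hd : Summable fun n => ‖d n‖) {g : ℂ → ℂ}
    (hg : ∀ z ∈ sphere (0 : ℂ) 1, HasSum (fun n => d n * z ^ n) (g z)) :
    ContinuousOn g (sphere 0 1) := by
  have h : ContinuousOn (fun z : ℂ => ∑' n, d n * z ^ n) (sphere 0 1) := by
    refine continuousOn_tsum (fun n => by fun_prop) hd fun n z hz => ?_
    rw [norm_mul, norm_pow_of_mem_sphere hz, mul_one]
  exact h.congr fun z hz => (hg z hz).tsum_eq.symm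

lemma circleAverage_mul_conj_of_hasSum {d : ℕ → ℂ} (hd : Summable fun n => ‖d n‖) {g h : ℂ → ℂ}
    (hg : ∀ z ∈ sphere (0 : ℂ) 1, HasSum (fun n => d n * z ^ n) (g z))
    (hh : ContinuousOn h (sphere 0 1)) :
    HasSum (fun n => conj (d n) * Real.circleAverage (fun z => h z * conj (z ^ n)) 0 1)
      (Real.circleAverage (fun z => h z * conj (g z)) 0 1) := by
  obtain ⟨C, hC⟩ := (isCompact_sphere (0 : ℂ) 1).exists_bound_of_continuousOn hh
  have hcm : ∀ θ, circleMap 0 1 θ ∈ sphere (0 : ℂ) 1 := fun θ => by simp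
  have hcont : Continuous fun θ => h (circleMap 0 1 θ) :=
    hh.comp_continuous (continuous_circleMap 0 1) hcm
  have key := intervalIntegral.hasSum_integral_of_dominated_convergence (μ := volume)
    (a := 0) (b := 2 * Real.pi)
    (F := fun (n : ℕ) (θ : ℝ) => conj (d n) * (h (circleMap 0 1 θ) * conj (circleMap 0 1 θ ^ n)))
    (f := fun θ => h (circleMap 0 1 θ) * conj (g (circleMap 0 1 θ)))
    (bound := fun n _ => C * ‖d n‖) ?_ ?_ ?_ ?_ ?_
  · have := key.const_smul ((2 * Real.pi)⁻¹ : ℝ)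
    simp only [intervalIntegral.integral_const_mul, Complex.real_smul] at this
    simp only [Real.circleAverage, Complex.real_smul]
    refine this.congr_fun fun n => ?_
    ring
  · intro n
    refine Continuous.aestronglyMeasurable ?_
    exact continuous_const.mul (hcont.mul (continuous_conj.comp
      ((continuous_circleMap 0 1).pow n)))
  · intro n
    refine Eventually.of_forall fun θ _ => ?_
    rw [norm_mul, norm_mul, norm_conj, norm_conj, norm_pow_of_mem_sphere (hcm θ), mul_one, mul_comm]
    exact mul_le_mul_of_nonneg_right (hC _ (hcm θ)) (norm_nonneg _)
  · exact Eventually.of_forall fun θ _ => hd.mul_left C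
  · exact intervalIntegrable_const
  · refine Eventually.of_forall fun θ _ => ?_
    have := ((hg _ (hcm θ)).map conjCLE conjCLE.continuous).mul_left (h (circleMap 0 1 θ))
    refine this.congr_fun fun n => ?_
    simp
    ring

/-- Parseval's identity for a pair of absolutely convergent power series on the unit circle. -/
lemma circleAverage_mul_conj {c d : ℕ → ℂ} (hc : Summable fun n => ‖c n‖)
    (hd : Summable fun n => ‖d n‖) {f g : ℂ → ℂ}
    (hf : ∀ z ∈ sphere (0 : ℂ) 1, HasSum (fun n => c n * z ^ n) (f z))
    (hg : ∀ z ∈ sphere (0 : ℂ) 1, HasSum (fun n => d n * z ^ n) (g z)) :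
    HasSum (fun n => c n * conj (d n)) (Real.circleAverage (fun z => f z * conj (g z)) 0 1) := by
  have hfc := continuousOn_of_hasSum_pow hc hf
  refine (circleAverage_mul_conj_of_hasSum hd hg hfc).congr_fun fun n => ?_
  -- The same interchange of sum and mean, with the monomial in place of `h` and the series of f
  -- under the conjugation, identifies the n-th Fourier coefficient of f as `c n`.
  have h1 := circleAverage_mul_conj_of_hasSum hc hf (h := fun z => z ^ n) (by fun_prop)
  simp only [circleAverage_pow_mul_conj_pow] at h1
  have h2 := h1.unique (hasSum_single n fun m hm => by simp [hm.symm])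
  have h3 : Real.circleAverage (fun z => f z * conj (z ^ n)) 0 1 = c n := by
    rw [← conj_conj (c n), ← (by simpa using h2 : _ = conj (c n)), ← circleAverage_conj]
    · refine Real.circleAverage_congr_sphere fun z _ => ?_
      simp [mul_comm]
    · exact ContinuousOn.mul (by fun_prop) (continuous_conj.comp_continuousOn hfc)
  rw [h3, mul_comm]

/-- The quadratic mean of a power series on a circle of radius `ρ ≤ 1` is at most that on the unit
circle. -/
lemma circleAverage_norm_sq_comp_mul_le {c : ℕ → ℂ} (hc : Summable fun n => ‖c n‖) {f : ℂ → ℂ}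
    (hf : ∀ z ∈ closedBall (0 : ℂ) 1, HasSum (fun n => c n * z ^ n) (f z)) {ρ : ℝ} (h0 : 0 ≤ ρ)
    (h1 : ρ ≤ 1) :
    Real.circleAverage (fun z => ‖f (ρ * z)‖ ^ 2) 0 1 ≤
      Real.circleAverage (fun z => ‖f z‖ ^ 2) 0 1 := by
  -- Parseval on the circle of radius s: every term increases with s.
  have key : ∀ s : ℝ, 0 ≤ s → s ≤ 1 → HasSum (fun n => ‖c n‖ ^ 2 * (s ^ n) ^ 2)
      (Real.circleAverage (fun z => ‖f (s * z)‖ ^ 2) 0 1) := by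
    intro s hs0 hs1
    have hcs : Summable fun n => ‖c n * (s : ℂ) ^ n‖ := by
      refine Summable.of_nonneg_of_le (fun n => norm_nonneg _) (fun n => ?_) hc
      rw [norm_mul, norm_pow, norm_real, Real.norm_of_nonneg hs0]
      exact mul_le_of_le_one_right (norm_nonneg _) (pow_le_one₀ hs0 hs1)
    have hfs : ∀ z ∈ sphere (0 : ℂ) 1, HasSum (fun n => c n * (s : ℂ) ^ n * z ^ n) (f (s * z)) := by
      intro z hz
      have hz' : ‖z‖ = 1 := by simpa using hz
      have := hf (s * z) (by simp [hz', abs_of_nonneg hs0, hs1])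
      simpa only [mul_pow, mul_assoc] using this
    have h := circleAverage_mul_conj hcs hcs hfs hfs
    have hcont := continuousOn_of_hasSum_pow hcs hfs
    have e : Real.circleAverage (fun z => f (s * z) * conj (f (s * z))) 0 1 =
        ((Real.circleAverage (fun z => ‖f (s * z)‖ ^ 2) 0 1 : ℝ) : ℂ) := by
      have h3 : ContinuousOn (fun z : ℂ => ‖f (s * z)‖ ^ 2) (sphere 0 1) := hcont.norm.pow 2
      rw [← circleAverage_ofReal h3]
      simp only [mul_conj, normSq_eq_norm_sq]
    rw [e] at h
    have h' := hasSum_re h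
    rw [ofReal_re] at h'
    refine h'.congr_fun fun n => ?_
    rw [mul_conj, normSq_eq_norm_sq, ofReal_re, norm_mul, norm_pow, norm_real,
      Real.norm_of_nonneg hs0, mul_pow]
  have e1 : (fun z : ℂ => ‖f z‖ ^ 2) = fun z : ℂ => ‖f ((1 : ℝ) * z)‖ ^ 2 := by simp
  rw [e1]
  refine hasSum_le (fun n => ?_) (key ρ h0 h1) (key 1 zero_le_one le_rfl)
  gcongr

/-- A function that is complex differentiable on a larger disc is the sum of an absolutely
convergent power series on the closed unit disc. -/
lemma exists_hasSum_pow_of_differentiableOn {f : ℂ → ℂ} {R : ℝ} (hR : 1 < R)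
    (hf : DifferentiableOn ℂ f (ball 0 R)) :
    ∃ c : ℕ → ℂ, (Summable fun n => ‖c n‖) ∧
      ∀ z ∈ closedBall (0 : ℂ) 1, HasSum (fun n => c n * z ^ n) (f z) := by
  obtain ⟨s, hs1, hsR⟩ := exists_between hR
  lift s to NNReal using by linarith
  have hs0 : (0 : NNReal) < s := by
    have : (0 : ℝ) < s := by linarith
    exact_mod_cast this
  have hp := (hf.mono (closedBall_subset_ball hsR)).hasFPowerSeriesOnBall hs0
  refine ⟨(cauchyPowerSeries f 0 s).coeff, ?_, fun z hz => ?_⟩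
  · have h1 : (1 : NNReal) < s := by exact_mod_cast hs1
    have := (cauchyPowerSeries f 0 s).summable_norm_mul_pow (r := 1)
      (lt_of_lt_of_le (by exact_mod_cast h1) hp.r_le)
    simpa using this
  · have hz1 : ‖z‖ ≤ 1 := by simpa using hz
    have := hp.hasSum (y := z) (by
      simp only [eball_coe, mem_ball, dist_zero_right]
      linarith)
    simp only [zero_add] at this
    refine this.congr_fun fun n => ?_
    rw [FormalMultilinearSeries.apply_eq_pow_smul_coeff, smul_eq_mul, mul_comm]

/-- The Cauchy-Schwarz inequality for means over the unit circle. -/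
lemma circleAverage_mul_sq_le {f g : ℂ → ℝ} (hf : ContinuousOn f (sphere 0 1))
    (hg : ContinuousOn g (sphere 0 1)) :
    (Real.circleAverage (fun z => f z * g z) 0 1) ^ 2 ≤
      Real.circleAverage (fun z => f z ^ 2) 0 1 * Real.circleAverage (fun z => g z ^ 2) 0 1 := by
  set a := Real.circleAverage (fun z => f z ^ 2) 0 1
  set b := Real.circleAverage (fun z => f z * g z) 0 1
  set c := Real.circleAverage (fun z => g z ^ 2) 0 1
  -- The mean of (x f - g)² is a nonnegative quadratic in x; its discriminant gives the inequality.
  have key : ∀ x : ℝ, 0 ≤ a * (x * x) + (-2 * b) * x + c := by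
    intro x
    have h0 : 0 ≤ Real.circleAverage (fun z => (x * f z - g z) ^ 2) 0 1 :=
      Real.circleAverage_nonneg_of_nonneg fun z _ => sq_nonneg _
    have e : Real.circleAverage (fun z => (x * f z - g z) ^ 2) 0 1
        = a * (x * x) + (-2 * b) * x + c := by
      have e1 : (fun z => (x * f z - g z) ^ 2) =
          fun z => (((x * x) • f z ^ 2) + ((-2 * x) • (f z * g z))) + g z ^ 2 := by
        funext z; simp only [smul_eq_mul]; ring
      rw [e1, Real.circleAverage_fun_add, Real.circleAverage_fun_add, Real.circleAverage_fun_smul,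
        Real.circleAverage_fun_smul]
      · simp only [smul_eq_mul, a, b, c]; ring
      all_goals
        apply circleIntegrable_of_continuousOn_sphere
        fun_prop
    linarith
  have := discrim_le_zero key
  rw [discrim] at this
  nlinarith

end CircleMean

end

noncomputable section

/-! ### The coefficient inner product of real polynomials as a circle mean. -/

section PolyInner

open Polynomial ComplexConjugate Metric

/-- The inner product of real polynomials that makes the monomials orthonormal. -/
def polyInner (f g : ℝ[X]) : ℝ := f.sum fun m c => c * g.coeff m

lemma polyInner_eq_sum_range {f : ℝ[X]} (g : ℝ[X]) {N : ℕ} (hN : f.natDegree < N) :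
    polyInner f g = ∑ m ∈ Finset.range N, f.coeff m * g.coeff m :=
  Polynomial.sum_over_range' f (by simp) N hN

lemma polyInner_sum_left {ι : Type*} (s : Finset ι) (f : ι → ℝ[X]) (g : ℝ[X]) :
    polyInner (∑ i ∈ s, f i) g = ∑ i ∈ s, polyInner (f i) g := by
  classical
  induction s using Finset.induction_on with
  | empty => simp [polyInner]
  | insert i s hi ih =>
    rw [Finset.sum_insert hi, Finset.sum_insert hi, ← ih, polyInner, Polynomial.sum_add_index] <;>
      simp [polyInner, add_mul]

lemma polyInner_C_mul_left (c : ℝ) (f g : ℝ[X]) : polyInner (C c * f) g = c * polyInner f g := by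
  have h : (C c * f).natDegree < f.natDegree + 1 := by
    have := natDegree_C_mul_le c f
    omega
  rw [polyInner_eq_sum_range g h, polyInner_eq_sum_range g (Nat.lt_succ_self _), Finset.mul_sum]
  refine Finset.sum_congr rfl fun m _ => ?_
  rw [coeff_C_mul, mul_assoc]

lemma hasSum_aeval (f : ℝ[X]) (z : ℂ) :
    HasSum (fun n => (f.coeff n : ℂ) * z ^ n) (aeval z f) := by
  have h : aeval z f = ∑ n ∈ Finset.range (f.natDegree + 1), (f.coeff n : ℂ) * z ^ n := by
    rw [aeval_eq_sum_range]
    simp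
  rw [h]
  refine hasSum_sum_of_ne_finset_zero fun n hn => ?_
  have : f.natDegree < n := by simpa [Nat.lt_succ_iff] using hn
  simp [coeff_eq_zero_of_natDegree_lt this]

lemma summable_norm_coeff (f : ℝ[X]) : Summable fun n => ‖(f.coeff n : ℂ)‖ := by
  refine summable_of_ne_finset_zero (s := f.support) fun n hn => ?_
  simpa using hn

lemma continuous_complex_aeval (f : ℝ[X]) : Continuous fun z : ℂ => aeval z f :=
  f.continuous_aeval

lemma conj_aeval (f : ℝ[X]) (z : ℂ) : conj (aeval z f) = aeval (conj z) f :=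
  (Polynomial.aeval_conj f z).symm

lemma circleAverage_aeval_mul_conj (f g : ℝ[X]) :
    Real.circleAverage (fun z : ℂ => aeval z f * conj (aeval z g)) 0 1 = (polyInner f g : ℂ) := by
  refine (circleAverage_mul_conj (summable_norm_coeff f) (summable_norm_coeff g)
    (fun z _ => hasSum_aeval f z) (fun z _ => hasSum_aeval g z)).unique ?_
  rw [polyInner_eq_sum_range g (Nat.lt_succ_self _), Complex.ofReal_sum]
  have : (fun n => (f.coeff n : ℂ) * conj (g.coeff n : ℂ)) =
      fun n => ((f.coeff n * g.coeff n : ℝ) : ℂ) := by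
    funext n; simp
  rw [this]
  refine hasSum_sum_of_ne_finset_zero fun n hn => ?_
  have : f.natDegree < n := by simpa [Nat.lt_succ_iff] using hn
  simp [coeff_eq_zero_of_natDegree_lt this]

lemma circleAverage_norm_aeval_sq (f : ℝ[X]) :
    Real.circleAverage (fun z : ℂ => ‖aeval z f‖ ^ 2) 0 1 = polyInner f f := by
  have h : ContinuousOn (fun z : ℂ => ‖aeval z f‖ ^ 2) (sphere 0 1) :=
    ((continuous_complex_aeval f).norm.pow 2).continuousOn
  rw [← Complex.ofReal_inj, ← circleAverage_ofReal h, ← circleAverage_aeval_mul_conj]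
  simp only [Complex.mul_conj, Complex.normSq_eq_norm_sq]

lemma circleAverage_aeval_mul_conj_pow (f : ℝ[X]) (n : ℕ) :
    Real.circleAverage (fun z : ℂ => aeval z f * conj (z ^ n)) 0 1 = (f.coeff n : ℂ) := by
  have h := circleAverage_aeval_mul_conj f (X ^ n)
  simp only [map_pow, aeval_X] at h
  simp only [map_pow]
  rw [h, polyInner_eq_sum_range _ (show f.natDegree < f.natDegree + n + 1 by omega)]
  simp [coeff_X_pow]

end PolyInner

/-! ### The products A and its reversal A', and biorthogonality. -/

section UpperTail

open Polynomial ComplexConjugate Metric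

/-- The polynomial `∏ (1 + aᵢ X)` over `i < M`. -/
def elemPoly (a : ℕ → ℝ) (M : ℕ) : ℝ[X] := ∏ i ∈ Finset.range M, (1 + C (a i) * X)

/-- The polynomial `∏ (X + aᵢ)` over `i < M`. -/
def elemPolyRev (a : ℕ → ℝ) (M : ℕ) : ℝ[X] := ∏ i ∈ Finset.range M, (X + C (a i))

lemma aeval_elemPoly (a : ℕ → ℝ) (M : ℕ) (z : ℂ) :
    aeval z (elemPoly a M) = ∏ i ∈ Finset.range M, (1 + (a i : ℂ) * z) := by
  simp [elemPoly, map_prod]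

lemma aeval_elemPolyRev (a : ℕ → ℝ) (M : ℕ) (z : ℂ) :
    aeval z (elemPolyRev a M) = ∏ i ∈ Finset.range M, (z + (a i : ℂ)) := by
  simp [elemPolyRev, map_prod]

lemma elemPoly_coeff_zero (a : ℕ → ℝ) (M : ℕ) : (elemPoly a M).coeff 0 = 1 := by
  rw [coeff_zero_eq_eval_zero, elemPoly, eval_prod]
  simp

/-- On the circle conj z = 1/z, so reversal agrees with conjugation up to z^M. The reversed product
therefore continues the conjugate of A analytically off the circle. -/
lemma aeval_elemPolyRev_of_mem_sphere (a : ℕ → ℝ) (M : ℕ) {z : ℂ} (hz : z ∈ sphere (0 : ℂ) 1) :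
    aeval z (elemPolyRev a M) = z ^ M * conj (aeval z (elemPoly a M)) := by
  have h := mul_conj_of_mem_sphere hz
  rw [aeval_elemPoly, aeval_elemPolyRev, map_prod]
  have : z ^ M = ∏ i ∈ Finset.range M, z := by simp
  rw [this, ← Finset.prod_mul_distrib]
  refine Finset.prod_congr rfl fun i _ => ?_
  simp only [map_add, map_one, map_mul, Complex.conj_ofReal]
  linear_combination -(a i : ℂ) * h

lemma norm_circleAverage_le (f : ℂ → ℂ) :
    ‖Real.circleAverage f 0 1‖ ≤ Real.circleAverage (fun z => ‖f z‖) 0 1 := by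
  rw [Real.circleAverage, Real.circleAverage, norm_smul, smul_eq_mul, Real.norm_of_nonneg
    (by positivity)]
  gcongr
  exact intervalIntegral.norm_integral_le_integral_norm Real.two_pi_pos.le

/-- Pairings with the shifts of A become coefficients of the single polynomial f A', so
orthogonality turns into a gap in its coefficients. -/
lemma coeff_mul_elemPolyRev (a : ℕ → ℝ) (M j : ℕ) (f : ℝ[X]) :
    (f * elemPolyRev a M).coeff (M + j) = polyInner f (X ^ j * elemPoly a M) := by
  rw [← Complex.ofReal_inj, ← circleAverage_aeval_mul_conj_pow, ← circleAverage_aeval_mul_conj]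
  refine Real.circleAverage_congr_sphere fun z hz => ?_
  have hz : z ∈ sphere (0 : ℂ) 1 := by simpa using hz
  have h := mul_conj_of_mem_sphere hz
  simp only [map_mul, aeval_elemPolyRev_of_mem_sphere a M hz, map_pow, aeval_X, pow_add]
  calc _ = (z * conj z) ^ M * (aeval z f * (conj z ^ j * conj (aeval z (elemPoly a M)))) := by
        rw [mul_pow]; ring
    _ = _ := by rw [h]; simp

/-- On |w| = ρ the quotient |1 + a w| / |w + a| is largest at w = -ρ: the difference of the two
squared sides is 2a(1-a²)(1-ρ²)(Re w + ρ). -/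
lemma norm_one_add_mul_le {a ρ : ℝ} {w : ℂ} (ha : 0 < a) (haρ : a < ρ) (hρ : ρ < 1)
    (hw : ‖w‖ = ρ) : (ρ - a) * ‖1 + a * w‖ ≤ (1 - a * ρ) * ‖w + a‖ := by
  have h1 : 0 < 1 - a * ρ := by nlinarith
  refine le_of_sq_le_sq ?_ (by positivity)
  have hx : -ρ ≤ w.re := by
    rw [← hw]; exact neg_le_of_abs_le (Complex.abs_re_le_norm w)
  have hsq : w.re ^ 2 + w.im ^ 2 = ρ ^ 2 := by
    rw [← hw, ← Complex.normSq_eq_norm_sq, Complex.normSq_apply]; ring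
  rw [mul_pow, mul_pow, ← Complex.normSq_eq_norm_sq, ← Complex.normSq_eq_norm_sq,
    Complex.normSq_apply, Complex.normSq_apply]
  simp only [Complex.add_re, Complex.add_im, Complex.mul_re, Complex.mul_im, Complex.ofReal_re,
    Complex.ofReal_im, Complex.one_re, Complex.one_im]
  have h2 : 0 ≤ 2 * a * ((1 - a ^ 2) * (1 - ρ ^ 2)) * (w.re + ρ) := by
    have : 0 ≤ 1 - a ^ 2 := by nlinarith
    have : 0 ≤ 1 - ρ ^ 2 := by nlinarith
    have : 0 ≤ w.re + ρ := by linarith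
    positivity
  have h3 : w.im ^ 2 = ρ ^ 2 - w.re ^ 2 := by linarith
  have h4 : (ρ - a) ^ 2 * ((1 + (a * w.re - 0 * w.im)) * (1 + (a * w.re - 0 * w.im)) +
      (0 + (a * w.im + 0 * w.re)) * (0 + (a * w.im + 0 * w.re))) =
      (ρ - a) ^ 2 * (1 + 2 * a * w.re + a ^ 2 * ρ ^ 2) := by
    linear_combination (ρ - a) ^ 2 * a ^ 2 * h3
  have h5 : (1 - a * ρ) ^ 2 * ((w.re + a) * (w.re + a) + (w.im + 0) * (w.im + 0)) =
      (1 - a * ρ) ^ 2 * (ρ ^ 2 + 2 * a * w.re + a ^ 2) := by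
    linear_combination (1 - a * ρ) ^ 2 * h3
  rw [h4, h5]
  nlinarith

/-- Expand one factor p A in the shifts X^j A; only j = 0 pairs nontrivially with the other factor.
-/
lemma polyInner_self_of_orthogonal {k : ℕ} {p A : ℝ[X]} (hp : p.natDegree ≤ k)
    (horth : ∀ j ≤ k, polyInner (X ^ j * A) (p * A) = if j = 0 then 1 else 0) :
    polyInner (p * A) (p * A) = p.coeff 0 := by
  have h : p * A = ∑ j ∈ Finset.range (k + 1), C (p.coeff j) * (X ^ j * A) := by
    conv_lhs => rw [p.as_sum_range_C_mul_X_pow' (Nat.lt_succ_of_le hp)]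
    rw [Finset.sum_mul]
    simp only [mul_assoc]
  have h2 := polyInner_sum_left (Finset.range (k + 1)) (fun j => C (p.coeff j) * (X ^ j * A))
    (p * A)
  rw [← h] at h2
  rw [h2, Finset.sum_eq_single 0]
  · rw [polyInner_C_mul_left, horth 0 (Nat.zero_le _)]; simp
  · intro j hj hj0
    rw [polyInner_C_mul_left, horth j (by simpa [Nat.lt_succ_iff] using hj), if_neg hj0, mul_zero]
  · simp

end UpperTail

end

noncomputable section

/-! ### Upper tail: the defect of the constant coefficient by a contour shift. -/

section UpperTail

open Polynomial ComplexConjugate Metric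

lemma aeval_elemPoly_ne_zero {a : ℕ → ℝ} {M : ℕ} {ρ : ℝ} (h0 : ∀ i < M, 0 < a i)
    (ha : ∀ i < M, a i < ρ) (hρ0 : 0 < ρ) {z : ℂ} (hz : ‖z‖ < ρ⁻¹) :
    aeval z (elemPoly a M) ≠ 0 := by
  rw [aeval_elemPoly, Finset.prod_ne_zero_iff]
  intro i hi h
  have hi := Finset.mem_range.1 hi
  have h1 : ‖(a i : ℂ) * z‖ = 1 := by
    rw [eq_neg_of_add_eq_zero_right h]; simp
  rw [norm_mul, Complex.norm_real, Real.norm_of_nonneg (h0 i hi).le] at h1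
  have : a i * ‖z‖ < ρ * ρ⁻¹ := by
    have := h0 i hi
    have := ha i hi
    have := norm_nonneg z
    nlinarith
  rw [mul_inv_cancel₀ hρ0.ne'] at this
  linarith

lemma aeval_elemPolyRev_ne_zero {a : ℕ → ℝ} {M : ℕ} {ρ : ℝ} (h0 : ∀ i < M, 0 < a i)
    (ha : ∀ i < M, a i < ρ) {z : ℂ} (hz : ρ ≤ ‖z‖) :
    aeval z (elemPolyRev a M) ≠ 0 := by
  rw [aeval_elemPolyRev, Finset.prod_ne_zero_iff]
  intro i hi h
  have hi := Finset.mem_range.1 hi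
  have h1 : ‖z‖ = a i := by
    rw [eq_neg_of_add_eq_zero_left h]; simp [(h0 i hi).le]
  have := ha i hi
  linarith

/-- The maximal modulus of `∏ (1 + aᵢ z) / (1 + aᵢ / z)` on the circle of radius `ρ`. -/
def circleRatio (a : ℕ → ℝ) (M : ℕ) (ρ : ℝ) : ℝ :=
  ∏ i ∈ Finset.range M, (1 - a i * ρ) / (1 - a i / ρ)

lemma norm_elemPoly_le {a : ℕ → ℝ} {M : ℕ} {ρ : ℝ} (h0 : ∀ i < M, 0 < a i)
    (ha : ∀ i < M, a i < ρ) (hρ0 : 0 < ρ) (hρ1 : ρ < 1) {w : ℂ} (hw : ‖w‖ = ρ) :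
    ρ ^ M * ‖aeval w (elemPoly a M)‖ ≤ circleRatio a M ρ * ‖aeval w (elemPolyRev a M)‖ := by
  rw [aeval_elemPoly, aeval_elemPolyRev, norm_prod, norm_prod, circleRatio,
    ← Finset.prod_mul_distrib]
  have : ρ ^ M = ∏ i ∈ Finset.range M, ρ := by simp
  rw [this, ← Finset.prod_mul_distrib]
  refine Finset.prod_le_prod (fun i _ => by positivity) fun i hi => ?_
  have hi := Finset.mem_range.1 hi
  have h1 := norm_one_add_mul_le (h0 i hi) (ha i hi) hρ1 hw
  have h2 : 0 < ρ - a i := sub_pos.2 (ha i hi)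
  have h3 : (1 - a i * ρ) / (1 - a i / ρ) = ρ * (1 - a i * ρ) / (ρ - a i) := by
    have : 1 - a i / ρ = (ρ - a i) / ρ := by field_simp
    rw [this]
    field_simp
  rw [h3, div_mul_eq_mul_div, le_div_iff₀ h2]
  nlinarith

lemma circleRatio_nonneg {a : ℕ → ℝ} {M : ℕ} {ρ : ℝ} (h0 : ∀ i < M, 0 < a i)
    (ha : ∀ i < M, a i < ρ) (hρ0 : 0 < ρ) (hρ1 : ρ < 1) : 0 ≤ circleRatio a M ρ := by
  refine Finset.prod_nonneg fun i hi => ?_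
  have hi := Finset.mem_range.1 hi
  have h1 := h0 i hi
  have h2 := ha i hi
  have h3 : a i / ρ ≤ 1 := (div_le_one hρ0).2 h2.le
  exact div_nonneg (by nlinarith) (by linarith)

/-- Cauchy's theorem on the annulus. It applies to quotients by A', whose zeros all have modulus
less than ρ. -/
lemma circleAverage_comp_mul_eq {f : ℂ → ℂ} {ρ : ℝ} (hρ0 : 0 < ρ) (hρ1 : ρ < 1)
    (hf : ∀ z : ℂ, ρ ≤ ‖z‖ → ‖z‖ ≤ 1 → DifferentiableAt ℂ f z) :
    Real.circleAverage f 0 1 = Real.circleAverage (fun z => f (ρ * z)) 0 1 := by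
  have h := Complex.circleIntegral_sub_center_inv_smul_eq_of_differentiable_on_annulus_off_countable
    (c := 0) hρ0 hρ1.le (f := f) Set.countable_empty
    (fun z hz => (hf z (by simpa using hz.2) (by simpa using hz.1)).continuousAt.continuousWithinAt)
    (fun z hz => by
      have h1 := hz.1.1
      have h2 := hz.1.2
      simp only [mem_ball, mem_closedBall, dist_zero_right, not_le] at h1 h2
      exact hf z h2.le h1.le)
  have e1 := Real.circleAverage_eq_circleIntegral (F := ℂ) (c := 0) (R := 1) (f := f) one_ne_zero
  have e2 := Real.circleAverage_eq_circleIntegral (F := ℂ) (c := 0) (R := ρ) (f := f) hρ0.ne'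
  rw [e1, h, ← e2, Real.circleAverage_eq_circleAverage_zero_one]
  simp

/-- A polynomial `p` of degree at most `k` whose product with `A = ∏ (1 + aᵢ X)` is biorthogonal to
`A, X A, …, X ^ k A` has constant coefficient close to one. -/
theorem one_sub_coeff_zero_le {M k : ℕ} {a : ℕ → ℝ} {ρ : ℝ} (h0 : ∀ i < M, 0 < a i)
    (ha : ∀ i < M, a i < ρ) (hρ0 : 0 < ρ) (hρ1 : ρ < 1) {p : ℝ[X]} (hp : p.natDegree ≤ k)
    (horth : ∀ j ≤ k, polyInner (X ^ j * elemPoly a M) (p * elemPoly a M) =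
      if j = 0 then 1 else 0) :
    1 - p.coeff 0 ≤ (ρ ^ (k + 1) * circleRatio a M ρ) ^ 2 := by
  set A := elemPoly a M with hA
  set A' := elemPolyRev a M with hA'
  set Y := p * A with hY
  set r := p.coeff 0 with hr
  set P := Y * A' with hP
  have hself : polyInner Y Y = r := polyInner_self_of_orthogonal hp horth
  have hr0 : 0 ≤ r := by
    rw [← hself, ← circleAverage_norm_aeval_sq]
    exact Real.circleAverage_nonneg_of_nonneg fun z _ => sq_nonneg _
  have hcomm : ∀ f g : ℝ[X], polyInner f g = polyInner g f := by
    intro f g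
    rw [polyInner_eq_sum_range g (show f.natDegree < f.natDegree + g.natDegree + 1 by omega),
      polyInner_eq_sum_range f (show g.natDegree < f.natDegree + g.natDegree + 1 by omega)]
    simp only [mul_comm]
  have hPc : ∀ j ≤ k, P.coeff (M + j) = if j = 0 then 1 else 0 := fun j hj => by
    rw [hP, hA', coeff_mul_elemPolyRev, hcomm, horth j hj]
  -- By biorthogonality the coefficients of P in degrees M, …, M+k are 1, 0, …, 0. Cutting P at
  -- degree m leaves a low part B of degree M with leading coefficient 1, and X^m E.
  set m := M + k + 1 with hm
  set B := P %ₘ (X ^ m) with hB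
  set E := P /ₘ (X ^ m) with hE
  have hmon : (X ^ m : ℝ[X]).Monic := monic_X_pow m
  have hdecomp : B + X ^ m * E = P := modByMonic_add_div P (X ^ m)
  have hBdeg : B.natDegree < m := by
    have := natDegree_modByMonic_lt P hmon (by
      intro h
      have := congrArg natDegree h
      simp [hm] at this)
    simpa using this
  have hBc : ∀ j < m, B.coeff j = P.coeff j := by
    intro j hj
    rw [← hdecomp, coeff_add, coeff_X_pow_mul', if_neg (by omega), add_zero]
  have hBM : B.coeff M = 1 := by
    have := hPc 0 (Nat.zero_le _)
    rw [hBc M (by omega)]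
    simpa using this
  have hBdegM : B.natDegree ≤ M := by
    rw [natDegree_le_iff_coeff_eq_zero]
    intro N hN
    by_cases hNm : N < m
    · rw [hBc N hNm]
      obtain ⟨j, rfl⟩ := Nat.exists_eq_add_of_lt hN
      have := hPc (j + 1) (by omega)
      simpa [add_assoc] using this
    · exact coeff_eq_zero_of_natDegree_lt (by omega)
  -- Reversal moves the leading coefficient 1 of B to the origin. The quotient B'/A is analytic
  -- beyond the unit disc, equals 1 at 0, and on the circle its conjugate is B/A'.
  set B' := B.reflect M with hB'
  have hB'0 : aeval (0 : ℂ) B' = 1 := by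
    rw [← coeff_zero_eq_aeval_zero', hB', coeff_reflect]
    simp [revAt_le, hBM]
  -- the analytic functions
  set Λ : ℂ → ℂ := fun z => aeval z B' / aeval z A with hΛ
  set G : ℂ → ℂ := fun z => aeval z E / aeval z A with hG
  have hρi : 1 < ρ⁻¹ := (one_lt_inv₀ hρ0).2 hρ1
  have hAne : ∀ z : ℂ, ‖z‖ < ρ⁻¹ → aeval z A ≠ 0 := fun z hz =>
    aeval_elemPoly_ne_zero h0 ha hρ0 hz
  have hA'ne : ∀ z : ℂ, ρ ≤ ‖z‖ → aeval z A' ≠ 0 := fun z hz => aeval_elemPolyRev_ne_zero h0 ha hz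
  have hdiffq : ∀ f : ℝ[X], ∀ z : ℂ, ‖z‖ < ρ⁻¹ →
      DifferentiableAt ℂ (fun z : ℂ => aeval z f / aeval z A) z := fun f z hz =>
    (f.differentiable_aeval z).div (A.differentiable_aeval z) (hAne z hz)
  have hpow : ∀ f : ℝ[X], ∃ c : ℕ → ℂ, (Summable fun n => ‖c n‖) ∧
      ∀ z ∈ closedBall (0 : ℂ) 1, HasSum (fun n => c n * z ^ n) (aeval z f / aeval z A) :=
    fun f => exists_hasSum_pow_of_differentiableOn hρi fun z hz =>
      (hdiffq f z (by simpa using hz)).differentiableWithinAt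
  have hcontq : ∀ f : ℝ[X], ContinuousOn (fun z : ℂ => aeval z f / aeval z A) (closedBall 0 1) :=
    fun f z hz => (hdiffq f z (lt_of_le_of_lt (by simpa using hz) hρi)).continuousAt.continuousWithinAt
  have hsph : sphere (0 : ℂ) 1 ⊆ closedBall 0 1 := sphere_subset_closedBall
  have hΛc : ContinuousOn Λ (sphere 0 1) := (hcontq B').mono hsph
  have hGc : ContinuousOn G (sphere 0 1) := (hcontq E).mono hsph
  have hYc : Continuous fun z : ℂ => aeval z Y := Y.continuous_aeval
  -- on the circle
  have hconjΛ : ∀ z ∈ sphere (0 : ℂ) 1, conj (Λ z) * aeval z A' = aeval z B := by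
    intro z hz
    have h1 := mul_conj_of_mem_sphere hz
    have hz0 : z ≠ 0 := by
      rintro rfl
      simp at hz
    have h2 : conj (aeval z B') * z ^ M = aeval z B := by
      rw [conj_aeval, (eq_inv_of_mul_eq_one_right h1), hB']
      let _ : Invertible z := invertibleOfNonzero hz0
      rw [← invOf_eq_inv]
      exact eval₂_reflect_mul_pow (algebraMap ℝ ℂ) z M B hBdegM
    have hAz := hAne z (by
      have : ‖z‖ = 1 := by simpa using hz
      rw [this]; exact hρi)
    have hAz' : conj (aeval z A) ≠ 0 := by simpa using hAz
    rw [hA', aeval_elemPolyRev_of_mem_sphere a M hz, ← h2, hΛ]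
    simp only [map_div₀, ← hA]
    field_simp
  -- On the circle Y = P/A', so Y is the conjugate of Λ plus a remainder whose modulus is |E/A| =
  -- |G|.
  have hR : ∀ z ∈ sphere (0 : ℂ) 1, aeval z Y - conj (Λ z) = z ^ m * aeval z E / aeval z A' := by
    intro z hz
    have hz1 : ‖z‖ = 1 := by simpa using hz
    have h1 := hA'ne z (by rw [hz1]; exact hρ1.le)
    rw [eq_div_iff h1, sub_mul, hconjΛ z hz]
    have := congrArg (aeval z) hdecomp
    simp only [hP, map_add, map_mul, map_pow, aeval_X] at this
    rw [← this]; ring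
  have hnormA : ∀ z ∈ sphere (0 : ℂ) 1, ‖aeval z A'‖ = ‖aeval z A‖ := by
    intro z hz
    rw [hA', aeval_elemPolyRev_of_mem_sphere a M hz, norm_mul, norm_pow_of_mem_sphere hz, one_mul]
    exact Complex.norm_conj _
  set ℓ := Real.circleAverage (fun z => ‖Λ z‖ ^ 2) 0 1 with hℓ
  have hΛ0 : Λ 0 = 1 := by
    have hA0 : aeval (0 : ℂ) A = 1 := by
      rw [← coeff_zero_eq_aeval_zero', hA, elemPoly_coeff_zero]; simp
    simp [hΛ, hB'0, hA0]
  have hmean : ∀ f : ℂ → ℂ, (∀ z : ℂ, ‖z‖ < ρ⁻¹ → DifferentiableAt ℂ f z) →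
      Real.circleAverage f 0 1 = f 0 := by
    intro f hf
    refine DiffContOnCl.circleAverage (DifferentiableOn.diffContOnCl fun z hz => ?_)
    have : z ∈ closedBall (0 : ℂ) 1 := by simpa using closure_ball_subset_closedBall hz
    exact (hf z (lt_of_le_of_lt (by simpa using this) hρi)).differentiableWithinAt
  have hΛmean : Real.circleAverage Λ 0 1 = 1 := by
    rw [hmean Λ (fun z hz => hdiffq B' z hz), hΛ0]
  have hYΛ : Real.circleAverage (fun z => aeval z Y * Λ z) 0 1 = (r : ℂ) := by
    rw [hmean (fun z => aeval z Y * Λ z) fun z hz =>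
      (Y.differentiable_aeval z).mul (hdiffq B' z hz), hΛ0, mul_one,
      ← coeff_zero_eq_aeval_zero', hY, mul_coeff_zero, hA, elemPoly_coeff_zero, mul_one]
    rfl
  have hexpand : ∀ u v : ℂ, ‖u - v‖ ^ 2 = ‖u‖ ^ 2 - 2 * (u * conj v).re + ‖v‖ ^ 2 := by
    intro u v
    rw [← Complex.normSq_eq_norm_sq, ← Complex.normSq_eq_norm_sq, ← Complex.normSq_eq_norm_sq,
      Complex.normSq_sub]
    ring
  have hquad : ∀ f : ℂ → ℂ, Continuous f → Real.circleAverage (fun z => ‖f z - conj (Λ z)‖ ^ 2) 0 1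
      = Real.circleAverage (fun z => ‖f z‖ ^ 2) 0 1
        - 2 * (Real.circleAverage (fun z => f z * Λ z) 0 1).re + ℓ := by
    intro f hf
    have hfΛ : ContinuousOn (fun z => f z * Λ z) (sphere 0 1) := hf.continuousOn.mul hΛc
    have hre : ContinuousOn (fun z => (f z * Λ z).re) (sphere 0 1) :=
      Complex.continuous_re.comp_continuousOn hfΛ
    have e : (fun z => ‖f z - conj (Λ z)‖ ^ 2) =
        fun z => (‖f z‖ ^ 2 - (2 : ℝ) • (f z * Λ z).re) + ‖Λ z‖ ^ 2 := by
      funext z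
      rw [hexpand]
      simp
    rw [e, Real.circleAverage_fun_add, Real.circleAverage_fun_sub, Real.circleAverage_fun_smul,
      circleAverage_re hfΛ, smul_eq_mul]
    all_goals
      apply circleIntegrable_of_continuousOn_sphere
      fun_prop
  -- Λ has mean 1, so the mean of |1 - conj Λ|² equals ℓ - 1.
  have hℓ1 : 1 ≤ ℓ := by
    have h1 := hquad (fun _ => 1) continuous_const
    have h2 : 0 ≤ Real.circleAverage (fun z => ‖1 - conj (Λ z)‖ ^ 2) 0 1 :=
      Real.circleAverage_nonneg_of_nonneg fun z _ => sq_nonneg _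
    simp only [one_mul, hΛmean, norm_one, one_pow, Complex.one_re, Real.circleAverage_const] at h1
    linarith
  -- The mean square of Y is r and the mean of YΛ is Y(0)Λ(0) = r, so the remainder has mean square
  -- r - 2r + ℓ.
  have hb2 : Real.circleAverage (fun z => ‖G z‖ ^ 2) 0 1 = ℓ - r := by
    have h1 := hquad (fun z => aeval z Y) hYc
    rw [hYΛ, Complex.ofReal_re, circleAverage_norm_aeval_sq, hself] at h1
    have h2 : Real.circleAverage (fun z => ‖G z‖ ^ 2) 0 1 =
        Real.circleAverage (fun z => ‖aeval z Y - conj (Λ z)‖ ^ 2) 0 1 := by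
      refine Real.circleAverage_congr_sphere fun z hz => ?_
      have hz : z ∈ sphere (0 : ℂ) 1 := by simpa using hz
      have hGz : ‖G z‖ = ‖aeval z E‖ / ‖aeval z A‖ := norm_div _ _
      rw [hGz, hR z hz, norm_div, norm_mul, norm_pow_of_mem_sphere hz, one_mul, hnormA z hz]
    rw [h2, h1]; ring
  -- H is the remainder times Λ. Its mean is r - ℓ, and since H is analytic for ρ ≤ |z| ≤ 1 the mean
  -- may be taken on |z| = ρ, where z^m is small.
  set H : ℂ → ℂ := fun z => (z ^ m * aeval z E / aeval z A') * Λ z with hH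
  have hHmean : Real.circleAverage H 0 1 = ((r - ℓ : ℝ) : ℂ) := by
    have e : Real.circleAverage H 0 1 =
        Real.circleAverage (fun z => aeval z Y * Λ z - ((‖Λ z‖ ^ 2 : ℝ) : ℂ)) 0 1 := by
      refine Real.circleAverage_congr_sphere fun z hz => ?_
      have hz : z ∈ sphere (0 : ℂ) 1 := by simpa using hz
      simp only [hH]
      rw [← hR z hz, sub_mul, mul_comm (conj (Λ z)), Complex.mul_conj, Complex.normSq_eq_norm_sq]
    have hΛsq : ContinuousOn (fun z => ‖Λ z‖ ^ 2) (sphere 0 1) := hΛc.norm.pow 2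
    rw [e, Real.circleAverage_fun_sub, hYΛ, circleAverage_ofReal hΛsq, Complex.ofReal_sub]
    · exact circleIntegrable_of_continuousOn_sphere (hYc.continuousOn.mul hΛc)
    · exact circleIntegrable_of_continuousOn_sphere
        (Complex.continuous_ofReal.comp_continuousOn hΛsq)
  have hshift : Real.circleAverage H 0 1 = Real.circleAverage (fun z => H (ρ * z)) 0 1 := by
    refine circleAverage_comp_mul_eq hρ0 hρ1 fun z hz1 hz2 => ?_
    exact ((((differentiable_id.pow m) z).mul (E.differentiable_aeval z)).div
      (A'.differentiable_aeval z) (hA'ne z hz1)).mul (hdiffq B' z (lt_of_le_of_lt hz2 hρi))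
  set ε := ρ ^ (k + 1) * circleRatio a M ρ with hε
  have hε0 : 0 ≤ ε := mul_nonneg (by positivity) (circleRatio_nonneg h0 ha hρ0 hρ1)
  have hscale : ∀ z ∈ sphere (0 : ℂ) 1, ‖(ρ : ℂ) * z‖ = ρ := by
    intro z hz
    have hz1 : ‖z‖ = 1 := by simpa using hz
    rw [norm_mul, hz1, Complex.norm_real, Real.norm_of_nonneg hρ0.le, mul_one]
  have hHbound : ∀ z ∈ sphere (0 : ℂ) 1, ‖H (ρ * z)‖ ≤ ε * (‖G (ρ * z)‖ * ‖Λ (ρ * z)‖) := by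
    intro z hz
    have hw := hscale z hz
    set w := (ρ : ℂ) * z
    have h1 := norm_elemPoly_le h0 ha hρ0 hρ1 hw
    have h2 : 0 < ‖aeval w A'‖ := norm_pos_iff.2 (hA'ne w hw.ge)
    have h3 : 0 < ‖aeval w A‖ := norm_pos_iff.2 (hAne w (by rw [hw]; linarith))
    have hGw : ‖G w‖ = ‖aeval w E‖ / ‖aeval w A‖ := norm_div _ _
    simp only [hH]
    rw [norm_mul, norm_div, norm_mul, norm_pow, hGw, hw, ← mul_assoc]
    gcongr
    rw [div_le_iff₀ h2, hm, hε]
    calc ρ ^ (M + k + 1) * ‖aeval w E‖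
        = ρ ^ (k + 1) * (ρ ^ M * ‖aeval w A‖) * (‖aeval w E‖ / ‖aeval w A‖) := by
          field_simp
          ring
      _ ≤ ρ ^ (k + 1) * (circleRatio a M ρ * ‖aeval w A'‖) * (‖aeval w E‖ / ‖aeval w A‖) := by
          gcongr
      _ = _ := by ring
  have hmaps : Set.MapsTo (fun z : ℂ => (ρ : ℂ) * z) (sphere 0 1) (closedBall 0 1) := by
    intro z hz
    have := hscale z hz
    simp only [mem_closedBall, dist_zero_right, this, hρ1.le]
  have hGρ : ContinuousOn (fun z : ℂ => ‖G (ρ * z)‖) (sphere 0 1) :=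
    ((hcontq E).comp (by fun_prop) hmaps).norm
  have hΛρ : ContinuousOn (fun z : ℂ => ‖Λ (ρ * z)‖) (sphere 0 1) :=
    ((hcontq B').comp (by fun_prop) hmaps).norm
  have hHρ : ContinuousOn (fun z : ℂ => ‖H (ρ * z)‖) (sphere 0 1) := by
    intro z hz
    have hw := hscale z hz
    have hd : DifferentiableAt ℂ H (ρ * z) :=
      ((((differentiable_id.pow m) (ρ * z)).mul (E.differentiable_aeval (ρ * z))).div
        (A'.differentiable_aeval (ρ * z)) (hA'ne (ρ * z) hw.ge)).mul
        (hdiffq B' (ρ * z) (by rw [hw]; linarith))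
    have : ContinuousAt (fun z : ℂ => H (ρ * z)) z :=
      ContinuousAt.comp (f := fun z : ℂ => (ρ : ℂ) * z) hd.continuousAt (by fun_prop)
    exact this.norm.continuousWithinAt
  -- On the small circle |H| ≤ ε|G||Λ|. Cauchy–Schwarz and the growth of quadratic means with the
  -- radius bring back the mean squares on the unit circle, ℓ - r for G and ℓ for Λ.
  have hfinal : (ℓ - r) ^ 2 ≤ ε ^ 2 * ((ℓ - r) * ℓ) := by
    have h1 : |r - ℓ| ≤ ε * Real.circleAverage (fun z => ‖G (ρ * z)‖ * ‖Λ (ρ * z)‖) 0 1 := by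
      calc |r - ℓ| = ‖Real.circleAverage (fun z => H (ρ * z)) 0 1‖ := by
            rw [← hshift, hHmean, Complex.norm_real, Real.norm_eq_abs]
        _ ≤ Real.circleAverage (fun z => ‖H (ρ * z)‖) 0 1 := norm_circleAverage_le _
        _ ≤ Real.circleAverage (fun z => ε • (‖G (ρ * z)‖ * ‖Λ (ρ * z)‖)) 0 1 := by
            refine Real.circleAverage_mono (circleIntegrable_of_continuousOn_sphere hHρ)
              (circleIntegrable_of_continuousOn_sphere (by fun_prop)) fun z hz => ?_
            exact hHbound z (by simpa using hz)
        _ = _ := by rw [Real.circleAverage_fun_smul, smul_eq_mul]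
    have h2 := circleAverage_mul_sq_le hGρ hΛρ
    obtain ⟨cE, hcE, hE'⟩ := hpow E
    obtain ⟨cB, hcB, hB''⟩ := hpow B'
    have h3 := circleAverage_norm_sq_comp_mul_le hcE hE' hρ0.le hρ1.le
    have h4 := circleAverage_norm_sq_comp_mul_le hcB hB'' hρ0.le hρ1.le
    change _ ≤ Real.circleAverage (fun z => ‖G z‖ ^ 2) 0 1 at h3
    change _ ≤ ℓ at h4
    rw [hb2] at h3
    have h5 : 0 ≤ Real.circleAverage (fun z : ℂ => ‖Λ (ρ * z)‖ ^ 2) 0 1 :=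
      Real.circleAverage_nonneg_of_nonneg fun z _ => sq_nonneg _
    have h6 : 0 ≤ Real.circleAverage (fun z : ℂ => ‖G (ρ * z)‖ ^ 2) 0 1 :=
      Real.circleAverage_nonneg_of_nonneg fun z _ => sq_nonneg _
    calc (ℓ - r) ^ 2 = |r - ℓ| ^ 2 := by rw [sq_abs]; ring
      _ ≤ (ε * Real.circleAverage (fun z => ‖G (ρ * z)‖ * ‖Λ (ρ * z)‖) 0 1) ^ 2 := by gcongr
      _ = ε ^ 2 * (Real.circleAverage (fun z => ‖G (ρ * z)‖ * ‖Λ (ρ * z)‖) 0 1) ^ 2 := mul_pow _ _ _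
      _ ≤ ε ^ 2 * ((ℓ - r) * ℓ) := by
          gcongr
          exact h2.trans (mul_le_mul h3 h4 h5 (h6.trans h3))
  have hb0 : 0 ≤ ℓ - r := by
    rw [← hb2]
    exact Real.circleAverage_nonneg_of_nonneg fun z _ => sq_nonneg _
  have hlin : ℓ - r ≤ ε ^ 2 * ℓ := by
    rcases hb0.eq_or_lt with h | h
    · rw [← h]; positivity
    · have : (ℓ - r) * (ℓ - r) ≤ (ℓ - r) * (ε ^ 2 * ℓ) := by nlinarith
      exact le_of_mul_le_mul_left this h
  -- Here r ≥ (1 - ε²)ℓ ≥ 1 - ε² since ℓ ≥ 1; when ε > 1 the bound r ≥ 0 is already enough.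
  by_cases hε1 : ε ^ 2 ≤ 1
  · nlinarith
  · push Not at hε1
    linarith

end UpperTail

end

noncomputable section

/-! ### Lower tail: the well V and its slope z V'. -/

section LowerTail

open Polynomial ComplexConjugate Metric

/-- The geometric series `1 / (1 + (1 - d) z)`, peaked near `z = -1`. -/
def peak (d : ℝ) (z : ℂ) : ℂ := (1 + (1 - d : ℝ) * z)⁻¹

/-- The analytic completion of a multiple of `‖1 + (1 - d) z‖ ^ (-4)` on the unit circle. -/
def well (d : ℝ) (z : ℂ) : ℂ :=
  (d ^ 3 / 16 : ℝ) * (2 * peak d z ^ 2 + (4 * (1 - d) ^ 2 / (1 - (1 - d) ^ 2) : ℝ) * peak d z +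
    (1 - 2 / (1 - (1 - d) ^ 2) : ℝ))

/-- The value of `well` at the origin. -/
def wellZero (d : ℝ) : ℝ := d ^ 3 / 16 * ((1 + (1 - d) ^ 2) / (1 - (1 - d) ^ 2))

/-- The function `z V'(z)` for `V = well d`. -/
def wellSlope (d : ℝ) (z : ℂ) : ℂ :=
  -(d ^ 3 / 16 : ℝ) * (1 - peak d z) *
    (4 * peak d z ^ 2 + (4 * (1 - d) ^ 2 / (1 - (1 - d) ^ 2) : ℝ) * peak d z)

lemma HasSum.congr_sum {ι α : Type*} [AddCommMonoid α] [TopologicalSpace α] {f : ι → α} {a b : α}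
    (h : HasSum f a) (hab : a = b) : HasSum f b := hab ▸ h

variable {d : ℝ}

lemma one_sub_sq_pos (hd0 : 0 < d) (hd1 : d < 1) : 0 < 1 - (1 - d) ^ 2 := by nlinarith

lemma wellSlope_zero : wellSlope d 0 = 0 := by simp [wellSlope, peak]

lemma norm_mul_lt_one (hd1 : d < 1) {z : ℂ} (hz : ‖z‖ < (1 - d)⁻¹) :
    ‖-((1 - d : ℝ) * z)‖ < 1 := by
  rw [norm_neg, norm_mul, Complex.norm_real, Real.norm_of_nonneg (by linarith)]
  have h : 0 < 1 - d := by linarith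
  calc (1 - d) * ‖z‖ < (1 - d) * (1 - d)⁻¹ := by gcongr
    _ = 1 := mul_inv_cancel₀ h.ne'

lemma one_add_mul_ne_zero (hd1 : d < 1) {z : ℂ} (hz : ‖z‖ < (1 - d)⁻¹) :
    1 + (1 - d : ℝ) * z ≠ 0 := by
  intro h
  have h1 := norm_mul_lt_one hd1 hz
  rw [← eq_neg_of_add_eq_zero_left h] at h1
  simp at h1

lemma one_lt_inv_one_sub (hd0 : 0 < d) (hd1 : d < 1) : 1 < (1 - d)⁻¹ :=
  (one_lt_inv₀ (by linarith)).2 (by linarith)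

lemma differentiableAt_peak (hd1 : d < 1) {z : ℂ} (hz : ‖z‖ < (1 - d)⁻¹) :
    DifferentiableAt ℂ (peak d) z := by
  unfold peak
  exact DifferentiableAt.inv (by fun_prop) (one_add_mul_ne_zero hd1 hz)

lemma differentiableAt_wellSlope (hd1 : d < 1) {z : ℂ} (hz : ‖z‖ < (1 - d)⁻¹) :
    DifferentiableAt ℂ (wellSlope d) z := by
  have := differentiableAt_peak hd1 hz
  unfold wellSlope
  fun_prop

lemma hasSum_peak_pow (hd1 : d < 1) {z : ℂ} (hz : ‖z‖ < (1 - d)⁻¹) (k : ℕ) :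
    HasSum (fun n => (((n + k).choose k : ℝ) * (-(1 - d)) ^ n : ℝ) * z ^ n)
      (peak d z ^ (k + 1)) := by
  have h := hasSum_choose_mul_geometric_of_norm_lt_one k (norm_mul_lt_one hd1 hz)
  have e : peak d z ^ (k + 1) = 1 / (1 - -((1 - d : ℝ) * z)) ^ (k + 1) := by
    simp [peak]
  rw [e]
  refine h.congr_fun fun n => ?_
  push_cast
  rw [mul_assoc, ← mul_pow]
  ring

/-- The Taylor coefficients of `well` beyond the constant one. -/
def wellCoeff (d : ℝ) (n : ℕ) : ℝ :=
  d ^ 3 / 16 * ((2 * (n + 1) + 4 * (1 - d) ^ 2 / (1 - (1 - d) ^ 2)) * (-(1 - d)) ^ n)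

lemma hasSum_well (hd0 : 0 < d) (hd1 : d < 1) {z : ℂ} (hz : ‖z‖ < (1 - d)⁻¹) :
    HasSum (fun n : ℕ => if n = 0 then 0 else (wellCoeff d n : ℂ) * z ^ n)
      (well d z - wellZero d) := by
  have h1 := hasSum_peak_pow hd1 hz 0
  have h2 := hasSum_peak_pow hd1 hz 1
  have h3 := ((h2.mul_left 2).add
    (h1.mul_left ((4 * (1 - d) ^ 2 / (1 - (1 - d) ^ 2) : ℝ) : ℂ))).mul_left ((d ^ 3 / 16 : ℝ) : ℂ)
  -- `wellCoeff` leaves out the additive constant in `well`, so the term n = 0 of its series is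
  -- overwritten.
  have h4 := h3.update 0 0
  have h := one_sub_sq_pos hd0 hd1
  have h' : (1 - (1 - (d : ℂ)) ^ 2) ≠ 0 := by
    have := h.ne'
    exact_mod_cast this
  refine (HasSum.congr_fun h4 fun n => ?_).congr_sum ?_
  · by_cases hn : n = 0
    · simp [hn]
    · rw [if_neg hn, Function.update_of_ne hn, wellCoeff]
      simp only [Nat.choose_one_right, Nat.choose_zero_right, Nat.cast_one]
      push_cast
      ring
  · simp only [well, wellZero]
    simp only [Nat.choose_one_right, Nat.choose_zero_right, Nat.cast_one, add_zero, pow_zero]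
    push_cast
    field_simp
    ring

/-- Since z peak' = -(1 - peak) peak, the slope is d³/16 times 4p³ + (β-4)p² - βp with p = peak and
β = 4(1-d)²/(1-(1-d)²); each power of p has a binomial series. -/
lemma hasSum_wellSlope (hd1 : d < 1) {z : ℂ} (hz : ‖z‖ < (1 - d)⁻¹) :
    HasSum (fun n : ℕ => ((n * wellCoeff d n : ℝ) : ℂ) * z ^ n) (wellSlope d z) := by
  have h1 := hasSum_peak_pow hd1 hz 0
  have h2 := hasSum_peak_pow hd1 hz 1
  have h3 := hasSum_peak_pow hd1 hz 2
  have h4 := (((h3.mul_left 4).add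
    (h2.mul_left ((4 * (1 - d) ^ 2 / (1 - (1 - d) ^ 2) - 4 : ℝ) : ℂ))).sub
    (h1.mul_left ((4 * (1 - d) ^ 2 / (1 - (1 - d) ^ 2) : ℝ) : ℂ))).mul_left ((d ^ 3 / 16 : ℝ) : ℂ)
  refine (HasSum.congr_fun h4 fun n => ?_).congr_sum ?_
  · have e : ((n + 2).choose 2 : ℂ) = ((n : ℂ) + 2) * ((n : ℂ) + 1) / 2 := by
      rw [Nat.cast_choose_two]
      push_cast
      ring
    rw [wellCoeff]
    simp only [Nat.choose_one_right, Nat.choose_zero_right, Nat.cast_one]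
    push_cast
    rw [e]
    ring
  · simp only [wellSlope]
    push_cast
    ring

lemma summable_norm_wellSlope_coeff (hd0 : 0 < d) (hd1 : d < 1) :
    Summable fun n : ℕ => ‖((n * wellCoeff d n : ℝ) : ℂ)‖ := by
  have h := (hasSum_wellSlope hd1 (z := 1) (by
    rw [norm_one]; exact one_lt_inv_one_sub hd0 hd1)).summable.norm
  simpa using h

lemma peak_conj (z : ℂ) : peak d (conj z) = conj (peak d z) := by simp [peak]

lemma well_conj (z : ℂ) : well d (conj z) = conj (well d z) := by
  simp only [well, map_mul, map_add, map_pow, map_ofNat, Complex.conj_ofReal, peak_conj]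

/-- Take norms in 1 - peak = (1-d) z peak; equality holds for |z| = 1. -/
lemma norm_peak_sq_le (hd0 : 0 < d) (hd1 : d < 1) {z : ℂ} (hz : ‖z‖ ≤ 1) :
    (1 - (1 - d) ^ 2) * ‖peak d z‖ ^ 2 ≤ 2 * (peak d z).re - 1 := by
  have hne := one_add_mul_ne_zero hd1 (hz.trans_lt (one_lt_inv_one_sub hd0 hd1))
  have h1 : (1 + (1 - d : ℝ) * z) * peak d z = 1 := mul_inv_cancel₀ hne
  have h2 : ‖1 - peak d z‖ ^ 2 ≤ ((1 - d) * ‖peak d z‖) ^ 2 := by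
    have : 1 - peak d z = (1 - d : ℝ) * z * peak d z := by linear_combination -h1
    rw [this, norm_mul, norm_mul, Complex.norm_real, Real.norm_of_nonneg (by linarith)]
    gcongr
    nlinarith [norm_nonneg z]
  rw [mul_pow, ← Complex.normSq_eq_norm_sq, ← Complex.normSq_eq_norm_sq, Complex.normSq_sub] at h2
  rw [← Complex.normSq_eq_norm_sq]
  simp at h2
  linarith

/-- The bound on |peak|² gives Re V ≥ d³/16 (2 Re peak - 1)², with equality on the circle. -/
lemma well_re_nonneg (hd0 : 0 < d) (hd1 : d < 1) {z : ℂ} (hz : ‖z‖ ≤ 1) : 0 ≤ (well d z).re := by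
  have h := one_sub_sq_pos hd0 hd1
  have h1 := norm_peak_sq_le hd0 hd1 hz
  rw [well, Complex.re_ofReal_mul]
  refine mul_nonneg (by positivity) ?_
  set y := peak d z
  set c := 1 - (1 - d) ^ 2 with hc
  have e : (1 - d) ^ 2 = 1 - c := by rw [hc]; ring
  rw [← Complex.normSq_eq_norm_sq, Complex.normSq_apply] at h1
  have h2 : (2 * y ^ 2 + (4 * (1 - d) ^ 2 / c : ℝ) * y + (1 - 2 / c : ℝ)).re =
      2 * (y.re ^ 2 - y.im ^ 2) + 4 * (1 - c) / c * y.re + (1 - 2 / c) := by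
    rw [← e]
    simp [pow_two]
  rw [h2]
  have h3 : y.re * y.re + y.im * y.im ≤ (2 * y.re - 1) / c := by
    rw [le_div_iff₀ h]; linarith
  have h4 : 2 * (2 * y.re ^ 2 - (2 * y.re - 1) / c) + 4 * (1 - c) / c * y.re + (1 - 2 / c) =
      (2 * y.re - 1) ^ 2 := by
    field_simp
    ring
  nlinarith [sq_nonneg (2 * y.re - 1)]

lemma norm_peak_le (hd0 : 0 < d) (hd1 : d < 1) {z : ℂ} (hz : ‖z‖ ≤ 1) : ‖peak d z‖ ≤ d⁻¹ := by
  rw [peak, norm_inv]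
  refine inv_anti₀ hd0 ?_
  have h1 : ‖((1 - d : ℝ) : ℂ) * z‖ ≤ 1 - d := by
    rw [norm_mul, Complex.norm_real, Real.norm_of_nonneg (by linarith)]
    nlinarith [norm_nonneg z]
  have h2 := norm_sub_norm_le (1 : ℂ) (-(((1 - d : ℝ) : ℂ) * z))
  rw [norm_neg, norm_one, sub_neg_eq_add] at h2
  linarith

/-- The factor d³/16 in the well is made for this: since |peak| ≤ 1/d, the slope stays below 1/2,
which keeps the density below at least 1/2 on the circle. -/
lemma norm_wellSlope_le (hd0 : 0 < d) (hd1 : d < 1) {z : ℂ} (hz : ‖z‖ ≤ 1) :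
    ‖wellSlope d z‖ ≤ d ^ 2 / 2 * ‖peak d z‖ ^ 2 := by
  have h := one_sub_sq_pos hd0 hd1
  have hp := norm_peak_le hd0 hd1 hz
  have hne := one_add_mul_ne_zero hd1 (hz.trans_lt (one_lt_inv_one_sub hd0 hd1))
  have h1 : (1 + (1 - d : ℝ) * z) * peak d z = 1 := mul_inv_cancel₀ hne
  have h2 : ‖1 - peak d z‖ ≤ ‖peak d z‖ := by
    have : 1 - peak d z = (1 - d : ℝ) * z * peak d z := by linear_combination -h1
    rw [this, norm_mul, norm_mul, Complex.norm_real, Real.norm_of_nonneg (by linarith)]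
    refine mul_le_of_le_one_left (norm_nonneg _) ?_
    nlinarith [norm_nonneg z]
  have hβ : 4 * (1 - d) ^ 2 / (1 - (1 - d) ^ 2) ≤ 4 / d := by
    rw [div_le_div_iff₀ h hd0]
    nlinarith
  have hβ0 : 0 ≤ 4 * (1 - d) ^ 2 / (1 - (1 - d) ^ 2) := by positivity
  set β := 4 * (1 - d) ^ 2 / (1 - (1 - d) ^ 2)
  set y := peak d z
  have h3 : ‖4 * y ^ 2 + (β : ℂ) * y‖ ≤ 8 / d * ‖y‖ := by
    calc ‖4 * y ^ 2 + (β : ℂ) * y‖ ≤ ‖4 * y ^ 2‖ + ‖(β : ℂ) * y‖ := norm_add_le _ _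
      _ = 4 * ‖y‖ * ‖y‖ + β * ‖y‖ := by
          rw [norm_mul, norm_mul, norm_pow, Complex.norm_real, Real.norm_of_nonneg hβ0]
          norm_num
          ring
      _ ≤ 4 * d⁻¹ * ‖y‖ + 4 / d * ‖y‖ := by gcongr
      _ = 8 / d * ‖y‖ := by field_simp; ring
  rw [wellSlope, norm_mul, norm_mul, norm_neg, Complex.norm_real,
    Real.norm_of_nonneg (by positivity)]
  calc d ^ 3 / 16 * ‖1 - y‖ * ‖4 * y ^ 2 + (β : ℂ) * y‖
      ≤ d ^ 3 / 16 * ‖y‖ * (8 / d * ‖y‖) := by gcongr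
    _ = d ^ 2 / 2 * ‖y‖ ^ 2 := by field_simp; ring

lemma norm_wellSlope_le_half (hd0 : 0 < d) (hd1 : d < 1) {z : ℂ} (hz : ‖z‖ ≤ 1) :
    ‖wellSlope d z‖ ≤ 1 / 2 := by
  refine (norm_wellSlope_le hd0 hd1 hz).trans ?_
  have hp := norm_peak_le hd0 hd1 hz
  calc d ^ 2 / 2 * ‖peak d z‖ ^ 2 ≤ d ^ 2 / 2 * (d⁻¹) ^ 2 := by gcongr
    _ = 1 / 2 := by field_simp

lemma norm_le_of_mem_sphere {z : ℂ} (hz : z ∈ sphere (0 : ℂ) 1) : ‖z‖ ≤ 1 := by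
  have : ‖z‖ = 1 := by simpa using hz
  exact this.le

lemma continuousOn_of_differentiableAt {f : ℂ → ℂ} {R : ℝ} (hR : 1 < R)
    (hf : ∀ z : ℂ, ‖z‖ < R → DifferentiableAt ℂ f z) : ContinuousOn f (sphere 0 1) :=
  fun z hz => (hf z ((norm_le_of_mem_sphere hz).trans_lt hR)).continuousAt.continuousWithinAt

lemma circleAverage_eq_of_differentiableAt {f : ℂ → ℂ} {R : ℝ} (hR : 1 < R)
    (hf : ∀ z : ℂ, ‖z‖ < R → DifferentiableAt ℂ f z) : Real.circleAverage f 0 1 = f 0 := by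
  refine DiffContOnCl.circleAverage (DifferentiableOn.diffContOnCl fun z hz => ?_)
  have : z ∈ closedBall (0 : ℂ) 1 := by simpa using closure_ball_subset_closedBall hz
  exact (hf z (lt_of_le_of_lt (by simpa using this) hR)).differentiableWithinAt

/-- Average the pointwise bound of `norm_peak_sq_le`; the mean of Re peak is peak(0) = 1. -/
lemma circleAverage_norm_peak_sq_le (hd0 : 0 < d) (hd1 : d < 1) :
    Real.circleAverage (fun z => ‖peak d z‖ ^ 2) 0 1 ≤ d⁻¹ := by
  have hc := continuousOn_of_differentiableAt (one_lt_inv_one_sub hd0 hd1)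
    fun z hz => differentiableAt_peak hd1 hz
  have h0 := circleAverage_eq_of_differentiableAt (one_lt_inv_one_sub hd0 hd1)
    fun z hz => differentiableAt_peak hd1 hz
  have h := one_sub_sq_pos hd0 hd1
  have hre : ContinuousOn (fun z => (peak d z).re) (sphere 0 1) :=
    Complex.continuous_re.comp_continuousOn hc
  have h1 : Real.circleAverage (fun z => ‖peak d z‖ ^ 2) 0 1 ≤
      Real.circleAverage (fun z => (1 - (1 - d) ^ 2)⁻¹ • ((2 : ℝ) • (peak d z).re - 1)) 0 1 := by
    refine Real.circleAverage_mono (circleIntegrable_of_continuousOn_sphere (hc.norm.pow 2))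
      (circleIntegrable_of_continuousOn_sphere (by fun_prop)) fun z hz => ?_
    have := norm_peak_sq_le hd0 hd1 (norm_le_of_mem_sphere (by simpa using hz))
    rw [smul_eq_mul, smul_eq_mul, ← div_eq_inv_mul, le_div_iff₀ h]
    linarith
  refine h1.trans ?_
  rw [Real.circleAverage_fun_smul, Real.circleAverage_fun_sub, Real.circleAverage_fun_smul,
    circleAverage_re hc, h0, Real.circleAverage_const]
  · simp only [peak]
    norm_num
    exact inv_anti₀ hd0 (by nlinarith)
  all_goals
    apply circleIntegrable_of_continuousOn_sphere
    fun_prop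

/-- This second moment bounds the relative entropy of the dip density with respect to the uniform
measure, and is the source of the loss d/4 in `wellGain`. -/
lemma circleAverage_wellSlope_re_sq_le (hd0 : 0 < d) (hd1 : d < 1) :
    Real.circleAverage (fun z => (wellSlope d z).re ^ 2) 0 1 ≤ d / 4 := by
  have hc := continuousOn_of_differentiableAt (one_lt_inv_one_sub hd0 hd1)
    fun z hz => differentiableAt_peak hd1 hz
  have hc' := continuousOn_of_differentiableAt (one_lt_inv_one_sub hd0 hd1)
    fun z hz => differentiableAt_wellSlope hd1 hz
  have hre : ContinuousOn (fun z => (wellSlope d z).re) (sphere 0 1) :=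
    Complex.continuous_re.comp_continuousOn hc'
  have h1 : Real.circleAverage (fun z => (wellSlope d z).re ^ 2) 0 1 ≤
      Real.circleAverage (fun z => (d ^ 2 / 4) • ‖peak d z‖ ^ 2) 0 1 := by
    refine Real.circleAverage_mono (circleIntegrable_of_continuousOn_sphere (hre.pow 2))
      (circleIntegrable_of_continuousOn_sphere (by fun_prop)) fun z hz => ?_
    have hz1 := norm_le_of_mem_sphere (z := z) (by simpa using hz)
    have h2 := norm_wellSlope_le hd0 hd1 hz1
    have hp := norm_peak_le hd0 hd1 hz1
    have h3 : ‖wellSlope d z‖ ^ 2 ≤ (d ^ 2 / 2 * ‖peak d z‖ ^ 2) ^ 2 := by gcongr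
    have h4 : (wellSlope d z).re ^ 2 ≤ ‖wellSlope d z‖ ^ 2 := by
      rw [← sq_abs]
      gcongr
      exact Complex.abs_re_le_norm _
    rw [smul_eq_mul]
    calc (wellSlope d z).re ^ 2 ≤ (d ^ 2 / 2 * ‖peak d z‖ ^ 2) ^ 2 := h4.trans h3
      _ = d ^ 4 / 4 * ‖peak d z‖ ^ 2 * ‖peak d z‖ ^ 2 := by ring
      _ ≤ d ^ 4 / 4 * (d⁻¹) ^ 2 * ‖peak d z‖ ^ 2 := by gcongr
      _ = d ^ 2 / 4 * ‖peak d z‖ ^ 2 := by field_simp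
  refine h1.trans ?_
  rw [Real.circleAverage_fun_smul, smul_eq_mul]
  calc d ^ 2 / 4 * _ ≤ d ^ 2 / 4 * d⁻¹ := by
        gcongr
        exact circleAverage_norm_peak_sq_le hd0 hd1
    _ = d / 4 := by field_simp

end LowerTail

end

noncomputable section

/-! ### The dip density, its logarithmic potential and a weighted Jensen inequality. -/

section LowerTail

open Polynomial ComplexConjugate Metric

variable {d : ℝ}

/-- The probability density `1 - Re (z V'(z))` on the unit circle, `V = well d`. -/
def dipDensity (d : ℝ) (z : ℂ) : ℝ := 1 - (wellSlope d z).re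

lemma continuousOn_wellSlope (hd0 : 0 < d) (hd1 : d < 1) :
    ContinuousOn (wellSlope d) (sphere 0 1) :=
  continuousOn_of_differentiableAt (one_lt_inv_one_sub hd0 hd1)
    fun _ hz => differentiableAt_wellSlope hd1 hz

lemma continuousOn_dipDensity (hd0 : 0 < d) (hd1 : d < 1) :
    ContinuousOn (dipDensity d) (sphere 0 1) :=
  continuousOn_const.sub (Complex.continuous_re.comp_continuousOn (continuousOn_wellSlope hd0 hd1))

lemma half_le_dipDensity (hd0 : 0 < d) (hd1 : d < 1) {z : ℂ} (hz : z ∈ sphere (0 : ℂ) 1) :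
    1 / 2 ≤ dipDensity d z := by
  have h1 := norm_wellSlope_le_half hd0 hd1 (norm_le_of_mem_sphere hz)
  have h2 := Complex.re_le_norm (wellSlope d z)
  rw [dipDensity]
  linarith

lemma circleAverage_dipDensity (hd0 : 0 < d) (hd1 : d < 1) :
    Real.circleAverage (dipDensity d) 0 1 = 1 := by
  have hc := continuousOn_wellSlope hd0 hd1
  have h0 := circleAverage_eq_of_differentiableAt (one_lt_inv_one_sub hd0 hd1)
    fun z hz => differentiableAt_wellSlope hd1 hz
  have hre : ContinuousOn (fun z => (wellSlope d z).re) (sphere 0 1) :=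
    Complex.continuous_re.comp_continuousOn hc
  unfold dipDensity
  rw [Real.circleAverage_fun_sub, circleAverage_re hc, h0, Real.circleAverage_const,
    wellSlope_zero]
  · simp
  all_goals
    apply circleIntegrable_of_continuousOn_sphere
    fun_prop

lemma one_sub_mul_ne_zero {w z : ℂ} (hz : z ∈ sphere (0 : ℂ) 1) (hw : ‖w‖ ≠ 1) :
    1 - z * w ≠ 0 := by
  intro h
  have hz1 : ‖z‖ = 1 := by simpa using hz
  have : ‖z * w‖ = 1 := by rw [← sub_eq_zero.1 h, norm_one]
  rw [norm_mul, hz1, one_mul] at this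
  exact hw this

lemma continuousOn_log_norm {f : ℂ → ℂ} (hf : ContinuousOn f (sphere 0 1))
    (h0 : ∀ z ∈ sphere (0 : ℂ) 1, f z ≠ 0) :
    ContinuousOn (fun z => Real.log ‖f z‖) (sphere 0 1) :=
  hf.norm.log fun z hz => by simpa using h0 z hz

/-- Why the density is built from z V': by Parseval the coefficients n v_n of z V' meet the
coefficients -w^n/n of log(1 - zw), and the factors n cancel to leave V(w) - V(0). The means of
log(1 - zw) and of its product with z V' vanish, because the logarithm is 0 at the origin. -/
lemma circleAverage_dipDensity_mul_log (hd0 : 0 < d) (hd1 : d < 1) {w : ℂ} (hw : ‖w‖ < 1) :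
    Real.circleAverage (fun z => dipDensity d z * Real.log ‖1 - z * w‖) 0 1 =
      ((well d w).re - wellZero d) / 2 := by
  obtain ⟨R, hR1, hRd, hRw⟩ : ∃ R : ℝ, 1 < R ∧ R < (1 - d)⁻¹ ∧ R * ‖w‖ < 1 := by
    rcases (norm_nonneg w).eq_or_lt with h | h
    · obtain ⟨R, h1, h2⟩ := exists_between (one_lt_inv_one_sub hd0 hd1)
      exact ⟨R, h1, h2, by rw [← h]; simp⟩
    · obtain ⟨R, h1, h2⟩ := exists_between (lt_min (one_lt_inv_one_sub hd0 hd1)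
        ((one_lt_inv₀ h).2 hw))
      refine ⟨R, h1, h2.trans_le (min_le_left _ _), ?_⟩
      have := h2.trans_le (min_le_right _ _)
      calc R * ‖w‖ < ‖w‖⁻¹ * ‖w‖ := by gcongr
        _ = 1 := inv_mul_cancel₀ h.ne'
  have hzw : ∀ z : ℂ, ‖z‖ < R → ‖z * w‖ < 1 := fun z hz => by
    rw [norm_mul]
    nlinarith [norm_nonneg w]
  set L : ℂ → ℂ := fun z => Complex.log (1 - z * w) with hL
  set G : ℂ → ℂ := wellSlope d with hG
  have hLd : ∀ z : ℂ, ‖z‖ < R → DifferentiableAt ℂ L z := fun z hz => by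
    refine DifferentiableAt.clog (by fun_prop) ?_
    rw [sub_eq_add_neg]
    exact Complex.mem_slitPlane_of_norm_lt_one (by rw [norm_neg]; exact hzw z hz)
  have hGd : ∀ z : ℂ, ‖z‖ < R → DifferentiableAt ℂ G z := fun z hz =>
    differentiableAt_wellSlope hd1 (hz.trans hRd)
  have hLc := continuousOn_of_differentiableAt hR1 hLd
  have hGc := continuousOn_of_differentiableAt hR1 hGd
  have hL0 : L 0 = 0 := by simp [hL]
  have h1 : Real.circleAverage L 0 1 = 0 := by
    rw [circleAverage_eq_of_differentiableAt hR1 hLd, hL0]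
  have h2 : Real.circleAverage (fun z => G z * L z) 0 1 = 0 := by
    rw [circleAverage_eq_of_differentiableAt hR1 (f := fun z => G z * L z)
      fun z hz => (hGd z hz).mul (hLd z hz), hL0, mul_zero]
  have hsphR : ∀ z ∈ sphere (0 : ℂ) 1, ‖z‖ < R := fun z hz =>
    (norm_le_of_mem_sphere hz).trans_lt hR1
  have hcoef : ∀ z ∈ sphere (0 : ℂ) 1, HasSum (fun n : ℕ => -(w ^ n / n) * z ^ n) (L z) := by
    intro z hz
    have := (Complex.hasSum_taylorSeries_neg_log (hzw z (hsphR z hz))).neg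
    rw [neg_neg] at this
    refine this.congr_fun fun n => ?_
    rw [mul_pow]; ring
  have hsum : Summable fun n : ℕ => ‖-(w ^ n / n)‖ := by
    have := (hcoef 1 (by simp)).summable.norm
    simpa using this
  have h3 := circleAverage_mul_conj (summable_norm_wellSlope_coeff hd0 hd1) hsum
    (fun z hz => hasSum_wellSlope hd1 ((hsphR z hz).trans hRd)) hcoef
  have h4 : Real.circleAverage (fun z => G z * conj (L z)) 0 1 =
      -(well d (conj w) - wellZero d) := by
    refine h3.unique ?_
    have hw' : ‖conj w‖ < (1 - d)⁻¹ := by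
      rw [Complex.norm_conj]
      exact hw.trans (one_lt_inv_one_sub hd0 hd1)
    refine (hasSum_well hd0 hd1 hw').neg.congr_fun fun n => ?_
    by_cases hn : n = 0
    · simp [hn]
    · have : (n : ℂ) ≠ 0 := by exact_mod_cast hn
      rw [if_neg hn]
      simp only [map_neg, map_div₀, map_pow, map_natCast]
      push_cast
      field_simp
  have e : ∀ z ∈ sphere (0 : ℂ) 1, dipDensity d z * Real.log ‖1 - z * w‖ =
      (L z).re - (1 / 2 : ℝ) • ((G z * conj (L z)).re + (G z * L z).re) := by
    intro z _
    have : (L z).re = Real.log ‖1 - z * w‖ := Complex.log_re _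
    rw [dipDensity, ← this, smul_eq_mul, Complex.mul_re, Complex.mul_re, Complex.conj_re,
      Complex.conj_im]
    ring
  have hGL : ContinuousOn (fun z => G z * L z) (sphere 0 1) := hGc.mul hLc
  have hGL' : ContinuousOn (fun z => G z * conj (L z)) (sphere 0 1) :=
    hGc.mul (Complex.continuous_conj.comp_continuousOn hLc)
  have c1 : ContinuousOn (fun z => (L z).re) (sphere 0 1) :=
    Complex.continuous_re.comp_continuousOn hLc
  have c2 : ContinuousOn (fun z => (G z * L z).re) (sphere 0 1) :=
    Complex.continuous_re.comp_continuousOn hGL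
  have c3 : ContinuousOn (fun z => (G z * conj (L z)).re) (sphere 0 1) :=
    Complex.continuous_re.comp_continuousOn hGL'
  rw [Real.circleAverage_congr_sphere (f₂ := fun z =>
    (L z).re - (1 / 2 : ℝ) • ((G z * conj (L z)).re + (G z * L z).re))
    fun z hz => e z (by simpa using hz), Real.circleAverage_fun_sub, Real.circleAverage_fun_smul,
    Real.circleAverage_fun_add, circleAverage_re hLc, circleAverage_re hGL, circleAverage_re hGL',
    h1, h2, h4, well_conj]
  · simp
    ring
  all_goals
    apply circleIntegrable_of_continuousOn_sphere
    fun_prop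

lemma wellZero_nonneg (hd0 : 0 < d) (hd1 : d < 1) : 0 ≤ wellZero d := by
  have := one_sub_sq_pos hd0 hd1
  unfold wellZero
  positivity

lemma circleIntegrable_dipDensity_mul_log (hd0 : 0 < d) (hd1 : d < 1) {f : ℂ → ℂ}
    (hf : ContinuousOn f (sphere 0 1)) (h0 : ∀ z ∈ sphere (0 : ℂ) 1, f z ≠ 0) :
    CircleIntegrable (fun z => dipDensity d z * Real.log ‖f z‖) 0 1 :=
  circleIntegrable_of_continuousOn_sphere
    ((continuousOn_dipDensity hd0 hd1).mul (continuousOn_log_norm hf h0))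

lemma circleAverage_dipDensity_mul_const (hd0 : 0 < d) (hd1 : d < 1) (c : ℝ) :
    Real.circleAverage (fun z => dipDensity d z * c) 0 1 = c := by
  have : (fun z => dipDensity d z * c) = fun z => c • dipDensity d z := by
    funext z; rw [smul_eq_mul, mul_comm]
  rw [this, Real.circleAverage_fun_smul, circleAverage_dipDensity hd0 hd1, smul_eq_mul, mul_one]

/-- For |w| < 1 this is Re V ≥ 0. For |w| > 1 reflect in the circle: |1 - zw| = |w| |1 - zv| with v
= 1/conj w, and log |w| > 0. -/
lemma neg_wellZero_le_circleAverage (hd0 : 0 < d) (hd1 : d < 1) {w : ℂ} (hw : ‖w‖ ≠ 1) :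
    -(wellZero d / 2) ≤
      Real.circleAverage (fun z => dipDensity d z * Real.log ‖1 - z * w‖) 0 1 := by
  rcases lt_or_gt_of_ne hw with h | h
  · rw [circleAverage_dipDensity_mul_log hd0 hd1 h]
    have := well_re_nonneg hd0 hd1 h.le
    linarith
  · have hw0 : w ≠ 0 := by
      rintro rfl
      simp at h
      linarith
    set v := conj w⁻¹ with hv
    have hv1 : ‖v‖ < 1 := by
      rw [hv, Complex.norm_conj, norm_inv]
      exact inv_lt_one_of_one_lt₀ h
    have e : ∀ z ∈ sphere (0 : ℂ) 1, dipDensity d z * Real.log ‖1 - z * w‖ =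
        dipDensity d z * Real.log ‖w‖ + dipDensity d z * Real.log ‖1 - z * v‖ := by
      intro z hz
      have h1 := mul_conj_of_mem_sphere hz
      have hz1 : ‖z‖ = 1 := by simpa using hz
      have h2 : 1 - z * w = -(z * w * conj (1 - z * v)) := by
        rw [hv]
        simp only [map_sub, map_one, map_mul, Complex.conj_conj]
        field_simp
        linear_combination (-1 : ℂ) * h1
      have h3 : ‖1 - z * w‖ = ‖w‖ * ‖1 - z * v‖ := by
        rw [h2, norm_neg, norm_mul, norm_mul, Complex.norm_conj, hz1, one_mul]
      rw [h3, Real.log_mul (by simpa using hw0)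
        (by simpa using one_sub_mul_ne_zero hz hv1.ne), mul_add]
    rw [Real.circleAverage_congr_sphere (f₂ := fun z =>
        dipDensity d z * Real.log ‖w‖ + dipDensity d z * Real.log ‖1 - z * v‖)
        fun z hz => e z (by simpa using hz), Real.circleAverage_fun_add,
      circleAverage_dipDensity_mul_const hd0 hd1, circleAverage_dipDensity_mul_log hd0 hd1 hv1]
    · have := well_re_nonneg hd0 hd1 hv1.le
      have := Real.log_pos h
      linarith
    · exact circleIntegrable_of_continuousOn_sphere
        ((continuousOn_dipDensity hd0 hd1).mul continuousOn_const)
    · exact circleIntegrable_dipDensity_mul_log hd0 hd1 (by fun_prop)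
        fun z hz => one_sub_mul_ne_zero hz hv1.ne

lemma multiset_le_circleAverage (hd0 : 0 < d) (hd1 : d < 1) (s : Multiset ℂ)
    (hs : ∀ ζ ∈ s, ζ ≠ 0 ∧ ‖ζ‖ ≠ 1) :
    Real.log ‖(s.map fun ζ => (0 : ℂ) - ζ).prod‖ - s.card * (wellZero d / 2) ≤
      Real.circleAverage
        (fun z => dipDensity d z * Real.log ‖(s.map fun ζ => z - ζ).prod‖) 0 1 := by
  induction s using Multiset.induction_on with
  | empty => simp [Real.circleAverage_const]
  | cons ζ s ih =>
    have hs' := fun ξ hξ => hs ξ (Multiset.mem_cons_of_mem hξ)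
    obtain ⟨hζ0, hζ1⟩ := hs ζ (Multiset.mem_cons_self ζ s)
    have ih := ih hs'
    have hw : ‖ζ⁻¹‖ ≠ 1 := by
      rw [norm_inv]
      simpa using hζ1
    have hne : ∀ t : Multiset ℂ, (∀ ζ ∈ t, ζ ≠ 0 ∧ ‖ζ‖ ≠ 1) → ∀ z ∈ sphere (0 : ℂ) 1,
        (t.map fun ζ => z - ζ).prod ≠ 0 := by
      intro t ht z hz h
      rw [Multiset.prod_eq_zero_iff, Multiset.mem_map] at h
      obtain ⟨ξ, hξ, h⟩ := h
      have hz1 : ‖z‖ = 1 := by simpa using hz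
      rw [sub_eq_zero.1 h] at hz1
      exact (ht ξ hξ).2 hz1
    have hne0 : (s.map fun ζ => (0 : ℂ) - ζ).prod ≠ 0 := by
      intro h
      rw [Multiset.prod_eq_zero_iff, Multiset.mem_map] at h
      obtain ⟨ξ, hξ, h⟩ := h
      exact (hs' ξ hξ).1 (by simpa using h)
    have e : ∀ z ∈ sphere (0 : ℂ) 1,
        dipDensity d z * Real.log ‖((ζ ::ₘ s).map fun ζ => z - ζ).prod‖ =
        dipDensity d z * Real.log ‖ζ‖ + dipDensity d z * Real.log ‖1 - z * ζ⁻¹‖ +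
          dipDensity d z * Real.log ‖(s.map fun ζ => z - ζ).prod‖ := by
      intro z hz
      have h1 : z - ζ = -(ζ * (1 - z * ζ⁻¹)) := by
        field_simp
        ring
      rw [Multiset.map_cons, Multiset.prod_cons, norm_mul, h1, norm_neg, norm_mul,
        Real.log_mul (mul_ne_zero (by simpa using hζ0)
          (by simpa using one_sub_mul_ne_zero hz hw)) (by simpa using hne s hs' z hz),
        Real.log_mul (by simpa using hζ0) (by simpa using one_sub_mul_ne_zero hz hw)]
      ring
    have i1 : CircleIntegrable (fun z => dipDensity d z * Real.log ‖ζ‖) 0 1 :=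
      circleIntegrable_of_continuousOn_sphere
        ((continuousOn_dipDensity hd0 hd1).mul continuousOn_const)
    have i2 := circleIntegrable_dipDensity_mul_log hd0 hd1 (f := fun z => 1 - z * ζ⁻¹)
      (by fun_prop) fun z hz => one_sub_mul_ne_zero hz hw
    have i3 := circleIntegrable_dipDensity_mul_log hd0 hd1
      (f := fun z => (s.map fun ζ => z - ζ).prod)
      (Continuous.continuousOn (continuous_multiset_prod s (fun ζ _ => by fun_prop)))
      fun z hz => hne s hs' z hz
    have i12 : CircleIntegrable (fun z => dipDensity d z * Real.log ‖ζ‖ +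
        dipDensity d z * Real.log ‖1 - z * ζ⁻¹‖) 0 1 := i1.add i2
    rw [Real.circleAverage_congr_sphere fun z hz => e z (by simpa using hz),
      Real.circleAverage_fun_add i12 i3, Real.circleAverage_fun_add i1 i2,
      circleAverage_dipDensity_mul_const hd0 hd1, Multiset.map_cons, Multiset.prod_cons, norm_mul,
      Real.log_mul (by simpa using hζ0) (by simpa using hne0), Multiset.card_cons, zero_sub,
      norm_neg]
    have := neg_wellZero_le_circleAverage hd0 hd1 hw
    push_cast
    linarith

/-- Jensen's inequality for log |P| with the dip density in place of the uniform one; each root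
costs at most V(0)/2. -/
lemma log_norm_eval_zero_le_circleAverage (hd0 : 0 < d) (hd1 : d < 1) {k : ℕ} (P : ℂ[X])
    (hP : P.natDegree ≤ k) (h0 : P.eval 0 ≠ 0) (h1 : ∀ z ∈ sphere (0 : ℂ) 1, P.eval z ≠ 0) :
    Real.log ‖P.eval 0‖ - k * (wellZero d / 2) ≤
      Real.circleAverage (fun z => dipDensity d z * Real.log ‖P.eval z‖) 0 1 := by
  have hP0 : P ≠ 0 := by
    rintro rfl
    simp at h0
  have hev : ∀ z, P.eval z = P.leadingCoeff * (P.roots.map fun ζ => z - ζ).prod := by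
    intro z
    conv_lhs => rw [(IsAlgClosed.splits P).eq_prod_roots]
    rw [eval_mul, eval_C, eval_multiset_prod, Multiset.map_map]
    simp
  have hl : P.leadingCoeff ≠ 0 := by simpa using hP0
  have hroots : ∀ ζ ∈ P.roots, ζ ≠ 0 ∧ ‖ζ‖ ≠ 1 := by
    intro ζ hζ
    have hr := (mem_roots hP0).1 hζ
    refine ⟨?_, fun h => h1 ζ (by simpa using h) hr⟩
    rintro rfl
    exact h0 hr
  have hne : ∀ z, P.eval z ≠ 0 → (P.roots.map fun ζ => z - ζ).prod ≠ 0 := fun z hz h => by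
    rw [hev, h, mul_zero] at hz
    exact hz rfl
  have key := multiset_le_circleAverage hd0 hd1 P.roots hroots
  have e : ∀ z ∈ sphere (0 : ℂ) 1, dipDensity d z * Real.log ‖P.eval z‖ =
      dipDensity d z * Real.log ‖P.leadingCoeff‖ +
        dipDensity d z * Real.log ‖(P.roots.map fun ζ => z - ζ).prod‖ := by
    intro z hz
    rw [hev z, norm_mul, Real.log_mul (by simpa using hl) (by simpa using hne z (h1 z hz)), mul_add]
  rw [Real.circleAverage_congr_sphere fun z hz => e z (by simpa using hz),
    Real.circleAverage_fun_add, circleAverage_dipDensity_mul_const hd0 hd1, hev 0, norm_mul,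
    Real.log_mul (by simpa using hl) (by simpa using hne 0 h0)]
  · have h2 : (P.roots.card : ℝ) ≤ k := by
      exact_mod_cast (card_roots' P).trans hP
    have h3 := wellZero_nonneg hd0 hd1
    nlinarith
  · exact circleIntegrable_of_continuousOn_sphere
      ((continuousOn_dipDensity hd0 hd1).mul continuousOn_const)
  · exact circleIntegrable_dipDensity_mul_log hd0 hd1
      (Continuous.continuousOn (continuous_multiset_prod _ (fun ζ _ => by fun_prop)))
      fun z hz => hne z (h1 z hz)

end LowerTail

end

noncomputable section

/-! ### Weighted norms from below, and the bound on the constant coefficient. -/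

section LowerTail

open Polynomial ComplexConjugate Metric

variable {d : ℝ}

/-- The Gibbs variational inequality: for a probability density f, log of the mean of x is at least
the mean of f log x minus the mean of f log f. The entropy is at most the mean of (f - 1)², hence at
most d/4. -/
lemma exp_le_circleAverage (hd0 : 0 < d) (hd1 : d < 1) {x : ℂ → ℝ}
    (hx : ContinuousOn x (sphere 0 1)) (hx0 : ∀ z ∈ sphere (0 : ℂ) 1, 0 < x z) :
    Real.exp (Real.circleAverage (fun z => dipDensity d z * Real.log (x z)) 0 1 - d / 4) ≤
      Real.circleAverage x 0 1 := by
  set c := Real.circleAverage (fun z => dipDensity d z * Real.log (x z)) 0 1 - d / 4 with hc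
  have hf := continuousOn_dipDensity hd0 hd1
  have hG : ContinuousOn (fun z => (wellSlope d z).re) (sphere 0 1) :=
    Complex.continuous_re.comp_continuousOn (continuousOn_wellSlope hd0 hd1)
  have hlog : ContinuousOn (fun z => Real.log (x z)) (sphere 0 1) :=
    hx.log fun z hz => (hx0 z hz).ne'
  -- Pointwise form, from log v ≤ v - 1 used twice: at v = x e^(-c)/f, and at v = f to bound f log f
  -- by f(f - 1).
  have hpt : ∀ z ∈ sphere (0 : ℂ) 1,
      (dipDensity d z * Real.log (x z) - (wellSlope d z).re ^ 2) + (1 - c) • dipDensity d z +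
        (wellSlope d z).re ≤ Real.exp (-c) • x z := by
    intro z hz
    have h1 : 0 < dipDensity d z := by linarith [half_le_dipDensity hd0 hd1 hz]
    have h2 : 0 < x z * Real.exp (-c) / dipDensity d z :=
      div_pos (mul_pos (hx0 z hz) (Real.exp_pos _)) h1
    have h3 := Real.log_le_sub_one_of_pos h2
    have h4 := Real.log_le_sub_one_of_pos h1
    rw [Real.log_div (mul_pos (hx0 z hz) (Real.exp_pos _)).ne' h1.ne',
      Real.log_mul (hx0 z hz).ne' (Real.exp_pos _).ne', Real.log_exp, le_sub_iff_add_le,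
      le_div_iff₀ h1] at h3
    have h5 : dipDensity d z * Real.log (dipDensity d z) ≤
        dipDensity d z * (dipDensity d z - 1) := by gcongr
    have h6 : (wellSlope d z).re = 1 - dipDensity d z := by rw [dipDensity]; ring
    rw [h6, smul_eq_mul, smul_eq_mul]
    nlinarith
  have i1 : ContinuousOn (fun z => dipDensity d z * Real.log (x z)) (sphere 0 1) := hf.mul hlog
  have i2 : ContinuousOn (fun z => (wellSlope d z).re ^ 2) (sphere 0 1) := hG.pow 2
  have hmono := Real.circleAverage_mono
    (circleIntegrable_of_continuousOn_sphere (f := fun z =>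
      (dipDensity d z * Real.log (x z) - (wellSlope d z).re ^ 2) + (1 - c) • dipDensity d z +
        (wellSlope d z).re) (by fun_prop))
    (circleIntegrable_of_continuousOn_sphere (f := fun z => Real.exp (-c) • x z) (by fun_prop))
    fun z hz => hpt z (by simpa using hz)
  have h0 := circleAverage_eq_of_differentiableAt (one_lt_inv_one_sub hd0 hd1)
    fun z hz => differentiableAt_wellSlope hd1 hz
  rw [Real.circleAverage_fun_smul, Real.circleAverage_fun_add, Real.circleAverage_fun_add,
    Real.circleAverage_fun_sub, Real.circleAverage_fun_smul, circleAverage_dipDensity hd0 hd1,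
    circleAverage_re (continuousOn_wellSlope hd0 hd1), h0, wellSlope_zero, Complex.zero_re,
    smul_eq_mul, smul_eq_mul] at hmono
  · have h1 := circleAverage_wellSlope_re_sq_le hd0 hd1
    have h2 : 1 ≤ Real.exp (-c) * Real.circleAverage x 0 1 := by linarith
    rw [Real.exp_neg] at h2
    rwa [← div_eq_inv_mul, le_div_iff₀ (Real.exp_pos _), one_mul] at h2
  all_goals
    apply circleIntegrable_of_continuousOn_sphere
    fun_prop

/-- The gain `∑ (V(-bᵢ) - V(0)) - k V(0) - d / 4` in the lower bound for weighted norms of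
polynomials of degree `k`. -/
def wellGain (d : ℝ) (b : ℕ → ℝ) (M k : ℕ) : ℝ :=
  ∑ i ∈ Finset.range M, ((well d (-(b i : ℂ))).re - wellZero d) - k * wellZero d - d / 4

/-- The potential is evaluated at w = -b_i, inside the disc, where it is known exactly. The values
V(-b_i) - V(0) are the gain. -/
lemma circleAverage_log_elemPoly (hd0 : 0 < d) (hd1 : d < 1) {b : ℕ → ℝ} {M : ℕ}
    (hb0 : ∀ i < M, 0 < b i) (hb1 : ∀ i < M, b i < 1) :
    Real.circleAverage (fun z => dipDensity d z * Real.log ‖aeval z (elemPoly b M)‖) 0 1 =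
      ∑ i ∈ Finset.range M, ((well d (-(b i : ℂ))).re - wellZero d) / 2 := by
  have hn : ∀ i < M, ‖-(b i : ℂ)‖ < 1 := fun i hi => by
    rw [norm_neg, Complex.norm_real, Real.norm_of_nonneg (hb0 i hi).le]
    exact hb1 i hi
  have e : ∀ z ∈ sphere (0 : ℂ) 1, dipDensity d z * Real.log ‖aeval z (elemPoly b M)‖ =
      ∑ i ∈ Finset.range M, dipDensity d z * Real.log ‖1 - z * -(b i : ℂ)‖ := by
    intro z hz
    rw [aeval_elemPoly, norm_prod, Real.log_prod, Finset.mul_sum]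
    · refine Finset.sum_congr rfl fun i _ => ?_
      rw [mul_neg, sub_neg_eq_add, mul_comm (b i : ℂ)]
    · intro i hi
      have := one_sub_mul_ne_zero hz (hn i (Finset.mem_range.1 hi)).ne
      rw [mul_neg, sub_neg_eq_add, mul_comm z] at this
      simpa using this
  rw [Real.circleAverage_congr_sphere fun z hz => e z (by simpa using hz),
    Real.circleAverage_fun_sum]
  · refine Finset.sum_congr rfl fun i hi => ?_
    rw [circleAverage_dipDensity_mul_log hd0 hd1 (hn i (Finset.mem_range.1 hi))]
  · intro i hi
    exact circleIntegrable_dipDensity_mul_log hd0 hd1 (by fun_prop)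
      fun z hz => one_sub_mul_ne_zero hz (hn i (Finset.mem_range.1 hi)).ne

lemma exp_wellGain_le_circleAverage (hd0 : 0 < d) (hd1 : d < 1) {b : ℕ → ℝ} {M k : ℕ}
    (hb0 : ∀ i < M, 0 < b i) (hb1 : ∀ i < M, b i < 1) (P : ℂ[X])
    (hP : P.natDegree ≤ k) (h0 : P.eval 0 ≠ 0) (h1 : ∀ z ∈ sphere (0 : ℂ) 1, P.eval z ≠ 0) :
    ‖P.eval 0‖ ^ 2 * Real.exp (wellGain d b M k) ≤
      Real.circleAverage (fun z => ‖P.eval z * aeval z (elemPoly b M)‖ ^ 2) 0 1 := by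
  have hAne : ∀ z ∈ sphere (0 : ℂ) 1, aeval z (elemPoly b M) ≠ 0 := by
    intro z hz
    rw [aeval_elemPoly, Finset.prod_ne_zero_iff]
    intro i hi
    have hi := Finset.mem_range.1 hi
    have := one_sub_mul_ne_zero (w := -(b i : ℂ)) hz (by
      rw [norm_neg, Complex.norm_real, Real.norm_of_nonneg (hb0 i hi).le]
      exact (hb1 i hi).ne)
    rwa [mul_neg, sub_neg_eq_add, mul_comm z] at this
  have hPc : ContinuousOn (fun z => P.eval z) (sphere 0 1) := P.continuous.continuousOn
  have hAc : ContinuousOn (fun z : ℂ => aeval z (elemPoly b M)) (sphere 0 1) :=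
    (continuous_complex_aeval _).continuousOn
  have key := exp_le_circleAverage hd0 hd1
    (x := fun z => ‖P.eval z * aeval z (elemPoly b M)‖ ^ 2) ((hPc.mul hAc).norm.pow 2)
    fun z hz => by
      have := mul_ne_zero (h1 z hz) (hAne z hz)
      positivity
  refine le_trans ?_ key
  have e : ∀ z ∈ sphere (0 : ℂ) 1,
      dipDensity d z * Real.log (‖P.eval z * aeval z (elemPoly b M)‖ ^ 2) =
      (2 : ℝ) • (dipDensity d z * Real.log ‖P.eval z‖) +
        (2 : ℝ) • (dipDensity d z * Real.log ‖aeval z (elemPoly b M)‖) := by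
    intro z hz
    rw [Real.log_pow, norm_mul, Real.log_mul (by simpa using h1 z hz) (by simpa using hAne z hz),
      smul_eq_mul, smul_eq_mul]
    push_cast
    ring
  have i1 := circleIntegrable_dipDensity_mul_log hd0 hd1 hPc h1
  have i2 := circleIntegrable_dipDensity_mul_log hd0 hd1 hAc hAne
  have i3 : CircleIntegrable (fun z => (2 : ℝ) • (dipDensity d z * Real.log ‖P.eval z‖)) 0 1 :=
    i1.const_smul
  have i4 : CircleIntegrable
      (fun z : ℂ => (2 : ℝ) • (dipDensity d z * Real.log ‖aeval z (elemPoly b M)‖)) 0 1 :=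
    i2.const_smul
  rw [Real.circleAverage_congr_sphere fun z hz => e z (by simpa using hz),
    Real.circleAverage_fun_add i3 i4,
    Real.circleAverage_fun_smul, Real.circleAverage_fun_smul,
    circleAverage_log_elemPoly hd0 hd1 hb0 hb1]
  have h2 := log_norm_eval_zero_le_circleAverage hd0 hd1 P hP h0 h1
  have h3 : ‖P.eval 0‖ ^ 2 = Real.exp (2 * Real.log ‖P.eval 0‖) := by
    rw [mul_comm, Real.exp_mul, Real.exp_log (norm_pos_iff.2 h0)]
    norm_cast
  rw [h3, ← Real.exp_add, Real.exp_le_exp, wellGain, smul_eq_mul, smul_eq_mul, Finset.mul_sum]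
  have h4 : ∀ i, 2 * (((well d (-(b i : ℂ))).re - wellZero d) / 2) =
      (well d (-(b i : ℂ))).re - wellZero d := fun i => by ring
  simp only [h4]
  linarith

/-- A polynomial `p` of degree at most `k` whose product with `A = ∏ (1 + aᵢ X)` is biorthogonal to
`A, X A, …, X ^ k A` has constant coefficient at most `exp (-gain)`. -/
theorem coeff_zero_le_exp_neg_wellGain (hd0 : 0 < d) (hd1 : d < 1) {a : ℕ → ℝ} {M k : ℕ}
    (ha0 : ∀ i < M, 0 < a i) (ha1 : ∀ i < M, a i < 1) {p : ℝ[X]} (hp : p.natDegree ≤ k)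
    (horth : ∀ j ≤ k, polyInner (X ^ j * elemPoly a M) (p * elemPoly a M) =
      if j = 0 then 1 else 0) :
    p.coeff 0 ≤ Real.exp (-wellGain d a M k) := by
  set r := p.coeff 0 with hr
  have hself : polyInner (p * elemPoly a M) (p * elemPoly a M) = r :=
    polyInner_self_of_orthogonal hp horth
  by_cases hr0 : r ≤ 0
  · exact hr0.trans (Real.exp_pos _).le
  push Not at hr0
  set P : ℂ[X] := p.map (algebraMap ℝ ℂ) with hP
  have hPev : ∀ z : ℂ, P.eval z = aeval z p := fun z => by rw [hP, eval_map_algebraMap]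
  have hP0 : P.eval 0 = r := by
    rw [hPev, ← coeff_zero_eq_aeval_zero']
    rfl
  have hPne : P ≠ 0 := by
    intro h
    rw [h] at hP0
    simp at hP0
    exact hr0.ne (by exact_mod_cast hP0)
  -- The Jensen inequality needs p to have no roots on the circle. Dilating by ρ < 1 avoids them and
  -- does not increase the mean square, so r² e^gain ≤ r; then ρ tends to 1.
  have hscaled : ∀ ρ : ℝ, 0 < ρ → ρ < 1 → (∀ ζ ∈ P.roots, ‖ζ‖ ≠ ρ) →
      r * Real.exp (wellGain d (fun i => ρ * a i) M k) ≤ 1 := by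
    intro ρ hρ0 hρ1 hρ
    have h := exp_wellGain_le_circleAverage hd0 hd1 (b := fun i => ρ * a i) (M := M) (k := k)
      (fun i hi => mul_pos hρ0 (ha0 i hi)) (fun i hi => by
        have := ha0 i hi
        have := ha1 i hi
        nlinarith) (P.comp (C (ρ : ℂ) * X)) ?_ ?_ ?_
    · have e : ∀ z : ℂ, (P.comp (C (ρ : ℂ) * X)).eval z *
          aeval z (elemPoly (fun i => ρ * a i) M) = aeval ((ρ : ℂ) * z) (p * elemPoly a M) := by
        intro z
        rw [eval_comp, map_mul, hPev, aeval_elemPoly, aeval_elemPoly]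
        simp only [eval_mul, eval_C, eval_X]
        congr 1
        refine Finset.prod_congr rfl fun i _ => ?_
        push_cast
        ring
      simp only [e] at h
      have h2 := circleAverage_norm_sq_comp_mul_le (summable_norm_coeff (p * elemPoly a M))
        (fun z _ => hasSum_aeval (p * elemPoly a M) z) hρ0.le hρ1.le
      rw [circleAverage_norm_aeval_sq, hself] at h2
      have h3 := h.trans h2
      simp only [eval_comp, eval_mul, eval_C, eval_X, mul_zero, hP0, Complex.norm_real,
        Real.norm_of_nonneg hr0.le] at h3
      have h4 : r * (r * Real.exp (wellGain d (fun i => ρ * a i) M k)) ≤ r * 1 := by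
        linarith
      exact le_of_mul_le_mul_left h4 hr0
    · refine natDegree_comp_le.trans ?_
      have h1 : (C (ρ : ℂ) * X).natDegree ≤ 1 :=
        (natDegree_C_mul_le _ _).trans natDegree_X_le
      have h2 : P.natDegree ≤ k := natDegree_map_le.trans hp
      nlinarith
    · simp [eval_comp, hP0, hr0.ne']
    · intro z hz h0
      have hz1 : ‖z‖ = 1 := by simpa using hz
      refine hρ ((ρ : ℂ) * z) ((mem_roots hPne).2 (by simpa [eval_comp] using h0)) ?_
      rw [norm_mul, hz1, Complex.norm_real, Real.norm_of_nonneg hρ0.le, mul_one]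
  -- Only finitely many radii carry roots, so all ρ < 1 close enough to 1 are admissible.
  have hev : ∀ᶠ ρ : ℝ in 𝓝[<] 1, r * Real.exp (wellGain d (fun i => ρ * a i) M k) ≤ 1 := by
    have hfin : (((fun ζ : ℂ => ‖ζ‖) '' (P.roots.toFinset : Set ℂ)) \ {1}).Finite :=
      ((Finset.finite_toSet _).image _).subset Set.sdiff_subset
    have h1 : ∀ᶠ ρ : ℝ in 𝓝[<] 1, ρ ∉ ((fun ζ : ℂ => ‖ζ‖) '' (P.roots.toFinset : Set ℂ)) \ {1} :=
      nhdsWithin_le_nhds (hfin.isClosed.isOpen_compl.mem_nhds (by simp))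
    have h2 : ∀ᶠ ρ : ℝ in 𝓝[<] 1, 0 < ρ :=
      nhdsWithin_le_nhds (lt_mem_nhds zero_lt_one)
    filter_upwards [h1, h2, self_mem_nhdsWithin] with ρ hρ1 hρ2 hρ3
    refine hscaled ρ hρ2 hρ3 fun ζ hζ h => hρ1 ⟨⟨ζ, by simpa using hζ, h⟩, ?_⟩
    exact (show ρ < 1 from hρ3).ne
  have hcont : Tendsto (fun ρ : ℝ => r * Real.exp (wellGain d (fun i => ρ * a i) M k)) (𝓝[<] 1)
      (𝓝 (r * Real.exp (wellGain d (fun i => 1 * a i) M k))) := by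
    have hc : ContinuousAt (fun ρ : ℝ => r * Real.exp (wellGain d (fun i => ρ * a i) M k)) 1 := by
      have hw : ∀ i ∈ Finset.range M,
          ContinuousAt (fun ρ : ℝ => (well d (-((ρ * a i : ℝ) : ℂ))).re) 1 := by
        intro i hi
        have hi := Finset.mem_range.1 hi
        have hlt : ‖-((1 * a i : ℝ) : ℂ)‖ < (1 - d)⁻¹ := by
          rw [norm_neg, one_mul, Complex.norm_real, Real.norm_of_nonneg (ha0 i hi).le]
          exact (ha1 i hi).trans (one_lt_inv_one_sub hd0 hd1)
        have hp := (differentiableAt_peak hd1 hlt).continuousAt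
        have hwell : ContinuousAt (well d) (-((1 * a i : ℝ) : ℂ)) := by
          unfold well
          fun_prop
        have h1 : ContinuousAt (fun ρ : ℝ => -((ρ * a i : ℝ) : ℂ)) 1 := by fun_prop
        exact Complex.continuous_re.continuousAt.comp
          (ContinuousAt.comp (f := fun ρ : ℝ => -((ρ * a i : ℝ) : ℂ)) hwell h1)
      unfold wellGain
      refine continuousAt_const.mul (Real.continuous_exp.continuousAt.comp ?_)
      refine ContinuousAt.sub (ContinuousAt.sub ?_ continuousAt_const) continuousAt_const
      exact tendsto_finsetSum _ fun i hi => (hw i hi).sub continuousAt_const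
    exact hc.tendsto.mono_left nhdsWithin_le_nhds
  have hlim := le_of_tendsto hcont hev
  simp only [one_mul] at hlim
  rw [Real.exp_neg, ← one_div, le_div_iff₀ (Real.exp_pos _)]
  exact hlim

lemma sq_div_le_wellZero (hd0 : 0 < d) (hd1 : d < 1) : d ^ 2 / 32 ≤ wellZero d := by
  have h := one_sub_sq_pos hd0 hd1
  rw [wellZero, ← mul_div_assoc, le_div_iff₀ h]
  have h1 : 0 ≤ d ^ 3 := by positivity
  nlinarith [sq_nonneg (1 - d)]

/-- This is where the edge comes from. With x = a/(1-a) one has peak(-a) = (1+x)/(1+dx), and V(-a) -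
V(0) is 2x V(0) to leading order in d. The error is at most 6 d² x(1+x)² V(0), and x(1+x)² =
a/(1-a)³. -/
lemma well_neg_sub_wellZero_ge (hd0 : 0 < d) (hd1 : d < 1) {a : ℝ} (ha0 : 0 < a) (ha1 : a < 1) :
    wellZero d * (2 * (a / (1 - a)) - 6 * d ^ 2 * (a / (1 - a) ^ 3)) ≤
      (well d (-(a : ℂ))).re - wellZero d := by
  have h := one_sub_sq_pos hd0 hd1
  have hx1 : 0 < 1 - a := by linarith
  set x := a / (1 - a) with hx
  have hx0 : 0 < x := div_pos ha0 hx1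
  have ha : a = x / (1 + x) := by rw [hx]; field_simp; ring
  have hdx : 0 < 1 + d * x := by positivity
  have hy : (1 - (1 - d) * a)⁻¹ = (1 + x) / (1 + d * x) := by
    rw [ha]
    have h1 : 1 - (1 - d) * (x / (1 + x)) = (1 + d * x) / (1 + x) := by field_simp; ring
    rw [h1, inv_div]
  have h3 : a / (1 - a) ^ 3 = x * (1 + x) ^ 2 := by
    rw [ha]
    have h1 : 1 - x / (1 + x) = 1 / (1 + x) := by field_simp; ring
    rw [h1]
    field_simp
  have hpk : peak d (-(a : ℂ)) = (((1 + x) / (1 + d * x) : ℝ) : ℂ) := by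
    rw [← hy, peak]
    push_cast
    congr 1
    ring
  have hre : (well d (-(a : ℂ))).re = d ^ 3 / 16 * (2 * ((1 + x) / (1 + d * x)) ^ 2 +
      4 * (1 - d) ^ 2 / (1 - (1 - d) ^ 2) * ((1 + x) / (1 + d * x)) +
      (1 - 2 / (1 - (1 - d) ^ 2))) := by
    rw [well, hpk]
    norm_cast
  rw [hre, h3, wellZero]
  have hc : 1 - (1 - d) ^ 2 = d * (2 - d) := by ring
  have h2d : 0 < 2 - d := by linarith
  have hkey : (1 + (1 - d) ^ 2) / (1 - (1 - d) ^ 2) *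
      (2 * x - 6 * d ^ 2 * (x * (1 + x) ^ 2)) ≤
      2 * ((1 + x) / (1 + d * x)) ^ 2 +
      4 * (1 - d) ^ 2 / (1 - (1 - d) ^ 2) * ((1 + x) / (1 + d * x)) +
      (1 - 2 / (1 - (1 - d) ^ 2)) - (1 + (1 - d) ^ 2) / (1 - (1 - d) ^ 2) := by
    rw [hc]
    have e : 2 * ((1 + x) / (1 + d * x)) ^ 2 +
        4 * (1 - d) ^ 2 / (d * (2 - d)) * ((1 + x) / (1 + d * x)) +
        (1 - 2 / (d * (2 - d))) - (1 + (1 - d) ^ 2) / (d * (2 - d)) =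
        (2 * (1 + x) ^ 2 * (d * (2 - d)) + 4 * (1 - d) ^ 2 * (1 + x) * (1 + d * x) +
          (d * (2 - d) - 2 - (1 + (1 - d) ^ 2)) * (1 + d * x) ^ 2) /
          ((1 + d * x) ^ 2 * (d * (2 - d))) := by
      field_simp
      ring
    rw [e, div_mul_eq_mul_div, div_le_div_iff₀ (by positivity) (by positivity)]
    have hpos : 0 < d * (2 - d) := by positivity
    rw [← mul_assoc, mul_le_mul_iff_left₀ hpos]
    have id1 : (2 * (1 + x) ^ 2 * (d * (2 - d)) + 4 * (1 - d) ^ 2 * (1 + x) * (1 + d * x) +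
          (d * (2 - d) - 2 - (1 + (1 - d) ^ 2)) * (1 + d * x) ^ 2) -
        (1 + (1 - d) ^ 2) * (2 * x) * (1 + d * x) ^ 2 =
        -(2 * x * d ^ 2) * ((1 - d) * (3 - d) * x + 2 * (1 - d) * x ^ 2 + (1 + d * x) ^ 2) := by
      ring
    have id2 : (1 - d) * (3 - d) * x + 2 * (1 - d) * x ^ 2 + (1 + d * x) ^ 2 ≤
        3 * (1 + x) ^ 2 := by
      have h5 : (1 - d) * (3 - d) ≤ 3 := by nlinarith
      have h6 : d * x ≤ x := by nlinarith
      have h7 : (1 + d * x) ^ 2 ≤ (1 + x) ^ 2 := by gcongr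
      nlinarith [mul_le_mul_of_nonneg_right h5 hx0.le, sq_nonneg x]
    have id3 : 1 ≤ (1 + (1 - d) ^ 2) * (1 + d * x) ^ 2 := by
      have : 1 ≤ (1 + d * x) ^ 2 := by nlinarith [mul_pos hd0 hx0]
      nlinarith [sq_nonneg (1 - d)]
    have id4 : 2 * x * d ^ 2 * ((1 - d) * (3 - d) * x + 2 * (1 - d) * x ^ 2 + (1 + d * x) ^ 2) ≤
        2 * x * d ^ 2 * (3 * (1 + x) ^ 2) := by gcongr
    have id5 : 2 * x * d ^ 2 * (3 * (1 + x) ^ 2) * 1 ≤ 2 * x * d ^ 2 * (3 * (1 + x) ^ 2) *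
        ((1 + (1 - d) ^ 2) * (1 + d * x) ^ 2) := by gcongr
    linarith
  have h16 : 0 < d ^ 3 / 16 := by positivity
  nlinarith

/-- The gain is at least a multiple of the distance of `k` from the edge `2 ∑ aᵢ / (1 - aᵢ)`. -/
lemma wellGain_ge (hd0 : 0 < d) (hd1 : d < 1) {a : ℕ → ℝ} {M k : ℕ}
    (ha0 : ∀ i < M, 0 < a i) (ha1 : ∀ i < M, a i < 1) {s : ℝ} (hs : 0 ≤ s)
    (h : k + s + 6 * d ^ 2 * ∑ i ∈ Finset.range M, a i / (1 - a i) ^ 3 ≤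
      2 * ∑ i ∈ Finset.range M, a i / (1 - a i)) :
    d ^ 2 / 32 * s - d / 4 ≤ wellGain d a M k := by
  have h1 : ∑ i ∈ Finset.range M,
      wellZero d * (2 * (a i / (1 - a i)) - 6 * d ^ 2 * (a i / (1 - a i) ^ 3)) ≤
      ∑ i ∈ Finset.range M, ((well d (-(a i : ℂ))).re - wellZero d) :=
    Finset.sum_le_sum fun i hi => well_neg_sub_wellZero_ge hd0 hd1 (ha0 i (Finset.mem_range.1 hi))
      (ha1 i (Finset.mem_range.1 hi))
  rw [← Finset.mul_sum, Finset.sum_sub_distrib, ← Finset.mul_sum, ← Finset.mul_sum] at h1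
  have h2 := sq_div_le_wellZero hd0 hd1
  have h3 := wellZero_nonneg hd0 hd1
  rw [wellGain]
  nlinarith

end LowerTail

end

noncomputable section

/-! ### Ratios of Toeplitz determinants. -/

section Toeplitz

open Polynomial

lemma polyInner_comm (f g : ℝ[X]) : polyInner f g = polyInner g f := by
  rw [polyInner_eq_sum_range g (show f.natDegree < f.natDegree + g.natDegree + 1 by omega),
    polyInner_eq_sum_range f (show g.natDegree < f.natDegree + g.natDegree + 1 by omega)]
  simp only [mul_comm]

lemma polyInner_X_mul (f g : ℝ[X]) : polyInner (X * f) (X * g) = polyInner f g := by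
  have h : (X * f).natDegree < f.natDegree + 1 + 1 := by
    have := natDegree_mul_le (p := X) (q := f)
    have := natDegree_X_le (R := ℝ)
    omega
  rw [polyInner_eq_sum_range _ h, polyInner_eq_sum_range _ (Nat.lt_succ_self f.natDegree),
    Finset.sum_range_succ']
  simp

/-- The Toeplitz matrix of the weight `|A|²` on the unit circle, `A = ∏ (1 + aᵢ X)`. -/
def toeplitz (a : ℕ → ℝ) (M n : ℕ) : Matrix (Fin n) (Fin n) ℝ :=
  Matrix.of fun i j => polyInner (X ^ (i : ℕ) * elemPoly a M) (X ^ (j : ℕ) * elemPoly a M)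

lemma toeplitz_submatrix_succ (a : ℕ → ℝ) (M k : ℕ) :
    (toeplitz a M (k + 1)).submatrix Fin.succ Fin.succ = toeplitz a M k := by
  ext i j
  simp only [toeplitz, Matrix.submatrix_apply, Matrix.of_apply, Fin.val_succ, pow_succ', mul_assoc]
  exact polyInner_X_mul _ _

/-- The ratio of consecutive Toeplitz determinants is the constant coefficient of a polynomial
biorthogonal to the multiples of `A`. -/
lemma exists_orthogonal_polynomial (a : ℕ → ℝ) (M k : ℕ) (hD : (toeplitz a M (k + 1)).det ≠ 0) :
    ∃ p : ℝ[X], p.natDegree ≤ k ∧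
      (∀ j ≤ k, polyInner (X ^ j * elemPoly a M) (p * elemPoly a M) = if j = 0 then 1 else 0) ∧
      p.coeff 0 = (toeplitz a M k).det / (toeplitz a M (k + 1)).det := by
  set T := toeplitz a M (k + 1) with hT
  -- The coefficients of p are the first column of the inverse matrix; biorthogonality is T T⁻¹ = 1
  -- read in that column.
  set v : Fin (k + 1) → ℝ := fun l => T⁻¹ l 0 with hv
  have hTv : ∀ j, ∑ l, T j l * v l = if j = 0 then 1 else 0 := by
    intro j
    have := congrFun (congrFun (T.mul_nonsing_inv (isUnit_iff_ne_zero.2 hD)) j) 0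
    rw [Matrix.mul_apply, Matrix.one_apply] at this
    exact this
  set p : ℝ[X] := ∑ l : Fin (k + 1), C (v l) * X ^ (l : ℕ) with hp
  have hcoeff : p.coeff 0 = v 0 := by
    rw [hp, finsetSum_coeff, Finset.sum_eq_single 0]
    · simp
    · intro l _ hl
      have : (0 : ℕ) ≠ l := fun h => hl (Fin.ext h.symm)
      simp [coeff_X_pow, this]
    · simp
  refine ⟨p, ?_, ?_, ?_⟩
  · refine natDegree_sum_le_of_forall_le _ _ fun l _ => ?_
    exact (natDegree_C_mul_X_pow_le _ _).trans (Nat.lt_succ_iff.1 l.2)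
  · intro j hj
    have h := hTv ⟨j, Nat.lt_succ_of_le hj⟩
    rw [polyInner_comm, hp, Finset.sum_mul, polyInner_sum_left]
    have e : ((⟨j, Nat.lt_succ_of_le hj⟩ : Fin (k + 1)) = 0) ↔ j = 0 := by simp [Fin.ext_iff]
    simp only [e] at h
    rw [← h]
    refine Finset.sum_congr rfl fun l _ => ?_
    rw [mul_assoc, polyInner_C_mul_left, polyInner_comm, mul_comm]
    rfl
  · rw [hcoeff, hv]
    simp only
    -- Cramer's rule: the cofactor at (0,0) deletes the first row and column, and shift invariance
    -- makes the rest the Toeplitz matrix of size k.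
    rw [Matrix.inv_def, Matrix.smul_apply, Ring.inverse_eq_inv', smul_eq_mul,
      Matrix.adjugate_fin_succ_eq_det_submatrix]
    simp only [Fin.val_zero, add_zero, pow_zero, one_mul, Fin.succAbove_zero]
    rw [hT, toeplitz_submatrix_succ, div_eq_inv_mul]

/-- The ratio of consecutive Toeplitz determinants. -/
def toeplitzRatio (a : ℕ → ℝ) (M k : ℕ) : ℝ := (toeplitz a M k).det / (toeplitz a M (k + 1)).det

lemma one_sub_toeplitzRatio_le {M k : ℕ} {a : ℕ → ℝ} {ρ : ℝ} (h0 : ∀ i < M, 0 < a i)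
    (ha : ∀ i < M, a i < ρ) (hρ0 : 0 < ρ) (hρ1 : ρ < 1) (hD : (toeplitz a M (k + 1)).det ≠ 0) :
    1 - toeplitzRatio a M k ≤ (ρ ^ (k + 1) * circleRatio a M ρ) ^ 2 := by
  obtain ⟨p, hp, horth, hc⟩ := exists_orthogonal_polynomial a M k hD
  rw [toeplitzRatio, ← hc]
  exact one_sub_coeff_zero_le h0 ha hρ0 hρ1 hp horth

lemma toeplitzRatio_le_exp {d : ℝ} (hd0 : 0 < d) (hd1 : d < 1) {a : ℕ → ℝ} {M k : ℕ}
    (ha0 : ∀ i < M, 0 < a i) (ha1 : ∀ i < M, a i < 1) (hD : (toeplitz a M (k + 1)).det ≠ 0) :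
    toeplitzRatio a M k ≤ Real.exp (-wellGain d a M k) := by
  obtain ⟨p, hp, horth, hc⟩ := exists_orthogonal_polynomial a M k hD
  rw [toeplitzRatio, ← hc]
  exact coeff_zero_le_exp_neg_wellGain hd0 hd1 ha0 ha1 hp horth

/-- The ratio r is both the constant coefficient and the squared norm of pA, so r ≥ r². -/
lemma toeplitzRatio_nonneg_le_one {a : ℕ → ℝ} {M k : ℕ} (hD : (toeplitz a M (k + 1)).det ≠ 0) :
    0 ≤ toeplitzRatio a M k ∧ toeplitzRatio a M k ≤ 1 := by
  obtain ⟨p, hp, horth, hc⟩ := exists_orthogonal_polynomial a M k hD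
  rw [toeplitzRatio, ← hc]
  have hself := polyInner_self_of_orthogonal hp horth
  set f := p * elemPoly a M
  have hf0 : f.coeff 0 = p.coeff 0 := by rw [mul_coeff_zero, elemPoly_coeff_zero, mul_one]
  rw [polyInner_eq_sum_range _ (Nat.lt_succ_self f.natDegree), Finset.sum_range_succ', hf0] at hself
  have h0 : 0 ≤ ∑ m ∈ Finset.range f.natDegree, f.coeff (m + 1) * f.coeff (m + 1) :=
    Finset.sum_nonneg fun m _ => mul_self_nonneg _
  constructor
  · nlinarith [mul_self_nonneg (p.coeff 0)]
  · nlinarith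

/-- Upper bound for the product of the factors of `circleRatio`. -/
lemma circleRatio_exp_le {M : ℕ} {a : ℕ → ℝ} {ε : ℝ} (hε0 : 0 < ε) (hε1 : ε ≤ 1)
    (h0 : ∀ i < M, 0 < a i) (h1 : ∀ i < M, a i < Real.exp (-ε))
    (h2 : ∀ i < M, 4 * ε ^ 2 ≤ (1 - a i) ^ 2) :
    circleRatio a M (Real.exp (-ε)) ≤ Real.exp (ε * (2 * ∑ i ∈ Finset.range M, a i / (1 - a i)) +
      20 * ε ^ 3 * ∑ i ∈ Finset.range M, a i / (1 - a i) ^ 3) := by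
  rw [circleRatio, Finset.mul_sum, Finset.mul_sum, Finset.mul_sum, ← Finset.sum_add_distrib,
    Real.exp_sum]
  have hη : |ε| ≤ 1 := by rwa [abs_of_pos hε0]
  have hη' : |-ε| ≤ 1 := by rwa [abs_neg]
  have hsinh : Real.sinh ε ≤ ε + ε ^ 3 := by
    have h3 := (abs_le.1 (Real.exp_bound hη (n := 3) (by norm_num))).2
    have h4 := (abs_le.1 (Real.exp_bound hη' (n := 3) (by norm_num))).1
    rw [abs_neg, abs_of_pos hε0] at h4
    rw [abs_of_pos hε0] at h3
    simp only [Finset.sum_range_succ, Finset.sum_range_zero, Nat.factorial] at h3 h4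
    norm_num at h3 h4
    have : 0 < ε ^ 3 := by positivity
    rw [Real.sinh_eq]
    linarith
  have hcosh : Real.cosh ε ≤ 1 + ε ^ 2 := by
    have h3 := (abs_le.1 (Real.abs_exp_sub_one_sub_id_le hη)).2
    have h4 := (abs_le.1 (Real.abs_exp_sub_one_sub_id_le hη')).2
    rw [Real.cosh_eq]
    nlinarith
  have hcosh1 := Real.one_le_cosh ε
  have hsinh0 := Real.sinh_pos_iff.2 hε0
  refine Finset.prod_le_prod (fun i hi => ?_) fun i hi => ?_
  all_goals
    have hi := Finset.mem_range.1 hi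
    have hpos := h0 i hi
    have hlt := h1 i hi
    have hsq := h2 i hi
    set b := a i
    have hρ : Real.exp (-ε) < 1 := by rw [Real.exp_lt_one_iff]; linarith
    have hb1 : b < 1 := hlt.trans hρ
    have hq0 : 0 < 1 - b / Real.exp (-ε) := sub_pos.2 ((div_lt_one (Real.exp_pos _)).2 hlt)
    have hp0 : 0 < 1 - b * Real.exp (-ε) := by nlinarith [Real.exp_pos (-ε)]
  · positivity
  · set y := (1 - b * Real.exp (-ε)) / (1 - b / Real.exp (-ε)) with hy
    have hyp : 0 < y := div_pos hp0 hq0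
    have hexp : Real.exp (-ε) * Real.exp ε = 1 := by rw [← Real.exp_add]; simp
    have hdiv : b / Real.exp (-ε) = b * Real.exp ε := by rw [Real.exp_neg, div_inv_eq_mul]
    have hy1 : 1 ≤ y := by
      rw [hy, one_le_div hq0, hdiv]
      have : Real.exp (-ε) ≤ Real.exp ε := Real.exp_le_exp.2 (by linarith)
      nlinarith
    -- Bounding log y by sinh(log y) = (y - 1/y)/2 makes the estimate rational in e^ε and loses only
    -- third order in ε.
    have h3 := Real.self_le_sinh_iff.2 (Real.log_nonneg hy1)
    rw [Real.sinh_log hyp] at h3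
    set w := 1 - b with hw
    have hw0 : 0 < w := by linarith
    set η := Real.cosh ε - 1 with hηdef
    have hη0 : 0 ≤ η := by linarith
    -- The hypothesis 4ε² ≤ (1 - a_i)² is used here, with cosh ε - 1 ≤ ε²; it keeps the denominator
    -- w² - 2bη at least w²/2.
    have hbη : 2 * b * η ≤ w ^ 2 / 2 := by nlinarith
    have hden : 0 < w ^ 2 - 2 * b * η := by nlinarith
    have h4 : (y - y⁻¹) / 2 = 2 * b * Real.sinh ε * ((w - b * η) / (w ^ 2 - 2 * b * η)) := by
      have e1 : (1 - b * Real.exp (-ε)) * (1 - b * Real.exp ε) = w ^ 2 - 2 * b * η := by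
        rw [hw, hηdef, Real.cosh_eq]
        linear_combination b ^ 2 * hexp
      have e2 : (1 - b * Real.exp (-ε)) ^ 2 - (1 - b * Real.exp ε) ^ 2 =
          2 * (2 * b * Real.sinh ε * (w - b * η)) := by
        rw [hw, hηdef, Real.cosh_eq, Real.sinh_eq]
        ring
      rw [hdiv] at hq0
      rw [hy, hdiv, inv_div, ← mul_div_assoc, ← e1]
      field_simp
      linarith
    have h5 : (w - b * η) / (w ^ 2 - 2 * b * η) ≤ 1 / w + 4 * η / w ^ 3 := by
      have e : 1 / w + 4 * η / w ^ 3 = (w ^ 2 + 4 * η) / w ^ 3 := by field_simp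
      rw [e, div_le_div_iff₀ hden (by positivity)]
      have t1 : 0 ≤ b * η * w ^ 3 := by positivity
      have t2 : 4 * η * (2 * b * η) ≤ 4 * η * (w ^ 2 / 2) := by gcongr
      have t3 : η * w ^ 2 * b ≤ η * w ^ 2 * 1 := by gcongr
      nlinarith
    have h6 : Real.log y ≤ ε * (2 * (b / w)) + 20 * ε ^ 3 * (b / w ^ 3) := by
      have hε3 : ε ^ 3 ≤ 1 := pow_le_one₀ hε0.le hε1
      have hw1 : w ≤ 1 := by linarith
      calc Real.log y ≤ 2 * b * Real.sinh ε * ((w - b * η) / (w ^ 2 - 2 * b * η)) := h4 ▸ h3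
        _ ≤ 2 * b * (ε + ε ^ 3) * (1 / w + 4 * ε ^ 2 / w ^ 3) := by
            have h7 : η ≤ ε ^ 2 := by linarith
            have h8 : 1 / w + 4 * η / w ^ 3 ≤ 1 / w + 4 * ε ^ 2 / w ^ 3 := by gcongr
            have h9 : 0 ≤ w - b * η := by nlinarith
            exact mul_le_mul (by gcongr) (h5.trans h8) (div_nonneg h9 hden.le) (by positivity)
        _ = ε * (2 * (b / w)) + 2 * ε ^ 3 * (b / w ^ 3) * (w ^ 2 + 4 + 4 * ε ^ 2) := by
            field_simp
            ring
        _ ≤ ε * (2 * (b / w)) + 2 * ε ^ 3 * (b / w ^ 3) * 10 := by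
            have : w ^ 2 + 4 + 4 * ε ^ 2 ≤ 10 := by nlinarith
            gcongr
        _ = _ := by ring
    calc y = Real.exp (Real.log y) := (Real.exp_log hyp).symm
      _ ≤ _ := Real.exp_le_exp.2 h6

end Toeplitz

end

/-! ### Partitions, horizontal strips and the Cauchy identity. -/

noncomputable section

open scoped ENNReal

/-- Integer partitions, as eventually vanishing nonincreasing sequences. -/
@[ext]
structure Par where
  /-- The parts of the partition. -/
  parts : ℕ → ℕ
  anti : ∀ i, parts (i + 1) ≤ parts i
  eventually_zero : ∃ n, ∀ i, n ≤ i → parts i = 0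

namespace Par

instance : CoeFun Par fun _ => ℕ → ℕ := ⟨parts⟩

lemma antitone (l : Par) : Antitone l := antitone_nat_of_succ_le l.anti

/-- The empty partition. -/
def empty : Par := ⟨fun _ => 0, fun _ => le_rfl, 0, fun _ _ => rfl⟩

/-- The sum of the parts. -/
def size (l : Par) : ℕ := ∑ᶠ i, l i

lemma size_eq_sum (l : Par) {N : ℕ} (hN : ∀ i, N ≤ i → l i = 0) :
    l.size = ∑ i ∈ Finset.range N, l i := by
  refine finsum_eq_sum_of_support_subset _ fun i hi => ?_
  by_contra h
  exact hi (hN i (by simpa using h))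

lemma size_empty : empty.size = 0 := by simp [size, empty]

/-- `Interlace ν l` holds if `ν / l` is a horizontal strip. -/
def Interlace (ν l : Par) : Prop := ∀ i, l i ≤ ν i ∧ ν (i + 1) ≤ l i

lemma size_mono {ν l : Par} (h : ∀ i, l i ≤ ν i) : l.size ≤ ν.size := by
  obtain ⟨N, hN⟩ := ν.eventually_zero
  rw [ν.size_eq_sum hN, l.size_eq_sum fun i hi => Nat.le_zero.1 (hN i hi ▸ h i)]
  exact Finset.sum_le_sum fun i _ => h i

lemma Interlace.size_le {ν l : Par} (h : Interlace ν l) : l.size ≤ ν.size :=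
  size_mono fun i => (h i).1

lemma interlace_empty_left {l : Par} : Interlace empty l ↔ l = empty := by
  constructor
  · intro h
    ext i
    exact Nat.le_zero.1 (h i).1
  · rintro rfl i
    exact ⟨le_rfl, le_rfl⟩

/-- The local move that exchanges common upper and common lower neighbours of two partitions. -/
def toggleDown (μ l ν : Par) (h1 : Interlace ν μ) (h2 : Interlace ν l) : Par where
  parts i := min (l i) (μ i) + max (l (i + 1)) (μ (i + 1)) - ν (i + 1)
  anti i := by
    have := h1 i; have := h2 i; have := h1 (i + 1); have := h2 (i + 1)
    have := l.anti i; have := μ.anti i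
    have := h1 (i + 1 + 1); have := h2 (i + 1 + 1)
    have := l.anti (i + 1); have := μ.anti (i + 1)
    omega
  eventually_zero := by
    obtain ⟨n, hn⟩ := l.eventually_zero
    refine ⟨n, fun i hi => ?_⟩
    have := hn i hi; have := hn (i + 1) (by omega); have := h1 (i + 1)
    omega

/-- The inverse local move. -/
def toggleUp (μ l κ : Par) (m : ℕ) (h1 : Interlace μ κ) (h2 : Interlace l κ) : Par where
  parts
    | 0 => max (l 0) (μ 0) + m
    | i + 1 => min (l i) (μ i) + max (l (i + 1)) (μ (i + 1)) - κ i
  anti i := by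
    cases i with
    | zero =>
      have := h1 0; have := h2 0
      simp only [zero_add] at *
      omega
    | succ i =>
      have := h1 i; have := h2 i; have := h1 (i + 1); have := h2 (i + 1)
      simp only
      omega
  eventually_zero := by
    obtain ⟨n, hn⟩ := l.eventually_zero
    obtain ⟨n', hn'⟩ := μ.eventually_zero
    refine ⟨max n n' + 1, fun i hi => ?_⟩
    obtain ⟨j, rfl⟩ : ∃ j, i = j + 1 := ⟨i - 1, by omega⟩
    have := hn j (by omega); have := hn (j + 1) (by omega); have := hn' (j + 1) (by omega)
    simp only
    omega

/-- Common upper neighbours of two partitions correspond to their common lower neighbours together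
with a natural number. -/
def toggleEquiv (μ l : Par) :
    {ν : Par // Interlace ν μ ∧ Interlace ν l} ≃
      ℕ × {κ : Par // Interlace μ κ ∧ Interlace l κ} where
  -- The entries ν_(i+1) and κ_i range over the same interval, from max(l_(i+1), μ_(i+1)) to
  -- min(l_i, μ_i), and correspond by reflecting it. Only ν_0 is unbounded above; its excess over
  -- max(l_0, μ_0) is the free natural number.
  toFun ν := (ν.1 0 - max (l 0) (μ 0), ⟨toggleDown μ l ν.1 ν.2.1 ν.2.2, by
    constructor <;> intro i
    all_goals
      have := ν.2.1 i; have := ν.2.2 i; have := ν.2.1 (i + 1); have := ν.2.2 (i + 1)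
      have := l.anti i; have := μ.anti i
      simp only [toggleDown]
      omega⟩)
  invFun κ := ⟨toggleUp μ l κ.2.1 κ.1 κ.2.2.1 κ.2.2.2, by
    obtain ⟨m, κ, h1, h2⟩ := κ
    constructor <;> intro i
    all_goals
      cases i with
      | zero =>
        have := h1 0; have := h2 0
        simp only [toggleUp, zero_add] at *
        omega
      | succ i =>
        have := h1 i; have := h2 i; have := h1 (i + 1); have := h2 (i + 1)
        simp only [toggleUp]
        omega⟩
  left_inv := by
    rintro ⟨ν, h1, h2⟩
    ext i
    cases i with
    | zero =>
      have := h1 0; have := h2 0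
      simp only [toggleUp]
      omega
    | succ i =>
      have := h1 i; have := h2 i; have := h1 (i + 1); have := h2 (i + 1)
      simp only [toggleUp, toggleDown]
      omega
  right_inv := by
    rintro ⟨m, κ, h1, h2⟩
    refine Prod.ext ?_ (Subtype.ext (Par.ext (funext fun i => ?_)))
    · simp [toggleUp]
    · have := h1 i; have := h2 i
      simp only [toggleUp, toggleDown]
      omega

/-- Reflection gives ν_(i+1) + κ_i = min(l_i, μ_i) + max(l_(i+1), μ_(i+1)); sum over i and use min +
max = l + μ. -/
lemma size_toggleUp (μ l κ : Par) (m : ℕ) (h1 : Interlace μ κ) (h2 : Interlace l κ) :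
    (toggleUp μ l κ m h1 h2).size + κ.size = m + l.size + μ.size := by
  set ν := toggleUp μ l κ m h1 h2 with hν
  obtain ⟨n₁, hn₁⟩ := l.eventually_zero
  obtain ⟨n₂, hn₂⟩ := μ.eventually_zero
  set N := max n₁ n₂ + 1
  have hl : ∀ i, N ≤ i → l i = 0 := fun i hi => hn₁ i (by omega)
  have hμ : ∀ i, N ≤ i → μ i = 0 := fun i hi => hn₂ i (by omega)
  have hκ : ∀ i, N ≤ i → κ i = 0 := fun i hi => by
    have := h1 i; have := hμ i hi
    omega
  have hνz : ∀ i, N + 1 ≤ i → ν i = 0 := fun i hi => by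
    obtain ⟨j, rfl⟩ : ∃ j, i = j + 1 := ⟨i - 1, by omega⟩
    have := hl j (by omega); have := hl (j + 1) (by omega); have := hμ (j + 1) (by omega)
    simp only [hν, toggleUp]
    omega
  rw [ν.size_eq_sum hνz, κ.size_eq_sum hκ, l.size_eq_sum hl, μ.size_eq_sum hμ,
    Finset.sum_range_succ', add_right_comm, ← Finset.sum_add_distrib, add_assoc m,
    ← Finset.sum_add_distrib]
  have e1 : ∀ i, ν (i + 1) + κ i = min (l i) (μ i) + max (l (i + 1)) (μ (i + 1)) := fun i => by
    have := h1 i; have := h2 i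
    simp only [hν, toggleUp]
    omega
  have e2 : ∀ i, l i + μ i = min (l i) (μ i) + max (l i) (μ i) := fun i => by omega
  have e3 : ν 0 = max (l 0) (μ 0) + m := rfl
  simp only [e1, e2, e3]
  rw [Finset.sum_add_distrib, Finset.sum_add_distrib]
  have e4 := Finset.sum_range_succ' (fun i => max (l i) (μ i)) N
  rw [Finset.sum_range_succ, hl N le_rfl, hμ N le_rfl] at e4
  simp only [max_self] at e4
  omega

open Classical in
/-- The operator that adds horizontal strips with weight `x` per box, transposed. -/
def up (x : ℝ≥0∞) (f : Par → ℝ≥0∞) (ν : Par) : ℝ≥0∞ :=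
  ∑' l, if Interlace ν l then x ^ (ν.size - l.size) * f l else 0

open Classical in
/-- The operator that removes horizontal strips with weight `y` per box, transposed. -/
def down (y : ℝ≥0∞) (f : Par → ℝ≥0∞) (μ : Par) : ℝ≥0∞ :=
  ∑' ν, if Interlace ν μ then y ^ (ν.size - μ.size) * f ν else 0

/-- Multiplication by `c ^ size`. -/
def scale (c : ℝ≥0∞) (f : Par → ℝ≥0∞) (l : Par) : ℝ≥0∞ := c ^ l.size * f l

open Classical in
/-- The indicator of the empty partition. -/
def delta (l : Par) : ℝ≥0∞ := if l = empty then 1 else 0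

/-- Under the toggle bijection the free natural number m contributes (xy)^m, whence the geometric
series. -/
lemma tsum_toggle (x y : ℝ≥0∞) (μ l : Par) :
    ∑' ν : {ν : Par // Interlace ν μ ∧ Interlace ν l},
      y ^ (ν.1.size - μ.size) * x ^ (ν.1.size - l.size) =
    (1 - x * y)⁻¹ * ∑' κ : {κ : Par // Interlace μ κ ∧ Interlace l κ},
      x ^ (μ.size - κ.1.size) * y ^ (l.size - κ.1.size) := by
  rw [← (toggleEquiv μ l).symm.tsum_eq, ← ENNReal.tsum_geometric, ← ENNReal.tsum_mul_right,
    ENNReal.tsum_prod']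
  refine tsum_congr fun m => ?_
  rw [← ENNReal.tsum_mul_left]
  refine tsum_congr fun κ => ?_
  have h := size_toggleUp μ l κ.1 m κ.2.1 κ.2.2
  have h1 := κ.2.1.size_le
  have h2 := κ.2.2.size_le
  change y ^ ((toggleUp μ l κ.1 m κ.2.1 κ.2.2).size - μ.size) *
    x ^ ((toggleUp μ l κ.1 m κ.2.1 κ.2.2).size - l.size) = _
  have e1 : (toggleUp μ l κ.1 m κ.2.1 κ.2.2).size - μ.size = m + (l.size - κ.1.size) := by omega
  have e2 : (toggleUp μ l κ.1 m κ.2.1 κ.2.2).size - l.size = m + (μ.size - κ.1.size) := by omega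
  rw [e1, e2, pow_add, pow_add, mul_pow]
  ring

lemma tsum_ite_eq_tsum_subtype {α : Type*} (p : α → Prop) [DecidablePred p] (f : α → ℝ≥0∞) :
    ∑' a, (if p a then f a else 0) = ∑' a : {a // p a}, f a := by
  rw [← tsum_subtype_eq_of_support_subset (s := {a | p a})]
  · refine tsum_congr fun a => ?_
    exact if_pos a.2
  · intro a ha
    by_contra h
    simp at h
    simp [h] at ha

/-- The commutation relation behind the Cauchy identity. -/
lemma down_up (x y : ℝ≥0∞) (f : Par → ℝ≥0∞) (μ : Par) :
    down y (up x f) μ = (1 - x * y)⁻¹ * up x (down y f) μ := by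
  classical
  have h1 : down y (up x f) μ = ∑' l, f l * ∑' ν : {ν : Par // Interlace ν μ ∧ Interlace ν l},
      y ^ (ν.1.size - μ.size) * x ^ (ν.1.size - l.size) := by
    unfold down up
    have : ∀ ν : Par, (if Interlace ν μ then y ^ (ν.size - μ.size) *
        ∑' l, (if Interlace ν l then x ^ (ν.size - l.size) * f l else 0) else 0) =
        ∑' l, f l * (if Interlace ν μ ∧ Interlace ν l then
          y ^ (ν.size - μ.size) * x ^ (ν.size - l.size) else 0) := by
      intro ν
      by_cases h : Interlace ν μ
      · rw [if_pos h, ← ENNReal.tsum_mul_left]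
        refine tsum_congr fun l => ?_
        by_cases h' : Interlace ν l
        · simp only [h, h', and_self, if_true]; ring
        · simp [h']
      · simp [h]
    rw [tsum_congr this, ENNReal.tsum_comm]
    refine tsum_congr fun l => ?_
    rw [ENNReal.tsum_mul_left]
    congr 1
    exact tsum_ite_eq_tsum_subtype _ _
  have h2 : up x (down y f) μ = ∑' l, f l * ∑' κ : {κ : Par // Interlace μ κ ∧ Interlace l κ},
      x ^ (μ.size - κ.1.size) * y ^ (l.size - κ.1.size) := by
    unfold down up
    have : ∀ κ : Par, (if Interlace μ κ then x ^ (μ.size - κ.size) *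
        ∑' l, (if Interlace l κ then y ^ (l.size - κ.size) * f l else 0) else 0) =
        ∑' l, f l * (if Interlace μ κ ∧ Interlace l κ then
          x ^ (μ.size - κ.size) * y ^ (l.size - κ.size) else 0) := by
      intro κ
      by_cases h : Interlace μ κ
      · rw [if_pos h, ← ENNReal.tsum_mul_left]
        refine tsum_congr fun l => ?_
        by_cases h' : Interlace l κ
        · simp only [h, h', and_self, if_true]; ring
        · simp [h']
      · simp [h]
    rw [tsum_congr this, ENNReal.tsum_comm]
    refine tsum_congr fun l => ?_
    rw [ENNReal.tsum_mul_left]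
    congr 1
    exact tsum_ite_eq_tsum_subtype _ _
  rw [h1, h2, ← ENNReal.tsum_mul_left]
  refine tsum_congr fun l => ?_
  rw [tsum_toggle]
  ring

lemma scale_up (c x : ℝ≥0∞) (f : Par → ℝ≥0∞) : scale c (up x f) = up (c * x) (scale c f) := by
  funext ν
  unfold scale up
  rw [← ENNReal.tsum_mul_left]
  refine tsum_congr fun l => ?_
  by_cases h : Interlace ν l
  · have := h.size_le
    rw [if_pos h, if_pos h, mul_pow]
    have e : c ^ ν.size = c ^ (ν.size - l.size) * c ^ l.size := by
      rw [← pow_add]; congr 1; omega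
    rw [e]; ring
  · simp [h]

lemma up_const_mul (x c : ℝ≥0∞) (f : Par → ℝ≥0∞) :
    up x (fun l => c * f l) = fun ν => c * up x f ν := by
  funext ν
  unfold up
  rw [← ENNReal.tsum_mul_left]
  refine tsum_congr fun l => ?_
  by_cases h : Interlace ν l <;> simp [h]
  ring

lemma down_const_mul (x c : ℝ≥0∞) (f : Par → ℝ≥0∞) :
    down x (fun l => c * f l) = fun ν => c * down x f ν := by
  funext ν
  unfold down
  rw [← ENNReal.tsum_mul_left]
  refine tsum_congr fun l => ?_
  by_cases h : Interlace l ν <;> simp [h]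
  ring

lemma scale_delta (c : ℝ≥0∞) : scale c delta = delta := by
  funext l
  unfold scale delta
  by_cases h : l = empty
  · simp [h, size_empty]
  · simp [h]

lemma down_delta (y : ℝ≥0∞) : down y delta = delta := by
  funext μ
  unfold down
  rw [tsum_eq_single empty]
  · by_cases h : μ = empty
    · simp [delta, h, interlace_empty_left.2, size_empty]
    · have : ¬ Interlace empty μ := fun h' => h (interlace_empty_left.1 h')
      simp [delta, h, this]
  · intro ν hν
    simp [delta, hν]

/-- The Schur function `s(a₀, …, a_{M-1})` as an iterated sum over horizontal strips. -/
def schur : (ℕ → ℝ≥0∞) → ℕ → Par → ℝ≥0∞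
  | _, 0 => delta
  | a, M + 1 => up (a 0) (schur (fun i => a (i + 1)) M)

lemma scale_schur (c : ℝ≥0∞) (a : ℕ → ℝ≥0∞) (M : ℕ) :
    scale c (schur a M) = schur (fun i => c * a i) M := by
  induction M generalizing a with
  | zero => exact scale_delta c
  | succ M ih => rw [schur, scale_up, ih, schur]

/-- Schur functions are eigenfunctions of strip removal: commuting past each `up` yields one factor,
and the empty partition is fixed. -/
lemma down_schur (y : ℝ≥0∞) (a : ℕ → ℝ≥0∞) (M : ℕ) :
    down y (schur a M) = fun l => (∏ i ∈ Finset.range M, (1 - a i * y)⁻¹) * schur a M l := by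
  induction M generalizing a with
  | zero => funext l; simp [schur, down_delta]
  | succ M ih =>
    funext l
    rw [schur, down_up, ih, up_const_mul, Finset.prod_range_succ']
    ring

lemma schur_empty (a : ℕ → ℝ≥0∞) (M : ℕ) : schur a M empty = 1 := by
  induction M generalizing a with
  | zero => simp [schur, delta]
  | succ M ih =>
    rw [schur, up, tsum_eq_single empty]
    · rw [if_pos (interlace_empty_left.2 rfl), ih]; simp
    · intro l hl
      rw [if_neg fun h => hl (interlace_empty_left.1 h)]

/-- Adjointness of adding and removing strips: both sides sum over the pairs for which ν/l is a
horizontal strip. -/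
lemma tsum_mul_up (x : ℝ≥0∞) (f g : Par → ℝ≥0∞) :
    ∑' ν, g ν * up x f ν = ∑' l, down x g l * f l := by
  unfold up down
  simp only [← ENNReal.tsum_mul_left, ← ENNReal.tsum_mul_right]
  rw [ENNReal.tsum_comm]
  refine tsum_congr fun l => tsum_congr fun ν => ?_
  by_cases h : Interlace ν l <;> simp [h]
  ring

/-- Iterated removal of horizontal strips. -/
def downs : (ℕ → ℝ≥0∞) → ℕ → (Par → ℝ≥0∞) → Par → ℝ≥0∞
  | _, 0, g => g
  | a, M + 1, g => downs (fun i => a (i + 1)) M (down (a 0) g)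

/-- Adjointness moves every strip addition onto `g`; what is left is its value at the empty
partition. -/
lemma tsum_mul_schur (a : ℕ → ℝ≥0∞) (M : ℕ) (g : Par → ℝ≥0∞) :
    ∑' l, g l * schur a M l = downs a M g empty := by
  induction M generalizing a g with
  | zero =>
    rw [tsum_eq_single empty]
    · simp [schur, delta, downs]
    · intro l hl
      simp [schur, delta, hl]
  | succ M ih => rw [schur, tsum_mul_up, ih, downs]

/-- The Cauchy identity. -/
lemma tsum_schur_mul_schur (a b : ℕ → ℝ≥0∞) (M N : ℕ) :
    ∑' l, schur a M l * schur b N l =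
      ∏ j ∈ Finset.range N, ∏ i ∈ Finset.range M, (1 - a i * b j)⁻¹ := by
  rw [tsum_mul_schur]
  have key : ∀ (N : ℕ) (b : ℕ → ℝ≥0∞) (c : ℝ≥0∞), downs b N (fun l => c * schur a M l) empty =
      c * ∏ j ∈ Finset.range N, ∏ i ∈ Finset.range M, (1 - a i * b j)⁻¹ := by
    intro N
    induction N with
    | zero => intro b c; simp [downs, schur_empty]
    | succ N ih =>
      intro b c
      rw [downs, down_const_mul, down_schur]
      simp only [← mul_assoc]
      rw [ih, Finset.prod_range_succ']
      ring
  have := key N b 1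
  simpa using this

end Par

end

/-! ### Conjugation, vertical strips and nonintersecting particles. -/

noncomputable section

open scoped ENNReal

namespace Par

/-- The conjugate partition. -/
def conj (l : Par) : Par where
  parts j := Nat.find (p := fun i => l i ≤ j) (by
    obtain ⟨n, hn⟩ := l.eventually_zero
    exact ⟨n, by rw [hn n le_rfl]; exact Nat.zero_le _⟩)
  anti j := Nat.find_mono fun i hi => Nat.le_succ_of_le hi
  eventually_zero := ⟨l 0, fun j hj => by simpa using hj⟩

/-- Both sides say that the box (i,j) lies in the diagram. The later facts about conjugates rest on
this equivalence. -/
lemma lt_conj {l : Par} {i j : ℕ} : i < conj l j ↔ j < l i := by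
  change i < Nat.find _ ↔ _
  rw [Nat.lt_find_iff]
  constructor
  · intro h
    exact not_le.1 (h i le_rfl)
  · intro h m hm
    exact not_le.2 (h.trans_le (l.antitone hm))

lemma conj_conj (l : Par) : conj (conj l) = l := by
  ext i
  refine eq_of_forall_lt_iff fun k => ?_
  rw [lt_conj, lt_conj]

/-- Conjugation as a permutation of the set of partitions. -/
def conjEquiv : Par ≃ Par := ⟨conj, conj, conj_conj, conj_conj⟩

lemma size_conj (l : Par) : (conj l).size = l.size := by
  obtain ⟨n, hn⟩ := l.eventually_zero
  set N := max n (l 0)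
  have h1 : ∀ i, N ≤ i → l i = 0 := fun i hi => hn i (by omega)
  have h2 : ∀ j, N ≤ j → conj l j = 0 := fun j hj => by
    by_contra h
    have := lt_conj.1 (Nat.pos_of_ne_zero h)
    omega
  rw [l.size_eq_sum h1, (conj l).size_eq_sum h2]
  have hcard : ∀ m ≤ N, ((Finset.range N).filter (· < m)).card = m := fun m hm => by
    rw [show (Finset.range N).filter (· < m) = Finset.range m by ext; simp; omega,
      Finset.card_range]
  have e1 : ∀ i, l i = ∑ j ∈ Finset.range N, if j < l i then 1 else 0 := fun i => by
    have : l i ≤ N := (l.antitone (Nat.zero_le i)).trans (le_max_right _ _)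
    rw [Finset.sum_boole, hcard _ this, Nat.cast_id]
  have e2 : ∀ j, conj l j = ∑ i ∈ Finset.range N, if i < conj l j then 1 else 0 := fun j => by
    have h3 : conj l 0 ≤ N := by
      by_contra h
      have := lt_conj.1 (not_le.1 h)
      rw [h1 N le_rfl] at this
      omega
    have : conj l j ≤ N := ((conj l).antitone (Nat.zero_le j)).trans h3
    rw [Finset.sum_boole, hcard _ this, Nat.cast_id]
  rw [Finset.sum_congr rfl fun i _ => e1 i, Finset.sum_congr rfl fun j _ => e2 j,
    Finset.sum_comm]
  simp only [lt_conj]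

lemma conj_empty : conj empty = empty := by
  ext j
  by_contra h
  have := lt_conj.1 (Nat.pos_of_ne_zero h)
  simp [empty] at this

lemma conj_eq_empty {l : Par} : conj l = empty ↔ l = empty := by
  constructor
  · intro h
    rw [← conj_conj l, h, conj_empty]
  · rintro rfl
    exact conj_empty

/-- `VStrip ν l` holds if `ν / l` is a vertical strip. -/
def VStrip (ν l : Par) : Prop := ∀ j, l j ≤ ν j ∧ ν j ≤ l j + 1

/-- After conjugation each part changes by at most one per step, so strips become Bernoulli steps of
particles and determinants apply. -/
lemma interlace_conj {ν l : Par} : Interlace (conj ν) (conj l) ↔ VStrip ν l := by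
  constructor
  · intro h j
    constructor
    · by_contra h1
      have h2 := lt_conj.2 (not_le.1 h1)
      have h3 := lt_conj.1 (h2.trans_le (h (ν j)).1)
      omega
    · by_contra h1
      have h2 := lt_conj.2 (not_le.1 h1)
      have h3 := lt_conj.1 (h2.trans_le (h (l j)).2)
      omega
  · intro h i
    constructor
    · by_contra h1
      have h2 := lt_conj.1 (not_le.1 h1)
      have h3 := lt_conj.2 (h2.trans_le (h (conj ν i)).1)
      omega
    · by_contra h1
      have h2 := lt_conj.1 (not_le.1 h1)
      have h3 := (h (conj l i)).2
      have h4 : i < l (conj l i) := by omega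
      have := lt_conj.2 h4
      omega

open Classical in
lemma up_conj (x : ℝ≥0∞) (f : Par → ℝ≥0∞) (ν : Par) :
    up x f (conj ν) =
      ∑' l, if VStrip ν l then x ^ (ν.size - l.size) * f (conj l) else 0 := by
  unfold up
  rw [← conjEquiv.tsum_eq]
  refine tsum_congr fun l => ?_
  by_cases h : VStrip ν l
  · rw [if_pos (show Interlace (conj ν) (conjEquiv l) from interlace_conj.2 h), if_pos h, size_conj]
    change x ^ (ν.size - (conj l).size) * f (conj l) = _
    rw [size_conj]
  · rw [if_neg fun h' : Interlace (conj ν) (conjEquiv l) => h (interlace_conj.1 h'), if_neg h]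

open Classical in
lemma down_conj (y : ℝ≥0∞) (f : Par → ℝ≥0∞) (μ : Par) :
    down y f (conj μ) =
      ∑' ν, if VStrip ν μ then y ^ (ν.size - μ.size) * f (conj ν) else 0 := by
  unfold down
  rw [← conjEquiv.tsum_eq]
  refine tsum_congr fun l => ?_
  by_cases h : VStrip l μ
  · rw [if_pos (show Interlace (conjEquiv l) (conj μ) from interlace_conj.2 h), if_pos h, size_conj]
    change y ^ ((conj l).size - μ.size) * f (conj l) = _
    rw [size_conj]
  · rw [if_neg fun h' : Interlace (conjEquiv l) (conj μ) => h (interlace_conj.1 h'), if_neg h]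

/-- The partition has at most `n` nonzero parts. -/
def Bounded (n : ℕ) (l : Par) : Prop := ∀ i, n ≤ i → l i = 0

lemma bounded_conj {n : ℕ} {l : Par} : Bounded n (conj l) ↔ l 0 ≤ n := by
  constructor
  · intro h
    by_contra h1
    have := lt_conj.2 (not_le.1 h1)
    rw [h n le_rfl] at this
    omega
  · intro h i hi
    by_contra h1
    have := lt_conj.1 (Nat.pos_of_ne_zero h1)
    omega

/-- The positions of the particles of a partition with at most `n` nonzero parts. -/
def pos (n : ℕ) (l : Par) (j : Fin n) : ℤ := l j + (n - 1 - j)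

lemma pos_nonneg (n : ℕ) (l : Par) (j : Fin n) : 0 ≤ pos n l j := by
  have := j.2
  unfold pos
  omega

lemma pos_strictAnti (n : ℕ) (l : Par) : StrictAnti (pos n l) := by
  intro i j hij
  have h1 : (i : ℕ) < j := hij
  have := l.antitone h1.le
  unfold pos
  omega

lemma pos_injective {n : ℕ} {l l' : Par} (hl : Bounded n l) (hl' : Bounded n l')
    (h : pos n l = pos n l') : l = l' := by
  ext i
  by_cases hi : i < n
  · have := congrFun h ⟨i, hi⟩
    simp only [pos] at this
    omega
  · rw [hl i (not_lt.1 hi), hl' i (not_lt.1 hi)]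

lemma exists_pos_eq {n : ℕ} {x : Fin n → ℤ} (hx : StrictAnti x) (h0 : ∀ j, 0 ≤ x j) :
    ∃ l, Bounded n l ∧ pos n l = x := by
  have hgap : ∀ k (i : ℕ) (h : i + k < n), x ⟨i + k, h⟩ + k ≤ x ⟨i, by omega⟩ := by
    intro k
    induction k with
    | zero => intro i h; simp
    | succ k ih =>
      intro i h
      have h1 := ih i (by omega)
      have h2 : x ⟨i + (k + 1), h⟩ < x ⟨i + k, by omega⟩ := hx (Fin.mk_lt_mk.2 (by omega))
      push_cast
      omega
  have hlow : ∀ j : Fin n, ((n : ℤ) - 1 - j) ≤ x j := by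
    intro j
    have h1 := hgap (n - 1 - j) j (by omega)
    have h2 := h0 ⟨j + (n - 1 - j), by omega⟩
    have h3 : x ⟨(j : ℕ), by omega⟩ = x j := rfl
    omega
  refine ⟨⟨fun i => if h : i < n then (x ⟨i, h⟩ - (n - 1 - i)).toNat else 0, fun i => ?_, n,
    fun i hi => by simp [not_lt.2 hi]⟩, fun i hi => by simp [not_lt.2 hi], ?_⟩
  · by_cases h : i + 1 < n
    · have h1 := hgap 1 i h
      simp only [h, (by omega : i < n), dif_pos]
      push_cast at *
      omega
    · simp [h]
  · funext j
    have h1 := hlow j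
    simp only [pos, j.2, dif_pos, Fin.eta]
    omega

/-- Multilinearity in the rows; S is the set of particles that jump. -/
lemma det_add_smul {n : ℕ} (u v : Fin n → Fin n → ℝ) (a : ℝ) :
    (Matrix.of fun j => u j + a • v j).det =
      ∑ S : Finset (Fin n), a ^ S.card * (Matrix.of (S.piecewise v u)).det := by
  have h := (Matrix.detRowAlternating (R := ℝ) (n := Fin n)).toMultilinearMap.map_add_univ
    (fun j => a • v j) u
  have e : (fun j => u j + a • v j) = (fun j => a • v j) + u := by
    funext j; simp [add_comm]
  calc (Matrix.of fun j => u j + a • v j).det =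
        ∑ S : Finset (Fin n), (Matrix.of (S.piecewise (fun j => a • v j) u)).det := by
        rw [e]; exact h
    _ = _ := by
        refine Finset.sum_congr rfl fun S _ => ?_
        have h2 := (Matrix.detRowAlternating (R := ℝ) (n := Fin n)).toMultilinearMap.map_piecewise_smul
          (fun _ => a) (S.piecewise v u) S
        have e2 : (S.piecewise (fun i => a • S.piecewise v u i) (S.piecewise v u)) =
            S.piecewise (fun j => a • v j) u := by
          funext j
          by_cases hj : j ∈ S <;> simp [hj]
        rw [e2] at h2
        rw [Finset.prod_const, smul_eq_mul] at h2
        exact h2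

/-- The determinant with rows `c (x₁), …, c (xₙ)` at the particle positions of `l`. -/
def detAt {n : ℕ} (c : ℤ → Fin n → ℝ) (l : Par) : ℝ := (Matrix.of fun j => c (pos n l j)).det

open Classical in
/-- One step of nonintersecting Bernoulli walkers, in terms of determinants. -/
lemma tsum_strip_eq_det {n : ℕ} {x : Fin n → ℤ} (hx : StrictAnti x)
    {e : ℤ} (he : e = 1 ∨ e = -1) {c : ℤ → Fin n → ℝ} (hc : ∀ y < 0, c y = 0) {a : ℝ} (ha : 0 ≤ a)
    {g : Par → ℝ≥0∞} (hg : ∀ l, Bounded n l → 0 ≤ detAt c l ∧ g l = ENNReal.ofReal (detAt c l)) :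
    0 ≤ (Matrix.of fun j => c (x j) + a • c (x j + e)).det ∧
    ∑' l, (if Bounded n l ∧ ∀ j, pos n l j = x j ∨ pos n l j = x j + e then
      ENNReal.ofReal a ^ (Finset.univ.filter fun j => pos n l j ≠ x j).card * g l else 0) =
      ENNReal.ofReal (Matrix.of fun j => c (x j) + a • c (x j + e)).det := by
  set y : Finset (Fin n) → Fin n → ℤ := fun S j => if j ∈ S then x j + e else x j with hy
  set T : Finset (Fin n) → ℝ := fun S => (Matrix.of fun j => c (y S j)).det with hT
  have hdet : (Matrix.of fun j => c (x j) + a • c (x j + e)).det = ∑ S, a ^ S.card * T S := by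
    rw [det_add_smul]
    refine Finset.sum_congr rfl fun S _ => ?_
    congr 3
    funext j
    by_cases hj : j ∈ S <;> simp [hy, hj]
  -- Particles jump by one in a common direction, so a broken order means a collision, that is, two
  -- equal rows.
  have hanti : ∀ S, T S ≠ 0 → StrictAnti (y S) := by
    intro S hS i j hij
    by_contra h
    have h1 := hx hij
    have h2 : y S i = y S j := by
      simp only [hy] at h ⊢
      rcases he with rfl | rfl <;> split_ifs at h ⊢ <;> omega
    refine hS (Matrix.det_zero_of_row_eq hij.ne ?_)
    funext k
    simp only [Matrix.of_apply, h2]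
  -- A particle pushed below 0 gives a zero row. With the previous step, the surviving sets S
  -- correspond to genuine partitions.
  have hnonneg : ∀ S, T S ≠ 0 → ∀ j, 0 ≤ y S j := by
    intro S hS j
    by_contra h
    refine hS (Matrix.det_eq_zero_of_row_eq_zero j fun k => ?_)
    simp only [Matrix.of_apply, hc _ (not_le.1 h), Pi.zero_apply]
  have hex : ∀ S, T S ≠ 0 → ∃ l, Bounded n l ∧ pos n l = y S := fun S hS =>
    exists_pos_eq (hanti S hS) (hnonneg S hS)
  have hT0 : ∀ S, 0 ≤ T S := by
    intro S
    by_cases hS : T S = 0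
    · exact hS.ge
    · obtain ⟨l, hl, hp⟩ := hex S hS
      have := (hg l hl).1
      rwa [detAt, hp] at this
  have hterm : ∀ S, 0 ≤ a ^ S.card * T S := fun S => mul_nonneg (pow_nonneg ha _) (hT0 S)
  refine ⟨hdet ▸ Finset.sum_nonneg fun S _ => hterm S, ?_⟩
  rw [hdet, ENNReal.ofReal_sum_of_nonneg fun S _ => hterm S,
    ← tsum_fintype (f := fun S => ENNReal.ofReal (a ^ S.card * T S)) (L := .unconditional _)]
  symm
  set F : Par → ℝ≥0∞ := fun l => if Bounded n l ∧ ∀ j, pos n l j = x j ∨ pos n l j = x j + e then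
      ENNReal.ofReal a ^ (Finset.univ.filter fun j => pos n l j ≠ x j).card * g l else 0 with hF
  have hsupp : ∀ l, F l ≠ 0 → Bounded n l ∧ ∀ j, pos n l j = x j ∨ pos n l j = x j + e := by
    intro l hl
    by_contra h
    exact hl (if_neg h)
  have hyS : ∀ l, (∀ j, pos n l j = x j ∨ pos n l j = x j + e) →
      y (Finset.univ.filter fun j => pos n l j ≠ x j) = pos n l := by
    intro l h
    funext j
    by_cases hj : pos n l j = x j
    · simp [hy, hj]
    · simp [hy, (h j).resolve_left hj]
  have hval : ∀ l, (Bounded n l ∧ ∀ j, pos n l j = x j ∨ pos n l j = x j + e) →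
      ENNReal.ofReal (a ^ (Finset.univ.filter fun j => pos n l j ≠ x j).card *
        T (Finset.univ.filter fun j => pos n l j ≠ x j)) = F l := by
    intro l h
    rw [hF]
    simp only
    rw [if_pos h, (hg l h.1).2, ENNReal.ofReal_mul (pow_nonneg ha _), ENNReal.ofReal_pow ha]
    simp only [hT, hyS l h.2, detAt]
  refine tsum_eq_tsum_of_ne_zero_bij
    (fun l : Function.support F => Finset.univ.filter fun j => pos n l.1 j ≠ x j) ?_ ?_ ?_
  · intro l l' h
    have h1 := hsupp l.1 l.2
    have h2 := hsupp l'.1 l'.2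
    refine Subtype.ext (pos_injective h1.1 h2.1 ?_)
    rw [← hyS _ h1.2, ← hyS _ h2.2]
    exact congrArg y h
  · intro S hS
    have hTS : T S ≠ 0 := fun h => hS (by simp [h])
    obtain ⟨l, hl, hp⟩ := hex S hTS
    have hl2 : ∀ j, pos n l j = x j ∨ pos n l j = x j + e := by
      intro j
      rw [hp]
      by_cases hj : j ∈ S <;> simp [hy, hj]
    have hSl : (Finset.univ.filter fun j => pos n l j ≠ x j) = S := by
      ext j
      rw [hp]
      by_cases hj : j ∈ S
      · have : e ≠ 0 := by rcases he with rfl | rfl <;> decide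
        simp [hy, hj, this]
      · simp [hy, hj]
    refine ⟨⟨l, ?_⟩, hSl⟩
    change F l ≠ 0
    rw [← hval l ⟨hl, hl2⟩, hSl]
    exact hS
  · intro l
    exact hval l.1 (hsupp l.1 l.2)

end Par

end

/-! ### Dual Jacobi–Trudi and the truncated Cauchy sum as a Toeplitz determinant. -/

noncomputable section

open scoped ENNReal

open Polynomial in
lemma polyInner_X_pow_left (k : ℕ) (g : ℝ[X]) : polyInner (X ^ k) g = g.coeff k := by
  rw [polyInner, ← monomial_one_right_eq_X_pow, sum_monomial_index] <;> simp

open Polynomial in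
lemma polyInner_add_left (f₁ f₂ g : ℝ[X]) :
    polyInner (f₁ + f₂) g = polyInner f₁ g + polyInner f₂ g := by
  rw [polyInner, sum_add_index] <;> simp [polyInner, add_mul]

open Polynomial in
lemma elemPoly_succ (a : ℕ → ℝ) (M : ℕ) :
    elemPoly a (M + 1) = (1 + C (a 0) * X) * elemPoly (fun i => a (i + 1)) M := by
  rw [elemPoly, Finset.prod_range_succ', mul_comm, elemPoly]

namespace Par

lemma VStrip.card_eq {n : ℕ} {ν l : Par} (hν : Bounded n ν) (h : VStrip ν l) :
    (Finset.univ.filter fun j => pos n l j ≠ pos n ν j).card = ν.size - l.size := by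
  have hl : Bounded n l := fun i hi => Nat.le_zero.1 (hν i hi ▸ (h i).1)
  rw [ν.size_eq_sum hν, l.size_eq_sum hl, ← Fin.sum_univ_eq_sum_range,
    ← Fin.sum_univ_eq_sum_range, Finset.card_filter]
  refine (Nat.sub_eq_of_eq_add ?_).symm
  rw [← Finset.sum_add_distrib]
  refine Finset.sum_congr rfl fun j _ => ?_
  have := h j
  by_cases hj : l j = ν j
  · simp [pos, hj]
  · have : ν j = l j + 1 := by omega
    simp [pos, this, add_comm]

lemma vStrip_iff_left {n : ℕ} {ν l : Par} (hν : Bounded n ν) :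
    VStrip ν l ↔ Bounded n l ∧ ∀ j, pos n l j = pos n ν j ∨ pos n l j = pos n ν j + -1 := by
  constructor
  · intro h
    refine ⟨fun i hi => Nat.le_zero.1 (hν i hi ▸ (h i).1), fun j => ?_⟩
    have := h j
    simp only [pos]
    omega
  · rintro ⟨hl, h⟩ j
    by_cases hj : j < n
    · have := h ⟨j, hj⟩
      simp only [pos] at this
      omega
    · rw [hν j (not_lt.1 hj), hl j (not_lt.1 hj)]
      omega

lemma vStrip_iff_right {n : ℕ} {ν l : Par} (hν : Bounded n ν) (hl : Bounded n l) :
    VStrip ν l ↔ ∀ j, pos n ν j = pos n l j ∨ pos n ν j = pos n l j + 1 := by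
  rw [vStrip_iff_left hν]
  constructor
  · rintro ⟨-, h⟩ j
    have := h j
    omega
  · intro h
    refine ⟨hl, fun j => ?_⟩
    have := h j
    omega

open Polynomial in
/-- The rows of the matrices whose determinants describe sums over vertical strips. -/
def rowCoeff {n : ℕ} (R P : ℝ[X]) (x : ℤ) (i : Fin n) : ℝ :=
  if 0 ≤ x then polyInner (X ^ x.toNat * R) (X ^ (n - 1 - i : ℕ) * P) else 0

open Polynomial in
lemma rowCoeff_of_neg {n : ℕ} (R P : ℝ[X]) {x : ℤ} (hx : x < 0) :
    (rowCoeff R P x : Fin n → ℝ) = 0 := by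
  funext i
  simp [rowCoeff, not_le.2 hx]

open Polynomial in
-- A factor 1 + aX on the right lets a particle step down by one. At x = 0 the shifted row sits at
-- -1 and is zero by convention, matching the missing coefficient.
lemma rowCoeff_one_mul {n : ℕ} (a : ℝ) (P : ℝ[X]) (x : ℤ) :
    (rowCoeff 1 ((1 + C a * X) * P) x : Fin n → ℝ) =
      rowCoeff 1 P x + a • rowCoeff 1 P (x + -1) := by
  rcases lt_or_ge x 0 with hx | hx
  · rw [rowCoeff_of_neg _ _ hx, rowCoeff_of_neg _ _ hx, rowCoeff_of_neg _ _ (by omega)]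
    simp
  · obtain ⟨m, rfl⟩ := Int.eq_ofNat_of_zero_le hx
    funext i
    have e : X ^ (n - 1 - i : ℕ) * ((1 + C a * X) * P) =
      X ^ (n - 1 - i : ℕ) * P + C a * (X * (X ^ (n - 1 - i : ℕ) * P)) := by ring
    cases m with
    | zero =>
      have h1 : ¬ (0 : ℤ) ≤ ((0 : ℕ) : ℤ) + -1 := by omega
      have h2 : (0 : ℤ) ≤ ((0 : ℕ) : ℤ) := le_rfl
      simp only [rowCoeff, Pi.add_apply, Pi.smul_apply, if_pos h2, if_neg h1, Int.toNat_natCast,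
        mul_one, polyInner_X_pow_left, e, coeff_add, coeff_C_mul, coeff_X_mul_zero, mul_zero,
        smul_zero]
    | succ m =>
      have h1 : (0 : ℤ) ≤ ((m + 1 : ℕ) : ℤ) := by positivity
      have h2 : (((m + 1 : ℕ) : ℤ) + -1) = (m : ℤ) := by push_cast; ring
      have h3 : (0 : ℤ) ≤ (m : ℤ) := by positivity
      simp only [rowCoeff, Pi.add_apply, Pi.smul_apply, h2, if_pos h1, if_pos h3,
        Int.toNat_natCast, mul_one, polyInner_X_pow_left, e, coeff_add, coeff_C_mul, coeff_X_mul,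
        smul_eq_mul]

open Polynomial in
-- A factor 1 + aX on the left lets a particle step up. Nonnegativity of x is needed: at x = -1 the
-- left side is zero by convention, while row 0 need not be.
lemma rowCoeff_mul {n : ℕ} (a : ℝ) (R P : ℝ[X]) {x : ℤ} (hx : 0 ≤ x) :
    (rowCoeff ((1 + C a * X) * R) P x : Fin n → ℝ) =
      rowCoeff R P x + a • rowCoeff R P (x + 1) := by
  obtain ⟨m, rfl⟩ := Int.eq_ofNat_of_zero_le hx
  funext i
  have h1 : (0 : ℤ) ≤ (m : ℤ) := by positivity
  have h2 : ((m : ℤ) + 1).toNat = m + 1 := by omega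
  have h3 : (0 : ℤ) ≤ (m : ℤ) + 1 := by omega
  have e : X ^ m * ((1 + C a * X) * R) = X ^ m * R + C a * (X ^ (m + 1) * R) := by ring
  simp only [rowCoeff, Pi.add_apply, Pi.smul_apply, if_pos h1, if_pos h3, h2,
    Int.toNat_natCast, e, polyInner_add_left, polyInner_C_mul_left, smul_eq_mul]

/-- The dual Jacobi–Trudi formula. -/
lemma schur_conj {n M : ℕ} {a : ℕ → ℝ} (ha : ∀ i, 0 ≤ a i) {ν : Par} (hν : Bounded n ν) :
    0 ≤ detAt (n := n) (rowCoeff 1 (elemPoly a M)) ν ∧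
      schur (fun i => ENNReal.ofReal (a i)) M (conj ν) =
        ENNReal.ofReal (detAt (n := n) (rowCoeff 1 (elemPoly a M)) ν) := by
  classical
  induction M generalizing a ν with
  | zero =>
    by_cases h : ν = empty
    · subst h
      have : detAt (n := n) (rowCoeff 1 (elemPoly a 0)) empty = 1 := by
        -- The particles of the empty partition sit at n-1-j, exactly the column shifts, so the
        -- matrix is the identity.
        rw [detAt, ← Matrix.det_one (n := Fin n) (R := ℝ)]
        refine congrArg Matrix.det (Matrix.ext fun j i => ?_)
        have h0 := pos_nonneg n empty j
        have h1 : (pos n empty j).toNat = n - 1 - j := by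
          have := j.2
          simp only [pos, empty]
          omega
        simp only [Matrix.of_apply, rowCoeff, if_pos h0, h1, elemPoly, Finset.prod_range_zero,
          mul_one, polyInner_X_pow_left, Polynomial.coeff_X_pow, Matrix.one_apply]
        have := i.2
        have := j.2
        exact if_congr (by rw [Fin.ext_iff]; omega) rfl rfl
      simp [this, conj_empty, schur_empty]
    · have h2 : ν 0 ≠ 0 := fun h0 => h <| by
        ext i
        exact Nat.le_zero.1 (h0 ▸ ν.antitone (Nat.zero_le i))
      have hn : 0 < n := by
        by_contra h0
        exact h2 (hν 0 (by omega))
      have h3 : detAt (n := n) (rowCoeff 1 (elemPoly a 0)) ν = 0 := by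
        refine Matrix.det_eq_zero_of_row_eq_zero ⟨0, hn⟩ fun i => ?_
        have h0 := pos_nonneg n ν ⟨0, hn⟩
        simp only [Matrix.of_apply, rowCoeff, if_pos h0, elemPoly, Finset.prod_range_zero,
          mul_one, polyInner_X_pow_left, Polynomial.coeff_X_pow]
        refine if_neg ?_
        simp only [pos]
        omega
      rw [h3]
      simp [schur, delta, conj_eq_empty, h]
  | succ M ih =>
    have key := tsum_strip_eq_det (pos_strictAnti n ν) (Or.inr rfl)
      (fun y hy => rowCoeff_of_neg (n := n) 1 (elemPoly (fun i => a (i + 1)) M) hy) (ha 0)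
      (g := fun l => schur (fun i => ENNReal.ofReal (a (i + 1))) M (conj l))
      (fun l hl => ih (fun i => ha (i + 1)) hl)
    have e : detAt (n := n) (rowCoeff 1 (elemPoly a (M + 1))) ν = (Matrix.of fun j =>
        rowCoeff (n := n) 1 (elemPoly (fun i => a (i + 1)) M) (pos n ν j) +
        a 0 • rowCoeff 1 (elemPoly (fun i => a (i + 1)) M) (pos n ν j + -1)).det := by
      simp only [detAt, elemPoly_succ, rowCoeff_one_mul]
    rw [e]
    refine ⟨key.1, ?_⟩
    rw [← key.2, schur, up_conj]
    refine tsum_congr fun l => ?_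
    by_cases h : VStrip ν l
    · rw [if_pos h, if_pos ((vStrip_iff_left hν).1 h), h.card_eq hν]
    · rw [if_neg h, if_neg fun h' => h ((vStrip_iff_left hν).2 h')]

open Polynomial in
-- Each strip removal is one Bernoulli step and multiplies the left polynomial by a factor of A. The
-- number of particles stays n because g vanishes on conjugates of partitions with more than n
-- parts.
lemma downs_conj {n M : ℕ} {a : ℕ → ℝ} (ha : ∀ i, 0 ≤ a i) {R P : ℝ[X]} {g : Par → ℝ≥0∞}
    (hg : ∀ l, Bounded n l → 0 ≤ detAt (n := n) (rowCoeff R P) l ∧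
      g (conj l) = ENNReal.ofReal (detAt (n := n) (rowCoeff R P) l))
    (hg0 : ∀ l, ¬ Bounded n l → g (conj l) = 0) :
    downs (fun i => ENNReal.ofReal (a i)) M g empty =
      ENNReal.ofReal (detAt (n := n) (rowCoeff (elemPoly a M * R) P) empty) := by
  classical
  induction M generalizing a R g with
  | zero =>
    have := (hg empty fun i _ => rfl).2
    rw [conj_empty] at this
    simp [downs, this, elemPoly]
  | succ M ih =>
    have e : elemPoly a (M + 1) * R =
        elemPoly (fun i => a (i + 1)) M * ((1 + C (a 0) * X) * R) := by
      rw [elemPoly_succ]; ring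
    rw [downs, e]
    refine ih (fun i => ha (i + 1)) (fun μ hμ => ?_) fun μ hμ => ?_
    · have key := tsum_strip_eq_det (pos_strictAnti n μ) (Or.inl rfl)
        (fun y hy => rowCoeff_of_neg (n := n) R P hy) (ha 0) (g := fun l => g (conj l)) hg
      have e : detAt (n := n) (rowCoeff ((1 + C (a 0) * X) * R) P) μ = (Matrix.of fun j =>
          rowCoeff (n := n) R P (pos n μ j) + a 0 • rowCoeff R P (pos n μ j + 1)).det := by
        rw [detAt]
        congr 2
        funext j
        exact rowCoeff_mul _ _ _ (pos_nonneg n μ j)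
      rw [e]
      refine ⟨key.1, ?_⟩
      rw [← key.2, down_conj]
      refine tsum_congr fun ν => ?_
      by_cases hν : Bounded n ν
      · by_cases h : VStrip ν μ
        · rw [if_pos h, if_pos ⟨hν, (vStrip_iff_right hν hμ).1 h⟩, ← h.card_eq hν]
          simp only [ne_comm]
        · rw [if_neg h, if_neg fun h' => h ((vStrip_iff_right hν hμ).2 (And.right h'))]
      · rw [hg0 ν hν, mul_zero, ite_self, if_neg fun h' => hν h'.1]
    · rw [down_conj, ENNReal.tsum_eq_zero]
      intro ν
      split_ifs with h
      · rw [hg0 ν fun hν => hμ fun i hi => Nat.le_zero.1 (hν i hi ▸ (h i).1), mul_zero]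
      · rfl

open Classical in
/-- The truncated Cauchy sum is a Toeplitz determinant. -/
lemma tsum_schur_sq_eq_det {a : ℕ → ℝ} (ha : ∀ i, 0 ≤ a i) (M n : ℕ) :
    ∑' l : Par, (if l 0 ≤ n then schur (fun i => ENNReal.ofReal (a i)) M l ^ 2 else 0) =
      ENNReal.ofReal (toeplitz a M n).det := by
  set s := schur (fun i => ENNReal.ofReal (a i)) M with hs
  -- The cutoff is attached to one factor only; the other is unfolded into strip removals.
  have h1 : ∀ l : Par, (if l 0 ≤ n then s l ^ 2 else 0) = (if l 0 ≤ n then s l else 0) * s l := by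
    intro l
    split_ifs
    · exact sq _
    · exact (zero_mul _).symm
  rw [tsum_congr h1, tsum_mul_schur,
    downs_conj (n := n) (R := 1) (P := elemPoly a M) ha (fun l hl => ?_) fun l hl => ?_]
  · congr 1
    -- Particles are listed in decreasing order, so row and column indices are both reversed.
    rw [detAt, ← Matrix.det_submatrix_equiv_self Fin.revPerm (toeplitz a M n)]
    congr 1
    ext j i
    have h0 := pos_nonneg n empty j
    have hp : (pos n empty j).toNat = n - 1 - j := by
      have := j.2
      simp only [pos, empty]
      omega
    simp only [Matrix.of_apply, rowCoeff, if_pos h0, hp, toeplitz, Matrix.submatrix_apply,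
      Fin.revPerm_apply, Fin.val_rev, mul_one, Nat.sub_sub, add_comm]
  · have := schur_conj (M := M) ha hl
    refine ⟨this.1, ?_⟩
    rw [if_pos ?_]
    · exact this.2
    rwa [← bounded_conj, conj_conj]
  · refine if_neg ?_
    rwa [← bounded_conj, conj_conj]

/-- The empty partition alone contributes 1 to the sum. In particular all the ratios of determinants
are defined. -/
lemma one_le_det_toeplitz {a : ℕ → ℝ} (ha : ∀ i, 0 ≤ a i) (M n : ℕ) :
    1 ≤ (toeplitz a M n).det := by
  classical
  have h := ENNReal.le_tsum (f := fun l : Par =>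
    if l 0 ≤ n then schur (fun i => ENNReal.ofReal (a i)) M l ^ 2 else 0) empty
  rw [tsum_schur_sq_eq_det ha, if_pos (by simp [empty]), schur_empty, one_pow] at h
  exact ENNReal.one_le_ofReal.1 h

end Par

end

/-! ### Transfer operators along the diagonals. -/

noncomputable section

open scoped ENNReal

namespace Par

/-- The `N`-step transfer operator of a sequence of kernels. -/
def transfer : (ℕ → Par → Par → ℝ≥0∞) → ℕ → (Par → ℝ≥0∞) → Par → ℝ≥0∞
  | _, 0, g => g
  | K, N + 1, g => fun l => ∑' κ, K 0 l κ * transfer (fun k => K (k + 1)) N g κ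

lemma transfer_add (K : ℕ → Par → Par → ℝ≥0∞) (m n : ℕ) (g : Par → ℝ≥0∞) :
    transfer K (m + n) g = transfer K m (transfer (fun k => K (m + k)) n g) := by
  induction m generalizing K with
  | zero => simp [transfer]
  | succ m ih =>
    funext l
    rw [Nat.succ_add_eq_add_succ, Nat.add_succ, transfer, transfer, ih]
    simp only [Nat.add_right_comm m _ 1, add_assoc, add_comm 1]

/-- The transfer operator as a sum over paths. -/
lemma transfer_eq_tsum (K : ℕ → Par → Par → ℝ≥0∞) (N : ℕ) (g : Par → ℝ≥0∞) (l : Par) :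
    transfer K N g l = ∑' σ : Fin N → Par,
      (∏ k : Fin N, K k ((Fin.cons l σ : Fin (N + 1) → Par) k.castSucc)
        ((Fin.cons l σ : Fin (N + 1) → Par) k.succ)) *
        g ((Fin.cons l σ : Fin (N + 1) → Par) (Fin.last N)) := by
  induction N generalizing K l with
  | zero => simp [transfer]
  | succ N ih =>
    rw [← (Fin.consEquiv fun _ : Fin (N + 1) => Par).tsum_eq, ENNReal.tsum_prod', transfer]
    refine tsum_congr fun κ => ?_
    rw [ih, ← ENNReal.tsum_mul_left]
    refine tsum_congr fun σ => ?_
    rw [Fin.prod_univ_succ, mul_assoc]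
    rfl

open Classical in
/-- The kernel of `scale Q ∘ up 1`. -/
def shrinkKernel (Q : ℝ≥0∞) (l κ : Par) : ℝ≥0∞ := if Interlace l κ then Q ^ l.size else 0

open Classical in
/-- The kernel of `scale Q ∘ down 1`. -/
def growKernel (Q : ℝ≥0∞) (l κ : Par) : ℝ≥0∞ := if Interlace κ l then Q ^ l.size else 0

lemma tsum_shrinkKernel (Q : ℝ≥0∞) (g : Par → ℝ≥0∞) (l : Par) :
    ∑' κ, shrinkKernel Q l κ * g κ = scale Q (up 1 g) l := by
  unfold scale up shrinkKernel
  rw [← ENNReal.tsum_mul_left]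
  refine tsum_congr fun κ => ?_
  split_ifs <;> simp

lemma tsum_growKernel (Q : ℝ≥0∞) (g : Par → ℝ≥0∞) (l : Par) :
    ∑' κ, growKernel Q l κ * g κ = scale Q (down 1 g) l := by
  unfold scale down growKernel
  rw [← ENNReal.tsum_mul_left]
  refine tsum_congr fun κ => ?_
  split_ifs <;> simp

lemma tsum_mul_scale_up (Q : ℝ≥0∞) (f g : Par → ℝ≥0∞) :
    ∑' l, f l * scale Q (up 1 g) l = ∑' l, down 1 (scale Q f) l * g l := by
  rw [← tsum_mul_up]
  exact tsum_congr fun l => by unfold scale; ring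

lemma tsum_mul_scale_down (Q : ℝ≥0∞) (f g : Par → ℝ≥0∞) :
    ∑' l, f l * scale Q (down 1 g) l = ∑' l, up 1 (scale Q f) l * g l := by
  have := tsum_mul_up 1 (scale Q f) g
  simp only [mul_comm (up 1 (scale Q f) _), this]
  exact tsum_congr fun l => by unfold scale; ring

lemma transfer_shrinkKernel (Q : ℝ≥0∞) (N : ℕ) :
    transfer (fun _ => shrinkKernel Q) N delta = schur (fun i => Q ^ (i + 1)) N := by
  induction N with
  | zero => rfl
  | succ N ih =>
    funext l
    rw [transfer, ih]
    change ∑' κ, _ = _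
    rw [tsum_shrinkKernel, scale_up, scale_schur, schur]
    simp [pow_succ']

/-- By adjointness each shrinking step acts on the Schur function as a rescaling by Q followed by
strip removal; the eigenfunction property turns it into a scalar product and raises all exponents by
one. -/
lemma tsum_schur_mul_transfer_shrink (Q : ℝ≥0∞) (M s t : ℕ) (g : Par → ℝ≥0∞) :
    ∑' l, schur (fun i => Q ^ (s + i)) M l * transfer (fun _ => shrinkKernel Q) t g l =
      (∏ r ∈ Finset.range t, ∏ i ∈ Finset.range M, (1 - Q ^ (s + r + 1 + i))⁻¹) *
        ∑' l, schur (fun i => Q ^ (s + t + i)) M l * g l := by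
  induction t generalizing s with
  | zero => simp [transfer]
  | succ t ih =>
    simp only [transfer, tsum_shrinkKernel]
    rw [tsum_mul_scale_up, scale_schur, down_schur]
    have e : ∀ i, Q * Q ^ (s + i) = Q ^ (s + 1 + i) := fun i => by
      rw [← pow_succ']; congr 1; omega
    simp only [e, mul_one, mul_assoc]
    rw [ENNReal.tsum_mul_left, ih, Finset.prod_range_succ']
    simp only [← mul_assoc]
    rw [mul_comm (∏ i ∈ Finset.range M, (1 - Q ^ (s + 1 + i))⁻¹)]
    simp only [add_zero, add_left_comm, add_comm]

/-- Each growing step rescales the variables by Q and then adjoins the variable 1, so the geometric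
specialization gets one variable longer. -/
lemma tsum_schur_mul_transfer_grow (Q : ℝ≥0∞) (k m : ℕ) (g : Par → ℝ≥0∞) :
    ∑' l, schur (fun i => Q ^ i) k l * transfer (fun _ => growKernel Q) m g l =
      ∑' l, schur (fun i => Q ^ i) (k + m) l * g l := by
  induction m generalizing k with
  | zero => simp [transfer]
  | succ m ih =>
    simp only [transfer, tsum_growKernel]
    rw [tsum_mul_scale_down, scale_schur]
    have e : up 1 (schur (fun i => Q * Q ^ i) k) = schur (fun i => Q ^ i) (k + 1) := by
      rw [schur]; simp [pow_succ']
    rw [e, ih, Nat.add_right_comm, add_assoc]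

lemma transfer_congr {K K' : ℕ → Par → Par → ℝ≥0∞} {N : ℕ} (h : ∀ k < N, K k = K' k)
    (g : Par → ℝ≥0∞) : transfer K N g = transfer K' N g := by
  induction N generalizing K K' with
  | zero => rfl
  | succ N ih =>
    funext l
    rw [transfer, transfer, h 0 (Nat.succ_pos _),
      ih (K := fun k => K (k + 1)) (K' := fun k => K' (k + 1)) fun k hk => h (k + 1) (by omega)]

/-- The kernels between consecutive diagonals of a box. -/
def boxKernel (Q : ℝ≥0∞) (F : Par → ℝ≥0∞) (M t k : ℕ) (l κ : Par) : ℝ≥0∞ :=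
  (if k = M + t then F l else 1) * if k < M then growKernel Q l κ else shrinkKernel Q l κ

/-- The path has M growing steps to the main diagonal, t shrinking steps to the diagonal through
(0,t), where F is inserted, and M shrinking steps back to the empty partition. The three stretches
give the left Schur function, the scalar product and the right Schur function. -/
lemma transfer_boxKernel (Q : ℝ≥0∞) (F : Par → ℝ≥0∞) {M : ℕ} (hM : 0 < M) (t : ℕ) :
    transfer (boxKernel Q F M t) (M + t + M) delta empty =
      (∏ r ∈ Finset.range t, ∏ i ∈ Finset.range M, (1 - Q ^ (r + 1 + i))⁻¹) *
        ∑' l, schur (fun i => Q ^ (t + i)) M l * (F l * schur (fun i => Q ^ (i + 1)) M l) := by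
  have h1 : transfer (fun k => boxKernel Q F M t (M + t + k)) M delta =
      fun l => F l * schur (fun i => Q ^ (i + 1)) M l := by
    -- F sits at the source of step M + t, so that step must exist; this is where M > 0 is used.
    obtain ⟨m, rfl⟩ : ∃ m, M = m + 1 := ⟨M - 1, by omega⟩
    funext l
    rw [← transfer_shrinkKernel, transfer, transfer, ← ENNReal.tsum_mul_left]
    refine tsum_congr fun κ => ?_
    rw [transfer_congr (K' := fun _ => shrinkKernel Q)]
    · rw [boxKernel, if_pos (add_zero _), if_neg (by omega), mul_assoc]
    · intro k _
      funext l κ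
      rw [boxKernel, if_neg (by omega), if_neg (by omega), one_mul]
  have h2 : ∀ g, transfer (fun k => boxKernel Q F M t (M + k)) t g =
      transfer (fun _ => shrinkKernel Q) t g := fun g => transfer_congr (fun k hk => by
    funext l κ
    rw [boxKernel, if_neg (by omega), if_neg (by omega), one_mul]) g
  have h3 : ∀ g, transfer (boxKernel Q F M t) M g =
      transfer (fun _ => growKernel Q) M g := fun g => transfer_congr (fun k hk => by
    funext l κ
    rw [boxKernel, if_neg (by omega), if_pos hk, one_mul]) g
  have h4 : ∀ g : Par → ℝ≥0∞, g empty = ∑' l, schur (fun i => Q ^ i) 0 l * g l := by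
    intro g
    rw [tsum_eq_single empty]
    · simp [schur, delta]
    · intro l hl
      simp [schur, delta, hl]
  rw [transfer_add, transfer_add, h1, h2, h3,
    h4 (transfer (fun _ => growKernel Q) M _), tsum_schur_mul_transfer_grow, zero_add]
  have := tsum_schur_mul_transfer_shrink Q M 0 t fun l => F l * schur (fun i => Q ^ (i + 1)) M l
  simpa only [zero_add] using this

end Par

end

/-! ### Cutting a height function into interlacing diagonals. -/

noncomputable section

open scoped ENNReal

namespace CrystalHeight

attribute [ext] CrystalHeight

lemma exists_bound (h : CrystalHeight) :
    ∃ B, ∀ i j, h.height i j ≠ 0 → i < B ∧ j < B := by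
  have h1 : {p : ℕ × ℕ | h.height p.1 p.2 ≠ 0}.Finite := by
    have := h.tendsto_height
    rw [nhds_discrete, tendsto_pure, Filter.eventually_cofinite] at this
    exact this
  obtain ⟨B, hB⟩ := (h1.image fun p => max p.1 p.2).bddAbove
  refine ⟨B + 1, fun i j hij => ?_⟩
  have : max i j ≤ B := hB ⟨(i, j), hij, rfl⟩
  omega

/-- A diagonal of the height function. -/
def diag (h : CrystalHeight) (u v : ℕ) : Par where
  parts m := h.height (m + u) (m + v)
  anti m := by
    rw [Nat.add_right_comm, Nat.add_right_comm m 1 v]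
    exact (h.height_succ_left _ _).trans (h.height_succ_right _ _)
  eventually_zero := by
    obtain ⟨B, hB⟩ := h.exists_bound
    refine ⟨B, fun i hi => ?_⟩
    by_contra h0
    have := (hB _ _ h0).1
    omega

/-- The height function vanishes outside `M` rows and `N` columns. -/
def InBox (M N : ℕ) (h : CrystalHeight) : Prop := ∀ i j, h.height i j ≠ 0 → i < M ∧ j < N

/-- The `k`-th diagonal of a box with `M` rows. -/
def boxDiag (M : ℕ) (h : CrystalHeight) (k : ℕ) : Par := h.diag (M - k) (k - M)

lemma boxDiag_eq_empty_of_zero {M N : ℕ} {h : CrystalHeight} (hb : h.InBox M N) :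
    h.boxDiag M 0 = Par.empty := by
  ext m
  by_contra h0
  have := (hb _ _ h0).1
  omega

lemma boxDiag_eq_empty_of_le {M N k : ℕ} {h : CrystalHeight} (hb : h.InBox M N)
    (hk : M + N ≤ k) : h.boxDiag M k = Par.empty := by
  ext m
  by_contra h0
  have := (hb _ _ h0).2
  omega

lemma boxDiag_interlace_left {M k : ℕ} (h : CrystalHeight) (hk : k < M) :
    Par.Interlace (h.boxDiag M (k + 1)) (h.boxDiag M k) := by
  intro m
  simp only [boxDiag, diag]
  have e1 : m + (M - k) = m + (M - (k + 1)) + 1 := by omega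
  have e2 : m + (k + 1 - M) = m + (k - M) := by omega
  have e3 : m + 1 + (k + 1 - M) = m + (k - M) + 1 := by omega
  have e4 : m + 1 + (M - (k + 1)) = m + (M - (k + 1)) + 1 := by omega
  rw [e1, e2, e3, e4]
  exact ⟨h.height_succ_left _ _, h.height_succ_right _ _⟩

lemma boxDiag_interlace_right {M k : ℕ} (h : CrystalHeight) (hk : M ≤ k) :
    Par.Interlace (h.boxDiag M k) (h.boxDiag M (k + 1)) := by
  intro m
  simp only [boxDiag, diag]
  have e1 : m + (M - k) = m := by omega
  have e2 : m + (k + 1 - M) = m + (k - M) + 1 := by omega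
  have e3 : m + 1 + (k - M) = m + (k - M) + 1 := by omega
  have e4 : m + (M - (k + 1)) = m := by omega
  have e5 : m + 1 + (M - k) = m + 1 := by omega
  rw [e1, e2, e3, e4, e5]
  exact ⟨h.height_succ_right _ _, h.height_succ_left _ _⟩

lemma height_eq_boxDiag {M i j : ℕ} (h : CrystalHeight) (hi : i ≤ M + j) :
    h.height i j = h.boxDiag M (M + j - i) (min i j) := by
  simp only [boxDiag, diag]
  congr 1 <;> omega

lemma vol_eq_sum_boxDiag {M N : ℕ} {h : CrystalHeight} (hb : h.InBox M N) :
    h.vol = ∑ k ∈ Finset.range (M + N), (h.boxDiag M k).size := by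
  have h1 : h.vol = ∑ p ∈ Finset.range M ×ˢ Finset.range N, h.height p.1 p.2 := by
    refine finsum_eq_sum_of_support_subset _ fun p hp => ?_
    simpa using hb p.1 p.2 hp
  have h2 : ∀ k, (h.boxDiag M k).size = ∑ m ∈ Finset.range M, h.boxDiag M k m := fun k =>
    Par.size_eq_sum _ fun m hm => by
      by_contra h0
      have := (hb _ _ h0).1
      omega
  rw [h1, Finset.sum_congr rfl fun k _ => h2 k, ← Finset.sum_product']
  symm
  refine Finset.sum_bij_ne_zero (fun x _ _ => (x.2 + (M - x.1), x.2 + (x.1 - M))) ?_ ?_ ?_ ?_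
  · intro x _ hx
    have := hb _ _ hx
    simpa using this
  · rintro ⟨k, m⟩ h1 _ ⟨k', m'⟩ h2 _ h3
    simp only [Prod.mk.injEq] at h3 ⊢
    omega
  · rintro ⟨i, j⟩ hp hij
    simp only [Finset.mem_product, Finset.mem_range] at hp
    refine ⟨(M + j - i, min i j), ?_, ?_, ?_⟩
    · simp only [Finset.mem_product, Finset.mem_range]
      omega
    · rwa [← h.height_eq_boxDiag (by omega)]
    · simp only [Prod.mk.injEq]
      omega
  · intro x _ _
    rfl

/-- A height function from its diagonals. -/
def ofDiag (M N : ℕ) (s : ℕ → Par) (h0 : s 0 = Par.empty) (hN : ∀ k, M + N ≤ k → s k = Par.empty)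
    (h1 : ∀ k < M, Par.Interlace (s (k + 1)) (s k))
    (h2 : ∀ k, M ≤ k → Par.Interlace (s k) (s (k + 1))) :
    {h : CrystalHeight // h.InBox M N ∧ ∀ k, h.boxDiag M k = s k} := by
  -- Interlacing away from the empty ends bounds the number of parts: k before the main diagonal, M
  -- + N - k after it. Together with comparison to the main diagonal this confines the support to
  -- the box.
  have a1 : ∀ k ≤ M, ∀ m, k ≤ m → s k m = 0 := by
    intro k
    induction k with
    | zero => intro _ m _; rw [h0]; rfl
    | succ k ih =>
      intro hk m hm
      obtain ⟨m, rfl⟩ : ∃ m', m = m' + 1 := ⟨m - 1, by omega⟩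
      have := (h1 k (by omega) m).2
      rw [ih (by omega) m (by omega)] at this
      omega
  have a2 : ∀ r k, M ≤ k → k + r = M + N → ∀ m, r ≤ m → s k m = 0 := by
    intro r
    induction r with
    | zero => intro k hk hr m _; rw [hN k (by omega)]; rfl
    | succ r ih =>
      intro k hk hr m hm
      obtain ⟨m, rfl⟩ : ∃ m', m = m' + 1 := ⟨m - 1, by omega⟩
      have := (h2 k hk m).2
      rw [ih (k + 1) (by omega) (by omega) m (by omega)] at this
      omega
  have a3 : ∀ r ≤ M, ∀ m, s (M - r) m ≤ s M m := by
    intro r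
    induction r with
    | zero => intro _ m; exact le_rfl
    | succ r ih =>
      intro hr m
      have := (h1 (M - (r + 1)) (by omega) m).1
      rw [show M - (r + 1) + 1 = M - r by omega] at this
      exact this.trans (ih (by omega) m)
  have a4 : ∀ r m, s (M + r) m ≤ s M m := by
    intro r
    induction r with
    | zero => intro m; exact le_rfl
    | succ r ih => intro m; exact ((h2 (M + r) (by omega) m).1).trans (ih m)
  have hz : ∀ k m, s k m ≠ 0 → m + (M - k) < M ∧ m + (k - M) < N := by
    intro k m hs
    rcases le_total k M with hk | hk
    · have b1 : m < k := by
        by_contra hc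
        exact hs (a1 k hk m (by omega))
      have b2 : m < N := by
        by_contra hc
        have := a3 (M - k) (by omega) m
        rw [show M - (M - k) = k by omega, a2 N M le_rfl rfl m (by omega)] at this
        omega
      omega
    · have b1 : m < M := by
        by_contra hc
        have := a4 (k - M) m
        rw [show M + (k - M) = k by omega, a1 M le_rfl m (by omega)] at this
        omega
      have b2 : k < M + N := by
        by_contra hc
        exact hs (by rw [hN k (by omega)]; rfl)
      have b3 : m < M + N - k := by
        by_contra hc
        exact hs (a2 (M + N - k) k hk (by omega) m (by omega))
      omega
  set f : ℕ → ℕ → ℕ := fun i j => if i ≤ M + j then s (M + j - i) (min i j) else 0 with hf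
  have hbox : ∀ i j, f i j ≠ 0 → i < M ∧ j < N := by
    intro i j hij
    by_cases hi : i ≤ M + j
    · simp only [hf, if_pos hi] at hij
      have := hz _ _ hij
      omega
    · simp [hf, hi] at hij
  refine ⟨⟨f, fun i j => ?_, fun i j => ?_, ?_⟩, hbox, fun k => ?_⟩
  · by_cases hi : i + 1 ≤ M + j
    · simp only [hf, if_pos hi, if_pos (show i ≤ M + j by omega)]
      obtain ⟨k, hk⟩ : ∃ k, M + j - (i + 1) = k := ⟨_, rfl⟩
      rw [hk, show M + j - i = k + 1 by omega]
      rcases lt_or_ge i j with hij | hij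
      · rw [min_eq_left hij.le, min_eq_left (by omega : i + 1 ≤ j)]
        exact (h2 k (by omega) i).2
      · rw [min_eq_right hij, min_eq_right (by omega : j ≤ i + 1)]
        exact (h1 k (by omega) j).1
    · simp [hf, hi]
  · by_cases hi : i ≤ M + j
    · simp only [hf, if_pos hi, if_pos (show i ≤ M + (j + 1) by omega)]
      obtain ⟨k, hk⟩ : ∃ k, M + j - i = k := ⟨_, rfl⟩
      rw [hk, show M + (j + 1) - i = k + 1 by omega]
      rcases lt_or_ge j i with hij | hij
      · rw [min_eq_right hij.le, min_eq_right (by omega : j + 1 ≤ i)]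
        exact (h1 k (by omega) j).2
      · rw [min_eq_left hij, min_eq_left (by omega : i ≤ j + 1)]
        exact (h2 k (by omega) i).1
    · by_cases hi' : i ≤ M + (j + 1)
      · have e : f i (j + 1) = 0 := by
          by_contra hc
          have := hbox _ _ hc
          omega
        rw [e]
        exact Nat.zero_le _
      · simp [hf, hi']
  · rw [nhds_discrete, tendsto_pure, Filter.eventually_cofinite]
    refine ((Finset.range M ×ˢ Finset.range N).finite_toSet).subset fun p hp => ?_
    simpa using hbox p.1 p.2 hp
  · ext m
    change f (m + (M - k)) (m + (k - M)) = _
    simp only [hf]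
    rw [if_pos (by omega)]
    congr 1 <;> [congr 1; skip] <;> omega

lemma eq_of_boxDiag_eq {M N : ℕ} {h h' : CrystalHeight} (hb : h.InBox M N) (hb' : h'.InBox M N)
    (he : ∀ k, h.boxDiag M k = h'.boxDiag M k) : h = h' := by
  ext i j
  by_cases hi : i ≤ M + j
  · rw [h.height_eq_boxDiag hi, h'.height_eq_boxDiag hi, he]
  · have e : ∀ {h : CrystalHeight}, h.InBox M N → h.height i j = 0 := fun {h} hb => by
      by_contra h0
      have := hb _ _ h0
      omega
    rw [e hb, e hb']

end CrystalHeight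

end

/-! ### From box sums to the Schur measure. -/

noncomputable section

open scoped ENNReal

namespace CrystalHeight

open Par in
/-- The generating function of the height functions in a box, as a sum over diagonals. -/
lemma tsum_inBox_eq_transfer (Q : ℝ≥0∞) (F : Par → ℝ≥0∞) {M : ℕ} (hM : 0 < M) (t : ℕ)
    [DecidablePred (InBox M (M + t))] :
    ∑' h : CrystalHeight, (if InBox M (M + t) h then Q ^ h.vol * F (h.diag 0 t) else 0) =
      transfer (boxKernel Q F M t) (M + t + M) delta Par.empty := by
  rw [transfer_eq_tsum]
  symm
  set L := M + t + M with hL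
  set G : (Fin L → Par) → ℝ≥0∞ := fun σ =>
    (∏ k : Fin L, boxKernel Q F M t k ((Fin.cons Par.empty σ : Fin (L + 1) → Par) k.castSucc)
      ((Fin.cons Par.empty σ : Fin (L + 1) → Par) k.succ)) *
      delta ((Fin.cons Par.empty σ : Fin (L + 1) → Par) (Fin.last L)) with hG
  set H : CrystalHeight → ℝ≥0∞ := fun h =>
    if InBox M (M + t) h then Q ^ h.vol * F (h.diag 0 t) else 0 with hH
  set S : CrystalHeight → Fin L → Par := fun h k => h.boxDiag M (k + 1) with hS
  have hcons : ∀ h, InBox M (M + t) h → ∀ k : Fin (L + 1),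
      (Fin.cons Par.empty (S h) : Fin (L + 1) → Par) k = h.boxDiag M k := by
    intro h hb k
    refine Fin.cases ?_ (fun k => ?_) k
    · exact (boxDiag_eq_empty_of_zero hb).symm
    · rfl
  have hval : ∀ h, InBox M (M + t) h → G (S h) = H h := by
    intro h hb
    have e1 : delta (h.boxDiag M (Fin.last L : Fin (L + 1))) = 1 := by
      rw [boxDiag_eq_empty_of_le hb (by simp only [Fin.val_last]; omega)]
      simp [delta]
    have e2 : ∀ k : ℕ, boxKernel Q F M t k (h.boxDiag M k) (h.boxDiag M (k + 1)) =
        (if k = M + t then F (h.boxDiag M k) else 1) * Q ^ (h.boxDiag M k).size := by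
      intro k
      rw [boxKernel]
      congr 1
      split_ifs with hk
      · rw [growKernel, if_pos (h.boxDiag_interlace_left hk)]
      · rw [shrinkKernel, if_pos (h.boxDiag_interlace_right (not_lt.1 hk))]
    have e3 : h.boxDiag M (M + t) = h.diag 0 t := by
      rw [boxDiag, show M - (M + t) = 0 by omega, show M + t - M = t by omega]
    simp only [hG, hH, hcons h hb, Fin.val_castSucc, Fin.val_succ, e1, mul_one, e2, if_pos hb]
    rw [Fin.prod_univ_eq_prod_range (fun k => (if k = M + t then F (h.boxDiag M k) else 1) *
      Q ^ (h.boxDiag M k).size) L, Finset.prod_mul_distrib, Finset.prod_pow_eq_pow_sum,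
      Finset.prod_ite_eq' , if_pos (by simp; omega), e3, vol_eq_sum_boxDiag hb, mul_comm,
      show M + (M + t) = L by omega]
  have hsupp : ∀ h, H h ≠ 0 → InBox M (M + t) h := fun h h0 => by
    by_contra hc
    exact h0 (if_neg hc)
  refine tsum_eq_tsum_of_ne_zero_bij (fun h : Function.support H => S h.1) ?_ ?_ ?_
  · intro h h' he
    have hb := hsupp _ h.2
    have hb' := hsupp _ h'.2
    refine Subtype.ext (eq_of_boxDiag_eq hb hb' fun k => ?_)
    rcases lt_or_ge k (L + 1) with hk | hk
    · rw [← hcons _ hb ⟨k, hk⟩, ← hcons _ hb' ⟨k, hk⟩]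
      exact congrArg (fun σ => (Fin.cons Par.empty σ : Fin (L + 1) → Par) ⟨k, hk⟩) he
    · rw [boxDiag_eq_empty_of_le hb (by omega), boxDiag_eq_empty_of_le hb' (by omega)]
  -- Nonzero weight forces every kernel to be nonzero and the path to end at the empty partition, so
  -- the path interlaces and comes from a height function.
  · intro σ hσ
    set σ' : Fin (L + 1) → Par := Fin.cons Par.empty σ with hσ'
    set s : ℕ → Par := fun k => if hk : k < L + 1 then σ' ⟨k, hk⟩ else Par.empty with hs
    have hG0 : G σ ≠ 0 := hσ
    have hl : σ' (Fin.last L) = Par.empty := by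
      by_contra hc
      refine hG0 ?_
      simp only [hG]
      rw [delta, if_neg hc, mul_zero]
    have hk0 : ∀ k : Fin L, boxKernel Q F M t k (σ' k.castSucc) (σ' k.succ) ≠ 0 := by
      intro k hc
      refine hG0 ?_
      simp only [hG]
      rw [Finset.prod_eq_zero (Finset.mem_univ k) hc, zero_mul]
    have hs0 : s 0 = Par.empty := by
      simp only [hs, dif_pos (Nat.succ_pos L)]
      rfl
    have hsN : ∀ k, M + (M + t) ≤ k → s k = Par.empty := by
      intro k hk
      rcases Nat.lt_or_ge k (L + 1) with h' | h'
      · simp only [hs, dif_pos h']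
        rw [← hl]
        congr 1
        ext
        simp only [Fin.val_last]
        omega
      · simp only [hs, dif_neg (not_lt.2 h')]
    have hsk : ∀ k (hk : k < L), s k = σ' (⟨k, hk⟩ : Fin L).castSucc ∧
        s (k + 1) = σ' (⟨k, hk⟩ : Fin L).succ := by
      intro k hk
      constructor
      · simp only [hs, dif_pos (show k < L + 1 by omega)]
        rfl
      · simp only [hs, dif_pos (show k + 1 < L + 1 by omega)]
        rfl
    have hr1 : ∀ k < M, Par.Interlace (s (k + 1)) (s k) := by
      intro k hk
      have hkL : k < L := by omega
      have := hk0 ⟨k, hkL⟩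
      rw [← (hsk k hkL).1, ← (hsk k hkL).2, boxKernel, if_pos hk, growKernel] at this
      by_contra hc
      rw [if_neg hc, mul_zero] at this
      exact this rfl
    have hr2 : ∀ k, M ≤ k → Par.Interlace (s k) (s (k + 1)) := by
      intro k hk
      rcases Nat.lt_or_ge k L with hkL | hkL
      · have := hk0 ⟨k, hkL⟩
        rw [← (hsk k hkL).1, ← (hsk k hkL).2, boxKernel, if_neg (not_lt.2 hk), shrinkKernel] at this
        by_contra hc
        rw [if_neg hc, mul_zero] at this
        exact this rfl
      · rw [hsN k (by omega), hsN (k + 1) (by omega)]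
        exact interlace_empty_left.2 rfl
    obtain ⟨h, hb, hd⟩ := ofDiag M (M + t) s hs0 hsN hr1 hr2
    have hSσ : S h = σ := by
      funext k
      simp only [hS, hd, (hsk k k.2).2]
      exact Fin.cons_succ _ _ _
    refine ⟨⟨h, ?_⟩, hSσ⟩
    change H h ≠ 0
    rw [← hval h hb, hSσ]
    exact hG0
  · intro h
    exact hval _ (hsupp _ h.2)

open Par in
/-- The law of a diagonal of a height function in a box. -/
lemma tsum_inBox_eq {q α : ℝ} (hq : 0 ≤ q) (hα : 0 ≤ α) (F : Par → ℝ≥0∞) {M : ℕ} (hM : 0 < M)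
    {t : ℕ} (hqα : α ^ 2 = q ^ (t + 1)) [DecidablePred (InBox M (M + t))] :
    ∑' h : CrystalHeight,
      (if InBox M (M + t) h then ENNReal.ofReal (q ^ h.vol) * F (h.diag 0 t) else 0) =
      (∏ r ∈ Finset.range t, ∏ i ∈ Finset.range M, (1 - ENNReal.ofReal q ^ (r + 1 + i))⁻¹) *
        ∑' l, F l * schur (fun i => ENNReal.ofReal (α * q ^ i)) M l ^ 2 := by
  simp only [ENNReal.ofReal_pow hq]
  rw [tsum_inBox_eq_transfer _ F hM t, transfer_boxKernel _ F hM t]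
  congr 1
  refine tsum_congr fun l => ?_
  set Q := ENNReal.ofReal q
  set A := ENNReal.ofReal α
  have e : ∀ i, ENNReal.ofReal (α * q ^ i) = A * Q ^ i := fun i => by
    rw [ENNReal.ofReal_mul hα, ENNReal.ofReal_pow hq]
  have e1 : ∀ i, Q ^ (t + i) = Q ^ t * Q ^ i := fun i => pow_add _ _ _
  have e2 : ∀ i, Q ^ (i + 1) = Q * Q ^ i := fun i => pow_succ' _ _
  -- Both Schur functions are homogeneous of degree |l|, so only the product of the scales Q^t and Q
  -- matters; each may be replaced by A, which makes the measure a square.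
  have hA : A ^ 2 = Q ^ t * Q := by
    rw [← ENNReal.ofReal_pow hα, hqα, ENNReal.ofReal_pow hq, pow_succ]
  simp only [e, e1, e2]
  rw [← scale_schur, ← scale_schur, ← scale_schur]
  unfold scale
  have : A ^ l.size * A ^ l.size = (Q ^ t) ^ l.size * Q ^ l.size := by
    rw [← mul_pow, ← mul_pow, ← sq, hA]
  calc _ = F l * schur (fun i => Q ^ i) M l ^ 2 * ((Q ^ t) ^ l.size * Q ^ l.size) := by ring
    _ = _ := by rw [← this]; ring

end CrystalHeight

end

/-! ### The law of the border step: normalization and tails from determinants. -/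

noncomputable section

open scoped ENNReal

namespace CrystalHeight

instance : DiscreteMeasurableSpace CrystalHeight := ⟨fun _ => trivial⟩

open Classical in
lemma weightMeasure_apply (T : ℝ) (E : Set CrystalHeight) :
    weightMeasure T E = ∑' h, if h ∈ E then ENNReal.ofReal ((1 - 1 / T) ^ h.vol) else 0 := by
  rw [weightMeasure, withDensity_apply _ (MeasurableSet.of_discrete),
    ← lintegral_indicator MeasurableSet.of_discrete, lintegral_count]
  rfl

lemma InBox.mono {M N M' N' : ℕ} (hM : M ≤ M') (hN : N ≤ N') {h : CrystalHeight}
    (hb : h.InBox M N) : h.InBox M' N' := fun i j hij => by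
  have := hb i j hij
  omega

lemma exists_inBox (h : CrystalHeight) (t : ℕ) : ∃ M₀, ∀ M, M₀ ≤ M → h.InBox M (M + t) := by
  obtain ⟨B, hB⟩ := h.exists_bound
  exact ⟨B, fun M hM => InBox.mono (M := B) (N := B) hM (by omega) hB⟩

/-- The constant relating box sums to Toeplitz determinants. -/
def boxConst (q : ℝ) (M t : ℕ) : ℝ≥0∞ :=
  ∏ r ∈ Finset.range t, ∏ i ∈ Finset.range M, (1 - ENNReal.ofReal q ^ (r + 1 + i))⁻¹

lemma boxConst_ne_top {q : ℝ} (hq1 : q < 1) (M t : ℕ) : boxConst q M t ≠ ∞ := by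
  refine ENNReal.prod_ne_top fun r _ => ENNReal.prod_ne_top fun i _ => ENNReal.inv_ne_top.2 ?_
  refine (tsub_pos_of_lt ?_).ne'
  exact pow_lt_one₀ zero_le (ENNReal.ofReal_lt_one.2 hq1) (by omega)

/-- The specialization `α q ^ i` with `α ^ 2 = q ^ (t + 1)`. -/
def spec (q : ℝ) (t i : ℕ) : ℝ := √q ^ (t + 1) * q ^ i

lemma spec_nonneg {q : ℝ} (hq : 0 ≤ q) (t i : ℕ) : 0 ≤ spec q t i := by
  unfold spec; positivity

lemma weightMeasure_inBox_le {T : ℝ} (hq : 0 ≤ 1 - 1 / T) {M : ℕ} (hM : 0 < M) (t n : ℕ) :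
    weightMeasure T {h | h.InBox M (M + t) ∧ h.borderStep t ≤ n} =
      boxConst (1 - 1 / T) M t *
        ENNReal.ofReal (toeplitz (spec (1 - 1 / T) t) M n).det := by
  classical
  set q := 1 - 1 / T with hqdef
  have hα : (√q ^ (t + 1)) ^ 2 = q ^ (t + 1) := by rw [← pow_mul, mul_comm, pow_mul, Real.sq_sqrt hq]
  have h := tsum_inBox_eq hq (pow_nonneg (Real.sqrt_nonneg q) (t + 1))
    (fun l => if l 0 ≤ n then 1 else 0) hM hα
  rw [weightMeasure_apply, ← Par.tsum_schur_sq_eq_det (spec_nonneg hq t) M n, boxConst]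
  convert h using 2
  · funext h
    have e : (h.diag 0 t) 0 = h.borderStep t := by simp [diag, borderStep]
    simp only [e, Set.mem_ofPred_eq]
    by_cases h1 : h.InBox M (M + t) <;> by_cases h2 : h.borderStep t ≤ n <;> simp [h1, h2, hqdef]
  · refine tsum_congr fun l => ?_
    split_ifs
    · rw [one_mul]; rfl
    · rw [zero_mul]

/-- The case t = 0 without cutoff, where the Cauchy identity gives a finite MacMahon product; it
serves to show that the partition function is finite. -/
lemma weightMeasure_inBox {T : ℝ} (hq : 0 ≤ 1 - 1 / T) {M : ℕ} (hM : 0 < M) :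
    weightMeasure T {h | h.InBox M M} =
      ∏ j ∈ Finset.range M, ∏ i ∈ Finset.range M,
        (1 - ENNReal.ofReal ((1 - 1 / T) ^ (i + j + 1)))⁻¹ := by
  classical
  set q := 1 - 1 / T with hqdef
  have h := tsum_inBox_eq (t := 0) hq (Real.sqrt_nonneg q) (fun _ => 1) hM
    (by rw [Real.sq_sqrt hq]; simp)
  rw [weightMeasure_apply]
  simp only [Finset.range_zero, Finset.prod_empty, one_mul, mul_one, sq,
    Par.tsum_schur_mul_schur] at h
  refine h.trans (Finset.prod_congr rfl fun j _ => Finset.prod_congr rfl fun i _ => ?_)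
  rw [← ENNReal.ofReal_mul (by positivity)]
  congr 3
  rw [mul_mul_mul_comm, Real.mul_self_sqrt hq]
  ring

lemma partitionFunction_ne_top {T : ℝ} (hT : 1 < T) : partitionFunction T ≠ ∞ := by
  set q := 1 - 1 / T with hqdef
  have hT0 : 0 < T := by linarith
  have hq0 : 0 ≤ q := by
    rw [hqdef, sub_nonneg, div_le_one hT0]; exact hT.le
  have hq1 : q < 1 := by
    rw [hqdef]; have : 0 < 1 / T := by positivity
    linarith
  have hmono : Monotone fun M => {h : CrystalHeight | h.InBox M M} :=
    fun M M' hM h hh => InBox.mono hM hM hh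
  have huniv : ⋃ M, {h : CrystalHeight | h.InBox M M} = Set.univ := by
    refine Set.eq_univ_of_forall fun h => Set.mem_iUnion.2 ?_
    obtain ⟨B, hB⟩ := h.exists_inBox 0
    exact ⟨B, hB B le_rfl⟩
  have hlim := tendsto_measure_iUnion_atTop (μ := weightMeasure T) hmono
  rw [huniv] at hlim
  have hgeo : ∀ M, ∑ i ∈ Finset.range M, q ^ i ≤ (1 - q)⁻¹ := fun M => by
    rw [← tsum_geometric_of_lt_one hq0 hq1]
    exact (summable_geometric_of_lt_one hq0 hq1).sum_le_tsum _ fun i _ => by positivity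
  have hbound : ∀ M, 0 < M → weightMeasure T {h | h.InBox M M} ≤
      ENNReal.ofReal (Real.exp ((1 - q)⁻¹ * ((1 - q)⁻¹ * (1 - q)⁻¹))) := by
    intro M hM
    have h1 : ∀ k : ℕ, 1 - q ≤ 1 - q ^ (k + 1) := fun k => by
      have : q ^ (k + 1) ≤ q := by
        rw [pow_succ]
        exact mul_le_of_le_one_left hq0 (pow_le_one₀ hq0 hq1.le)
      linarith
    -- From 1/(1-x) = 1 + x/(1-x) ≤ exp(x/(1-x)) with x = q^(k+1); the double product becomes the
    -- exponential of a product of two geometric sums.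
    have h2 : ∀ k : ℕ, (1 - ENNReal.ofReal (q ^ (k + 1)))⁻¹ ≤
        ENNReal.ofReal (Real.exp ((1 - q)⁻¹ * q ^ k)) := by
      intro k
      have h3 : 0 < 1 - q ^ (k + 1) := lt_of_lt_of_le (by linarith) (h1 k)
      rw [← ENNReal.ofReal_one, ← ENNReal.ofReal_sub _ (by positivity),
        ← ENNReal.ofReal_inv_of_pos h3]
      refine ENNReal.ofReal_le_ofReal ?_
      have h4 : (1 - q ^ (k + 1))⁻¹ = (1 - q ^ (k + 1))⁻¹ * q ^ (k + 1) + 1 := by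
        field_simp
        ring
      have h5 : (1 - q ^ (k + 1))⁻¹ * q ^ (k + 1) ≤ (1 - q)⁻¹ * q ^ k := by
        refine mul_le_mul (inv_anti₀ (by linarith) (h1 k)) ?_ (by positivity)
          (inv_nonneg.2 (by linarith))
        rw [pow_succ]
        exact mul_le_of_le_one_right (by positivity) hq1.le
      rw [h4]
      exact (add_le_add_left h5 1).trans (Real.add_one_le_exp _)
    rw [weightMeasure_inBox hq0 hM]
    calc _ ≤ ∏ j ∈ Finset.range M, ∏ i ∈ Finset.range M,
          ENNReal.ofReal (Real.exp ((1 - q)⁻¹ * q ^ (i + j))) :=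
          Finset.prod_le_prod' fun j _ => Finset.prod_le_prod' fun i _ => h2 (i + j)
      _ = ENNReal.ofReal (Real.exp ((1 - q)⁻¹ *
          ((∑ j ∈ Finset.range M, q ^ j) * ∑ i ∈ Finset.range M, q ^ i))) := by
          simp_rw [← ENNReal.ofReal_prod_of_nonneg fun i _ => (Real.exp_pos _).le]
          rw [← ENNReal.ofReal_prod_of_nonneg fun i _ => by positivity]
          simp_rw [← Real.exp_sum]
          rw [Finset.sum_mul_sum, Finset.mul_sum]
          simp_rw [Finset.mul_sum]
          congr 2
          refine Finset.sum_congr rfl fun j _ => Finset.sum_congr rfl fun i _ => ?_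
          rw [pow_add, mul_comm (q ^ i)]
      _ ≤ _ := by
          have := hgeo M
          have h6 : 0 ≤ ∑ i ∈ Finset.range M, q ^ i := Finset.sum_nonneg fun i _ => by positivity
          have h7 : 0 ≤ (1 - q)⁻¹ := inv_nonneg.2 (by linarith)
          gcongr
  have h8 : partitionFunction T ≤
      ENNReal.ofReal (Real.exp ((1 - q)⁻¹ * ((1 - q)⁻¹ * (1 - q)⁻¹))) := le_of_tendsto hlim <| by
    filter_upwards [eventually_gt_atTop 0] with M hM using hbound M hM
  exact ne_top_of_le_ne_top ENNReal.ofReal_ne_top h8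

lemma partitionFunction_ne_zero {T : ℝ} (hT : 1 < T) : partitionFunction T ≠ 0 := by
  have hT0 : 0 < T := by linarith
  have hq : 0 < 1 - 1 / T := by
    rw [sub_pos, div_lt_one hT0]; exact hT
  rw [partitionFunction, weightMeasure_apply]
  refine fun h0 => ?_
  have := ENNReal.tsum_eq_zero.1 h0
    ⟨fun _ _ => 0, fun _ _ => le_rfl, fun _ _ => le_rfl, tendsto_const_nhds⟩
  rw [if_pos (Set.mem_univ _), ENNReal.ofReal_eq_zero] at this
  exact absurd this (not_le.2 (by positivity))

lemma isProbabilityMeasure_law {T : ℝ} (hT : 1 < T) : IsProbabilityMeasure (law T) :=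
  ⟨ENNReal.inv_mul_cancel (partitionFunction_ne_zero hT) (partitionFunction_ne_top hT)⟩

lemma law_le_of_weightMeasure_le {T : ℝ} {E : Set CrystalHeight} {b : ℝ≥0∞}
    (h : weightMeasure T E ≤ b * partitionFunction T) : law T E ≤ b := by
  change (partitionFunction T)⁻¹ * weightMeasure T E ≤ b
  rw [mul_comm, ← div_eq_mul_inv]
  exact ENNReal.div_le_of_le_mul h

/-- Lower tail of the border step from ratios of Toeplitz determinants. -/
lemma law_borderStep_le {T : ℝ} (hT : 1 < T) (t n : ℕ) {b : ℝ} (hb : 0 ≤ b)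
    (h : ∀ᶠ M in atTop, ∃ N, (toeplitz (spec (1 - 1 / T) t) M n).det ≤
      b * (toeplitz (spec (1 - 1 / T) t) M N).det) :
    law T {h | h.borderStep t ≤ n} ≤ ENNReal.ofReal b := by
  have hT0 : 0 < T := by linarith
  have hq : 0 ≤ 1 - 1 / T := by
    rw [sub_nonneg, div_le_one hT0]; exact hT.le
  refine law_le_of_weightMeasure_le ?_
  have hmono : Monotone fun M => {h : CrystalHeight | h.InBox M (M + t) ∧ h.borderStep t ≤ n} :=
    fun M M' hM h hh => ⟨InBox.mono hM (by omega) hh.1, hh.2⟩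
  have hU : ⋃ M, {h : CrystalHeight | h.InBox M (M + t) ∧ h.borderStep t ≤ n} =
      {h | h.borderStep t ≤ n} := by
    ext h
    simp only [Set.mem_iUnion, Set.mem_ofPred_eq]
    exact ⟨fun ⟨M, hM⟩ => hM.2, fun hh => by
      obtain ⟨B, hB⟩ := h.exists_inBox t
      exact ⟨B, hB B le_rfl, hh⟩⟩
  have hlim := tendsto_measure_iUnion_atTop (μ := weightMeasure T) hmono
  rw [hU] at hlim
  refine le_of_tendsto hlim ?_
  filter_upwards [h, eventually_gt_atTop 0] with M ⟨N, hN⟩ hM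
  calc _ = boxConst (1 - 1 / T) M t *
        ENNReal.ofReal (toeplitz (spec (1 - 1 / T) t) M n).det := weightMeasure_inBox_le hq hM t n
    _ ≤ boxConst (1 - 1 / T) M t *
        ENNReal.ofReal (b * (toeplitz (spec (1 - 1 / T) t) M N).det) := by gcongr
    _ = ENNReal.ofReal b * weightMeasure T {h | h.InBox M (M + t) ∧ h.borderStep t ≤ N} := by
        rw [weightMeasure_inBox_le hq hM t N, ENNReal.ofReal_mul hb]
        ring
    _ ≤ _ := by
        gcongr
        exact measure_mono (Set.subset_univ _)

/-- Upper tail of the border step from ratios of Toeplitz determinants. -/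
lemma law_lt_borderStep_le {T : ℝ} (hT : 1 < T) (t n : ℕ) {b : ℝ} (hb : 0 ≤ b)
    (h : ∀ᶠ M in atTop, ∀ N, n ≤ N → (1 - b) * (toeplitz (spec (1 - 1 / T) t) M N).det ≤
      (toeplitz (spec (1 - 1 / T) t) M n).det) :
    law T {h | n < h.borderStep t} ≤ ENNReal.ofReal b := by
  have hT0 : 0 < T := by linarith
  have hq : 0 ≤ 1 - 1 / T := by
    rw [sub_nonneg, div_le_one hT0]; exact hT.le
  have hq1 : 1 - 1 / T < 1 := by
    have : 0 < 1 / T := by positivity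
    linarith
  refine law_le_of_weightMeasure_le ?_
  -- The extra cutoff h(0,t) ≤ M makes the total weight a Toeplitz determinant as well; it
  -- disappears as M grows.
  set E : ℕ → Set CrystalHeight := fun M =>
    {h | h.InBox M (M + t) ∧ n < h.borderStep t ∧ h.borderStep t ≤ M} with hE
  have hmono : Monotone E :=
    fun M M' hM h hh => ⟨InBox.mono hM (by omega) hh.1, hh.2.1, hh.2.2.trans hM⟩
  have hU : ⋃ M, E M = {h | n < h.borderStep t} := by
    ext h
    simp only [Set.mem_iUnion, Set.mem_ofPred_eq, hE]
    exact ⟨fun ⟨M, hM⟩ => hM.2.1, fun hh => by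
      obtain ⟨B, hB⟩ := h.exists_inBox t
      exact ⟨max B (h.borderStep t), hB _ (le_max_left _ _), hh, le_max_right _ _⟩⟩
  have hlim := tendsto_measure_iUnion_atTop (μ := weightMeasure T) hmono
  rw [hU] at hlim
  refine le_of_tendsto hlim ?_
  filter_upwards [h, eventually_gt_atTop 0, eventually_ge_atTop n] with M hN hM hnM
  have h1 : weightMeasure T {h | h.InBox M (M + t) ∧ h.borderStep t ≤ M} =
      weightMeasure T (E M) + weightMeasure T {h | h.InBox M (M + t) ∧ h.borderStep t ≤ n} := by
    rw [← measure_union _ MeasurableSet.of_discrete]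
    · congr 1
      ext h
      simp only [hE, Set.mem_union, Set.mem_ofPred_eq]
      constructor
      · rintro ⟨h1, h2⟩
        rcases lt_or_ge n (h.borderStep t) with h3 | h3
        · exact Or.inl ⟨h1, h3, h2⟩
        · exact Or.inr ⟨h1, h3⟩
      · rintro (⟨h1, -, h2⟩ | ⟨h1, h2⟩)
        · exact ⟨h1, h2⟩
        · exact ⟨h1, h2.trans hnM⟩
    · refine Set.disjoint_left.2 fun h h1 h2 => ?_
      exact absurd h1.2.1 (not_lt.2 h2.2)
  have h2 : weightMeasure T {h | h.InBox M (M + t) ∧ h.borderStep t ≤ M} ≤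
      ENNReal.ofReal b * weightMeasure T {h | h.InBox M (M + t) ∧ h.borderStep t ≤ M} +
        weightMeasure T {h | h.InBox M (M + t) ∧ h.borderStep t ≤ n} := by
    rw [weightMeasure_inBox_le hq hM, weightMeasure_inBox_le hq hM]
    have hd := Par.one_le_det_toeplitz (spec_nonneg hq t) M M
    have hd' := Par.one_le_det_toeplitz (spec_nonneg hq t) M n
    calc _ ≤ boxConst (1 - 1 / T) M t * ENNReal.ofReal (b * (toeplitz (spec (1 - 1 / T) t) M M).det
          + (toeplitz (spec (1 - 1 / T) t) M n).det) := by
          gcongr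
          have := hN M hnM
          linarith
      _ = _ := by
          rw [ENNReal.ofReal_add (by positivity) (by linarith), ENNReal.ofReal_mul hb]
          ring
  have h3 : weightMeasure T {h | h.InBox M (M + t) ∧ h.borderStep t ≤ n} ≠ ∞ := by
    rw [weightMeasure_inBox_le hq hM]
    exact ENNReal.mul_ne_top (boxConst_ne_top hq1 M t) ENNReal.ofReal_ne_top
  nth_rewrite 1 [h1] at h2
  refine (ENNReal.le_of_add_le_add_right h3 h2).trans ?_
  gcongr
  exact measure_mono (Set.subset_univ _)

end CrystalHeight

end

/-! ### Products of ratios, and the telescoping of the edge sum. -/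

noncomputable section

lemma det_toeplitz_eq_ratio_mul {a : ℕ → ℝ} (ha : ∀ i, 0 ≤ a i) (M k : ℕ) :
    (toeplitz a M k).det = toeplitzRatio a M k * (toeplitz a M (k + 1)).det := by
  have := Par.one_le_det_toeplitz ha M (k + 1)
  rw [toeplitzRatio, div_mul_cancel₀ _ (by linarith)]

/-- D_n/D_N is a product of ratios, at least 1 minus the sum of their defects. Beyond the edge the
defects are dominated by a geometric series of ratio e^(-2ε), with sum at most e^(-2εs)/(2ε). -/
lemma det_toeplitz_ge {a : ℕ → ℝ} (ha : ∀ i, 0 < a i) {ε : ℝ} (hε0 : 0 < ε) (hε1 : ε ≤ 1)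
    (h1 : ∀ i, a i < Real.exp (-ε)) (h2 : ∀ i, 4 * ε ^ 2 ≤ (1 - a i) ^ 2) {M n : ℕ} {s : ℝ}
    (hn : 2 * ∑ i ∈ Finset.range M, a i / (1 - a i) +
      20 * ε ^ 2 * ∑ i ∈ Finset.range M, a i / (1 - a i) ^ 3 + s ≤ n) {N : ℕ} (hN : n ≤ N) :
    (1 - Real.exp (-2 * ε * s) / (2 * ε)) * (toeplitz a M N).det ≤ (toeplitz a M n).det := by
  have hD : ∀ k, 1 ≤ (toeplitz a M k).det := Par.one_le_det_toeplitz (fun i => (ha i).le) M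
  set x := Real.exp (-2 * ε * s)
  set y := Real.exp (-(2 * ε)) with hy
  have hy0 : 0 < y := Real.exp_pos _
  have hx0 : 0 < x := Real.exp_pos _
  have hρ1 : Real.exp (-ε) < 1 := by rw [Real.exp_lt_one_iff]; linarith
  have hratio : ∀ j, 1 - toeplitzRatio a M (n + j) ≤ x * y ^ (j + 1) := by
    intro j
    refine (one_sub_toeplitzRatio_le (fun i _ => ha i) (fun i _ => h1 i) (Real.exp_pos _) hρ1
      (by linarith [hD (n + j + 1)])).trans ?_
    have h3 := circleRatio_exp_le hε0 hε1 (fun i (_ : i < M) => ha i) (fun i _ => h1 i)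
      fun i _ => h2 i
    have h4 : 0 ≤ circleRatio a M (Real.exp (-ε)) := by
      refine Finset.prod_nonneg fun i _ => div_nonneg ?_ ?_
      · nlinarith [ha i, h1 i, Real.exp_pos (-ε)]
      · rw [sub_nonneg, div_le_one (Real.exp_pos _)]
        exact (h1 i).le
    set S := ∑ i ∈ Finset.range M, a i / (1 - a i)
    set Q := ∑ i ∈ Finset.range M, a i / (1 - a i) ^ 3
    calc _ ≤ (Real.exp (-ε) ^ (n + j + 1) * Real.exp (ε * (2 * S) + 20 * ε ^ 3 * Q)) ^ 2 := by
          gcongr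
      _ = Real.exp (2 * (ε * (2 * S + 20 * ε ^ 2 * Q) - ε * (n + j + 1))) := by
          rw [← Real.exp_nat_mul, ← Real.exp_add, ← Real.exp_nat_mul]
          congr 1
          push_cast
          ring
      _ ≤ Real.exp (2 * (-(ε * s) - ε * (j + 1))) := by
          refine Real.exp_le_exp.2 ?_
          nlinarith
      _ = _ := by
          rw [hy, ← Real.exp_nat_mul, ← Real.exp_add]
          congr 1
          push_cast
          ring
  have hprod : ∀ m, (1 - ∑ j ∈ Finset.range m, x * y ^ (j + 1)) * (toeplitz a M (n + m)).det ≤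
      (toeplitz a M n).det := by
    intro m
    induction m with
    | zero => simp
    | succ m ih =>
      refine le_trans ?_ ih
      have h5 : 0 ≤ ∑ j ∈ Finset.range m, x * y ^ (j + 1) :=
        Finset.sum_nonneg fun j _ => by positivity
      have h6 := (toeplitzRatio_nonneg_le_one (a := a) (M := M) (k := n + m)
        (by linarith [hD (n + m + 1)])).2
      rw [det_toeplitz_eq_ratio_mul (fun i => (ha i).le) M (n + m), Finset.sum_range_succ,
        ← mul_assoc]
      refine mul_le_mul_of_nonneg_right ?_ (by linarith [hD (n + (m + 1))])
      have := hratio m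
      nlinarith
  obtain ⟨m, rfl⟩ := Nat.exists_eq_add_of_le hN
  refine le_trans (mul_le_mul_of_nonneg_right ?_ (by linarith [hD (n + m)])) (hprod m)
  have hy1 : y < 1 := by rw [hy, Real.exp_lt_one_iff]; linarith
  have h7 : ∑ j ∈ Finset.range m, y ^ j ≤ (1 - y)⁻¹ := by
    rw [← tsum_geometric_of_lt_one hy0.le hy1]
    exact (summable_geometric_of_lt_one hy0.le hy1).sum_le_tsum _ fun i _ => by positivity
  have h8 : y * (1 - y)⁻¹ ≤ 1 / (2 * ε) := by
    rw [← div_eq_mul_inv, div_le_div_iff₀ (by linarith) (by linarith)]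
    have h9 : 2 * ε + 1 ≤ Real.exp (2 * ε) := Real.add_one_le_exp _
    have h10 : y * Real.exp (2 * ε) = 1 := by rw [hy, ← Real.exp_add]; simp
    nlinarith
  have h11 : ∑ j ∈ Finset.range m, x * y ^ (j + 1) ≤ x / (2 * ε) := by
    calc _ = x * (y * ∑ j ∈ Finset.range m, y ^ j) := by
          simp only [Finset.mul_sum, pow_succ']
      _ ≤ x * (1 / (2 * ε)) := by
          gcongr
          exact (mul_le_mul_of_nonneg_left h7 hy0.le).trans h8
      _ = _ := by ring
  linarith

/-- All m ratios between n and n + m still lie below the edge by at least s, so each contributes the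
gain for distance s. -/
lemma det_toeplitz_le {a : ℕ → ℝ} (ha : ∀ i, 0 < a i) (ha1 : ∀ i, a i < 1) {d : ℝ} (hd0 : 0 < d)
    (hd1 : d < 1) {M n m : ℕ} {s : ℝ} (hs : 0 ≤ s)
    (hn : n + m + s + 6 * d ^ 2 * ∑ i ∈ Finset.range M, a i / (1 - a i) ^ 3 ≤
      2 * ∑ i ∈ Finset.range M, a i / (1 - a i)) :
    (toeplitz a M n).det ≤
      Real.exp (-(m * (d ^ 2 / 32 * s - d / 4))) * (toeplitz a M (n + m)).det := by
  have hD : ∀ k, 1 ≤ (toeplitz a M k).det := Par.one_le_det_toeplitz (fun i => (ha i).le) M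
  have key : ∀ j ≤ m, (toeplitz a M n).det ≤
      Real.exp (-(j * (d ^ 2 / 32 * s - d / 4))) * (toeplitz a M (n + j)).det := by
    intro j
    induction j with
    | zero => intro _; simp
    | succ j ih =>
      intro hj
      refine (ih (by omega)).trans ?_
      have hjm : (j : ℝ) ≤ m := by exact_mod_cast (by omega : j ≤ m)
      have h1 := toeplitzRatio_le_exp (M := M) (k := n + j) hd0 hd1 (fun i _ => ha i)
        (fun i _ => ha1 i) (by linarith [hD (n + j + 1)])
      have h2 := wellGain_ge (M := M) (k := n + j) hd0 hd1 (fun i _ => ha i)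
        (fun i _ => ha1 i) hs (by push_cast; linarith)
      have h3 : toeplitzRatio a M (n + j) ≤ Real.exp (-(d ^ 2 / 32 * s - d / 4)) :=
        h1.trans (Real.exp_le_exp.2 (by linarith))
      rw [det_toeplitz_eq_ratio_mul (fun i => (ha i).le) M (n + j), ← mul_assoc]
      refine mul_le_mul_of_nonneg_right ?_ (by linarith [hD (n + j + 1)])
      calc _ ≤ Real.exp (-(j * (d ^ 2 / 32 * s - d / 4))) *
            Real.exp (-(d ^ 2 / 32 * s - d / 4)) := by gcongr
        _ = _ := by
            rw [← Real.exp_add]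
            congr 1
            push_cast
            ring
  exact key m le_rfl

/-- Along a geometric sequence of ratio q, the sum of a/(1-a) is a Riemann sum for -T log(1 - a).
This inequality and the next bracket it by telescoping increments. -/
lemma neg_log_one_sub_telescope_le {a T : ℝ} (ha0 : 0 < a) (ha1 : a < 1) (hT : 1 < T) :
    T * (-Real.log (1 - a) - -Real.log (1 - a * (1 - 1 / T))) ≤ a / (1 - a) := by
  have hT0 : 0 < T := by linarith
  have h1 : 0 < 1 - a := by linarith
  have h2 : 1 - a * (1 - 1 / T) = (1 - a) * (1 + a / (1 - a) / T) := by field_simp; ring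
  have h3 : 0 < a / (1 - a) / T := by positivity
  rw [h2, Real.log_mul h1.ne' (by linarith)]
  have h4 := Real.log_le_sub_one_of_pos (show 0 < 1 + a / (1 - a) / T by linarith)
  calc _ = T * Real.log (1 + a / (1 - a) / T) := by ring
    _ ≤ T * (a / (1 - a) / T) := by
        gcongr
        linarith
    _ = _ := by field_simp

lemma le_neg_log_one_sub_telescope {a T : ℝ} (ha0 : 0 < a) (ha1 : a < 1) (hT : 1 < T) :
    a * (1 - 1 / T) / (1 - a * (1 - 1 / T)) ≤
      T * (-Real.log (1 - a) - -Real.log (1 - a * (1 - 1 / T))) := by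
  have hT0 : 0 < T := by linarith
  set q := 1 - 1 / T with hq
  have hT1 : 1 / T < 1 := (div_lt_one hT0).2 hT
  have hq0 : 0 < q := by linarith
  have hq1 : q < 1 := by have : 0 < 1 / T := by positivity
                         linarith
  have hb : a * q < a := mul_lt_of_lt_one_right ha0 hq1
  have h1 : 0 < 1 - a := by linarith
  have h2 : 0 < 1 - a * q := by linarith
  have h4 := Real.log_le_sub_one_of_pos (div_pos h1 h2)
  rw [Real.log_div h1.ne' h2.ne'] at h4
  have h5 : (1 - a) / (1 - a * q) - 1 = -(a / T / (1 - a * q)) := by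
    rw [hq] at h2 ⊢
    rw [div_sub_one h2.ne', ← neg_div]
    congr 1
    ring
  calc a * q / (1 - a * q) ≤ a / (1 - a * q) := by gcongr
    _ = T * (a / T / (1 - a * q)) := by field_simp
    _ ≤ _ := by
        gcongr
        linarith

end

/-! ### Sums along the specialization and comparison with the limit shape. -/

noncomputable section

namespace CrystalHeight

section SpecSums

variable {T η : ℝ} {t : ℕ}

lemma spec_pos {q : ℝ} (hq : 0 < q) (t i : ℕ) : 0 < spec q t i := by
  have := Real.sqrt_pos.2 hq
  unfold spec
  positivity

lemma spec_succ (q : ℝ) (t i : ℕ) : spec q t (i + 1) = spec q t i * q := by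
  unfold spec; ring

lemma spec_zero (q : ℝ) (t : ℕ) : spec q t 0 = √q ^ (t + 1) := by simp [spec]

lemma spec_le {q : ℝ} (hq0 : 0 < q) (hq1 : q < 1) (t i : ℕ) : spec q t i ≤ √q ^ (t + 1) :=
  mul_le_of_le_one_right (by positivity) (pow_le_one₀ hq0.le hq1.le)

lemma one_sub_inv_mem (hT : 1 < T) : 0 < 1 - 1 / T ∧ 1 - 1 / T < 1 := by
  have hT0 : 0 < T := by linarith
  have h1 : 1 / T < 1 := (div_lt_one hT0).2 hT
  have h2 : 0 < 1 / T := by positivity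
  constructor <;> linarith

/-- The telescoping increment from i to i + 1 dominates the term i + 1, so the term 0 is estimated
separately, by 1/η. -/
lemma sum_spec_le (hT : 1 < T) (hη : 0 < η) (ha : √(1 - 1 / T) ^ (t + 1) ≤ 1 - η) (M : ℕ) :
    ∑ i ∈ Finset.range M, spec (1 - 1 / T) t i / (1 - spec (1 - 1 / T) t i) ≤
      T * -Real.log (1 - √(1 - 1 / T) ^ (t + 1)) + 1 / η := by
  obtain ⟨hq0, hq1⟩ := one_sub_inv_mem hT
  set a := spec (1 - 1 / T) t with hadef
  have ha0 : ∀ i, 0 < a i := spec_pos hq0 t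
  have ha1 : ∀ i, a i ≤ 1 - η := fun i => (spec_le hq0 hq1 t i).trans ha
  have hL : ∀ i, 0 ≤ -Real.log (1 - a i) := fun i => by
    have := Real.log_nonpos (by linarith [ha1 i]) (by linarith [ha0 i] : 1 - a i ≤ 1)
    linarith
  have key : ∀ M, ∑ i ∈ Finset.range (M + 1), a i / (1 - a i) ≤
      T * (-Real.log (1 - a 0) - -Real.log (1 - a M)) + 1 / η := by
    intro M
    induction M with
    | zero =>
      rw [Finset.sum_range_one, sub_self, mul_zero, zero_add,
        div_le_div_iff₀ (by linarith [ha1 0]) hη]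
      nlinarith [ha1 0, ha0 0]
    | succ M ih =>
      rw [Finset.sum_range_succ]
      have := le_neg_log_one_sub_telescope (ha0 M) (by linarith [ha1 M]) hT
      rw [← spec_succ] at this
      linarith
  rw [← spec_zero]
  have h0 : ∀ i, 0 ≤ a i / (1 - a i) := fun i =>
    div_nonneg (ha0 i).le (by linarith [ha1 i])
  calc _ ≤ ∑ i ∈ Finset.range (M + 1), a i / (1 - a i) := by
        rw [Finset.sum_range_succ]
        linarith [h0 M]
    _ ≤ _ := by
        have := mul_nonneg (by linarith : (0:ℝ) ≤ T) (hL M)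
        have := key M
        linarith

/-- Telescoping leaves -T log(1 - a_M), which tends to 0; for large M the constant 1 absorbs it. -/
lemma le_sum_spec (hT : 1 < T) (hη : 0 < η) (ha : √(1 - 1 / T) ^ (t + 1) ≤ 1 - η) :
    ∀ᶠ M in atTop, T * -Real.log (1 - √(1 - 1 / T) ^ (t + 1)) - 1 ≤
      ∑ i ∈ Finset.range M, spec (1 - 1 / T) t i / (1 - spec (1 - 1 / T) t i) := by
  obtain ⟨hq0, hq1⟩ := one_sub_inv_mem hT
  set a := spec (1 - 1 / T) t with hadef
  have ha0 : ∀ i, 0 < a i := spec_pos hq0 t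
  have ha1 : ∀ i, a i ≤ 1 - η := fun i => (spec_le hq0 hq1 t i).trans ha
  have key : ∀ M, T * (-Real.log (1 - a 0) - -Real.log (1 - a M)) ≤
      ∑ i ∈ Finset.range M, a i / (1 - a i) := by
    intro M
    induction M with
    | zero => simp
    | succ M ih =>
      rw [Finset.sum_range_succ]
      have := neg_log_one_sub_telescope_le (ha0 M) (by linarith [ha1 M]) hT
      rw [← spec_succ] at this
      linarith
  have hlim : Tendsto (fun M => T * -Real.log (1 - a M)) atTop (𝓝 0) := by
    have h1 : Tendsto a atTop (𝓝 0) := by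
      have := (tendsto_pow_atTop_nhds_zero_of_lt_one hq0.le hq1).const_mul (√(1 - 1 / T) ^ (t + 1))
      rwa [mul_zero] at this
    have h2 : Tendsto (fun M => Real.log (1 - a M)) atTop (𝓝 (Real.log (1 - 0))) :=
      ((Real.continuousAt_log (by norm_num)).tendsto).comp (tendsto_const_nhds.sub h1)
    have h3 := h2.neg.const_mul T
    simpa using h3
  filter_upwards [hlim.eventually (gt_mem_nhds one_pos)] with M hM
  have := key M
  rw [← spec_zero]
  linarith

lemma sum_spec_div_cube_le (hT : 1 < T) (hη : 0 < η) (ha : √(1 - 1 / T) ^ (t + 1) ≤ 1 - η)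
    (M : ℕ) :
    ∑ i ∈ Finset.range M, spec (1 - 1 / T) t i / (1 - spec (1 - 1 / T) t i) ^ 3 ≤ T / η ^ 3 := by
  obtain ⟨hq0, hq1⟩ := one_sub_inv_mem hT
  have h1 : ∑ i ∈ Finset.range M, (1 - 1 / T) ^ i ≤ T := by
    have h2 := (summable_geometric_of_lt_one hq0.le hq1).sum_le_tsum (Finset.range M)
      fun i _ => by positivity
    rw [tsum_geometric_of_lt_one hq0.le hq1] at h2
    simpa using h2
  calc _ ≤ ∑ i ∈ Finset.range M, (1 - 1 / T) ^ i / η ^ 3 := by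
        refine Finset.sum_le_sum fun i _ => ?_
        have h3 := (spec_le hq0 hq1 t i).trans ha
        have h4 : spec (1 - 1 / T) t i ≤ (1 - 1 / T) ^ i := by
          refine mul_le_of_le_one_left (by positivity) (pow_le_one₀ (Real.sqrt_nonneg _) ?_)
          exact Real.sqrt_le_one.2 hq1.le
        have h5 : η ≤ 1 - spec (1 - 1 / T) t i := by linarith
        gcongr
    _ = (∑ i ∈ Finset.range M, (1 - 1 / T) ^ i) / η ^ 3 := by rw [Finset.sum_div]
    _ ≤ _ := by gcongr

end SpecSums

lemma abs_log_one_sub_sub_le {x y η : ℝ} (hη : 0 < η) (hx : x ≤ 1 - η) (hxy : y ≤ x) :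
    |Real.log (1 - x) - Real.log (1 - y)| ≤ (x - y) / η := by
  have h1 : 0 < 1 - x := by linarith
  have h2 : 0 < 1 - y := by linarith
  have h3 : Real.log (1 - x) ≤ Real.log (1 - y) := Real.log_le_log h1 (by linarith)
  rw [abs_of_nonpos (by linarith), neg_sub, ← Real.log_div h2.ne' h1.ne']
  refine (Real.log_le_sub_one_of_pos (div_pos h2 h1)).trans ?_
  rw [div_sub_one h1.ne']
  have h4 : η ≤ 1 - x := by linarith
  calc _ = (x - y) / (1 - x) := by ring
    _ ≤ _ := div_le_div_of_nonneg_left (by linarith) hη h4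

/-- The exponent is (t+1) log(q)/2 with uT ≤ t+1 ≤ uT+1 and log q between -1/(T-1) and -1/T. The
condition T ≥ 2 turns 1/(T-1) into at most 2/T. -/
lemma sqrt_pow_bounds {T u : ℝ} (hT : 2 ≤ T) (hu : 0 < u) :
    √(1 - 1 / T) ^ (⌊u * T⌋₊ + 1) ≤ Real.exp (-u / 2) ∧
      Real.exp (-u / 2) - (u + 1) / T ≤ √(1 - 1 / T) ^ (⌊u * T⌋₊ + 1) := by
  have hT0 : 0 < T := by linarith
  obtain ⟨hq0, hq1⟩ := one_sub_inv_mem (by linarith : 1 < T)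
  set t := ⌊u * T⌋₊
  have ht1 : u * T ≤ t + 1 := (Nat.lt_floor_add_one _).le
  have ht2 : (t : ℝ) ≤ u * T := Nat.floor_le (by positivity)
  have e : √(1 - 1 / T) ^ (t + 1) = Real.exp ((t + 1) * (Real.log (1 - 1 / T) / 2)) := by
    rw [← Real.log_sqrt hq0.le]
    have : √(1 - 1 / T) = Real.exp (Real.log √(1 - 1 / T)) :=
      (Real.exp_log (Real.sqrt_pos.2 hq0)).symm
    nth_rewrite 1 [this]
    rw [← Real.exp_nat_mul]
    push_cast
    ring_nf
  have hlog1 : Real.log (1 - 1 / T) ≤ -(1 / T) := by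
    linarith [Real.log_le_sub_one_of_pos hq0]
  have hlog2 : -(1 / (T - 1)) ≤ Real.log (1 - 1 / T) := by
    have := Real.one_sub_inv_le_log_of_pos hq0
    have e2 : 1 - (1 - 1 / T)⁻¹ = -(1 / (T - 1)) := by
      have : T - 1 ≠ 0 := by linarith
      rw [show 1 - 1 / T = (T - 1) / T by field_simp]
      field_simp
      ring
    linarith
  rw [e]
  constructor
  · refine Real.exp_le_exp.2 ?_
    have h1 : (t + 1) * (Real.log (1 - 1 / T) / 2) ≤ (t + 1) * (-(1 / T) / 2) := by gcongr
    have h2 : u ≤ (t + 1) * (1 / T) := by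
      rw [mul_one_div, le_div_iff₀ hT0]; exact ht1
    linarith
  · have h1 : -(u / 2) - (u + 1) / T ≤ (t + 1) * (Real.log (1 - 1 / T) / 2) := by
      have h2 : (t + 1) * (-(1 / (T - 1)) / 2) ≤ (t + 1) * (Real.log (1 - 1 / T) / 2) := by gcongr
      have h3 : (t + 1) * (1 / (T - 1)) ≤ (u * T + 1) * (1 / (T - 1)) := by
        have : 0 < T - 1 := by linarith
        gcongr
      have h4 : (u * T + 1) * (1 / (T - 1)) = u + (u + 1) / (T - 1) := by
        have : T - 1 ≠ 0 := by linarith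
        field_simp
        ring
      have h5 : (u + 1) / (T - 1) ≤ 2 * ((u + 1) / T) := by
        rw [← mul_div_assoc, div_le_div_iff₀ (by linarith) hT0]
        nlinarith
      linarith
    set x := (u + 1) / T
    have hx : 0 < x := by positivity
    have h6 := Real.exp_le_exp.2 h1
    have h7 : Real.exp (-(u / 2)) * (1 - x) ≤ Real.exp (-(u / 2) - x) := by
      rw [sub_eq_add_neg (-(u / 2)), Real.exp_add]
      have := Real.add_one_le_exp (-x)
      have h8 := Real.exp_pos (-(u / 2))
      nlinarith
    have h8 : Real.exp (-(u / 2)) ≤ 1 := by rw [Real.exp_le_one_iff]; linarith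
    have h9 : -u / 2 = -(u / 2) := by ring
    rw [h9]
    nlinarith

/-- The limit shape approximates the centering of the border step. -/
lemma abs_borderLimit_sub_le {T u u₁ u₂ : ℝ} (hT : 2 ≤ T) (hu₁ : 0 < u₁) (h1 : u₁ ≤ u)
    (h2 : u ≤ u₂) :
    √(1 - 1 / T) ^ (⌊u * T⌋₊ + 1) ≤ 1 - (1 - Real.exp (-u₁ / 2)) ∧
    |T * borderLimit u - 2 * (T * -Real.log (1 - √(1 - 1 / T) ^ (⌊u * T⌋₊ + 1)))| ≤
      2 * (u₂ + 1) / (1 - Real.exp (-u₁ / 2)) := by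
  have hT0 : 0 < T := by linarith
  obtain ⟨h3, h4⟩ := sqrt_pow_bounds hT (hu₁.trans_le h1)
  set y := √(1 - 1 / T) ^ (⌊u * T⌋₊ + 1)
  have h5 : Real.exp (-u / 2) ≤ Real.exp (-u₁ / 2) := Real.exp_le_exp.2 (by linarith)
  have h6 : Real.exp (-u₁ / 2) < 1 := by rw [Real.exp_lt_one_iff]; linarith
  set η := 1 - Real.exp (-u₁ / 2) with hη
  have hη0 : 0 < η := by linarith
  refine ⟨by linarith, ?_⟩
  have h7 := abs_log_one_sub_sub_le hη0 (by linarith : Real.exp (-u / 2) ≤ 1 - η) h3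
  have e : T * borderLimit u - 2 * (T * -Real.log (1 - y)) =
      (-2 * T) * (Real.log (1 - Real.exp (-u / 2)) - Real.log (1 - y)) := by
    rw [borderLimit]; ring
  rw [e, abs_mul, abs_of_nonpos (by linarith : -2 * T ≤ 0)]
  calc _ ≤ -(-2 * T) * ((Real.exp (-u / 2) - y) / η) := by gcongr; linarith
    _ ≤ -(-2 * T) * ((u + 1) / T / η) := by
        gcongr
        · linarith
        · linarith
    _ = 2 * (u + 1) / η := by field_simp
    _ ≤ _ := by gcongr

end CrystalHeight

end

/-! ### Concentration at one point and the union bound. -/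

noncomputable section

namespace CrystalHeight

section Tails

variable {T η ε s : ℝ} {t n : ℕ}

lemma law_lt_borderStep_le_exp (hT : 1 < T) (ha : √(1 - 1 / T) ^ (t + 1) ≤ 1 - η) (hε0 : 0 < ε)
    (hε1 : ε ≤ 1) (hεη : 2 * ε ≤ η)
    (hn : 2 * (T * -Real.log (1 - √(1 - 1 / T) ^ (t + 1))) + 2 / η + 20 * ε ^ 2 * (T / η ^ 3) + s
      ≤ n) :
    law T {h | n < h.borderStep t} ≤ ENNReal.ofReal (Real.exp (-2 * ε * s) / (2 * ε)) := by
  have hη : 0 < η := by linarith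
  obtain ⟨hq0, hq1⟩ := one_sub_inv_mem hT
  have ha1 : ∀ i, spec (1 - 1 / T) t i ≤ 1 - η := fun i => (spec_le hq0 hq1 t i).trans ha
  refine law_lt_borderStep_le hT t n (by positivity) (Eventually.of_forall fun M N hN => ?_)
  refine det_toeplitz_ge (fun i => spec_pos hq0 t i) hε0 hε1 (fun i => ?_) (fun i => ?_) ?_ hN
  · have := Real.add_one_le_exp (-ε)
    linarith [ha1 i]
  · nlinarith [ha1 i]
  · have h1 := sum_spec_le hT hη ha M
    have h2 := mul_le_mul_of_nonneg_left (sum_spec_div_cube_le hT hη ha M)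
      (by positivity : 0 ≤ 20 * ε ^ 2)
    have e : 2 / η = 2 * (1 / η) := by ring
    linarith

lemma law_borderStep_le_exp {m : ℕ} (hT : 1 < T) (hη : 0 < η)
    (ha : √(1 - 1 / T) ^ (t + 1) ≤ 1 - η) (hε0 : 0 < ε) (hε1 : ε < 1) (hs : 0 ≤ s)
    (hn : n + m + s + 6 * ε ^ 2 * (T / η ^ 3) + 2 ≤
      2 * (T * -Real.log (1 - √(1 - 1 / T) ^ (t + 1)))) :
    law T {h | h.borderStep t ≤ n} ≤
      ENNReal.ofReal (Real.exp (-(m * (ε ^ 2 / 32 * s - ε / 4)))) := by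
  obtain ⟨hq0, hq1⟩ := one_sub_inv_mem hT
  have ha1 : ∀ i, spec (1 - 1 / T) t i ≤ 1 - η := fun i => (spec_le hq0 hq1 t i).trans ha
  refine law_borderStep_le hT t n (by positivity) ?_
  filter_upwards [le_sum_spec hT hη ha] with M hM
  refine ⟨n + m, det_toeplitz_le (fun i => spec_pos hq0 t i) (fun i => by linarith [ha1 i]) hε0 hε1
    hs ?_⟩
  have h2 := mul_le_mul_of_nonneg_left (sum_spec_div_cube_le hT hη ha M)
    (by positivity : 0 ≤ 6 * ε ^ 2)
  linarith

/-- Two-sided concentration of the border step at one point. -/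
lemma law_abs_borderStep_sub_le {x y : ℝ} (hT : 1 < T) (hη : 0 < η)
    (ha : √(1 - 1 / T) ^ (t + 1) ≤ 1 - η) (hx : x ^ 3 = T) (hx1 : 1 < x) (hxη : 2 ≤ x * η)
    (hy : 128 ≤ y) (hy1 : 8 * (2 / η + 20 / η ^ 3 + 3) ≤ y) :
    law T {h | 3 / 4 * (x * y) ≤
      |(h.borderStep t : ℝ) - 2 * (T * -Real.log (1 - √(1 - 1 / T) ^ (t + 1)))|} ≤
      ENNReal.ofReal (2 * x * Real.exp (-(y / 64))) := by
  set N := 2 * (T * -Real.log (1 - √(1 - 1 / T) ^ (t + 1))) with hN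
  have hx0 : 0 < x := by linarith
  have hy0 : 0 < y := by linarith
  have hT0 : 0 < T := by linarith
  -- Both tails use ε = 1/x = T^(-1/3). The edge error ε²T/η³ is then x/η³, of the same order as the
  -- length 1/ε on which the tail bounds decay.
  have hε0 : 0 < x⁻¹ := inv_pos.2 hx0
  have hε1 : x⁻¹ < 1 := inv_lt_one_of_one_lt₀ hx1
  have hσ : y ≤ x * y := le_mul_of_one_le_left hy0.le hx1.le
  have hεη : 2 * x⁻¹ ≤ η := by
    rw [← div_eq_mul_inv, div_le_iff₀ hx0]; linarith
  have hεT : x⁻¹ ^ 2 * (T / η ^ 3) = x * (1 / η ^ 3) := by rw [← hx]; field_simp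
  have hN0 : 0 ≤ N := by
    have h1 : 0 ≤ √(1 - 1 / T) ^ (t + 1) := by positivity
    have := Real.log_nonpos (by linarith) (by linarith : 1 - √(1 - 1 / T) ^ (t + 1) ≤ 1)
    have : 0 ≤ T * -Real.log (1 - √(1 - 1 / T) ^ (t + 1)) := mul_nonneg hT0.le (by linarith)
    linarith
  have hc1 : 0 < 2 / η := by positivity
  have hc2 : 0 < 1 / η ^ 3 := by positivity
  have e20 : 20 / η ^ 3 = 20 * (1 / η ^ 3) := by ring
  have hxy : x * (8 * (2 / η + 20 / η ^ 3 + 3)) ≤ x * y := by gcongr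
  have hmain : 2 / η + 20 * (x * (1 / η ^ 3)) + 3 ≤ x * y / 8 := by nlinarith
  have hup : law T {h | ⌊N + x * y / 4⌋₊ < h.borderStep t} ≤
      ENNReal.ofReal (x * Real.exp (-(y / 64))) := by
    -- Of the margin xy/4, one half covers the deterministic errors and rounding, and the other half
    -- is the distance s to the edge.
    refine (law_lt_borderStep_le_exp (s := x * y / 8) hT ha hε0 hε1.le hεη ?_).trans ?_
    · rw [mul_assoc 20, hεT]
      have := Nat.lt_floor_add_one (N + x * y / 4)
      linarith
    · refine ENNReal.ofReal_le_ofReal ?_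
      have e1 : -2 * x⁻¹ * (x * y / 8) = -(y / 4) := by field_simp; ring
      have e2 : Real.exp (-(y / 4)) / (2 * x⁻¹) = x / 2 * Real.exp (-(y / 4)) := by field_simp
      rw [e1, e2]
      have h3 : Real.exp (-(y / 4)) ≤ Real.exp (-(y / 64)) := Real.exp_le_exp.2 (by linarith)
      have h4 : x / 2 ≤ x := by linarith
      gcongr
  have hlow : law T {h | (h.borderStep t : ℝ) ≤ N - x * y / 2} ≤
      ENNReal.ofReal (x * Real.exp (-(y / 64))) := by
    rcases lt_or_ge (N - x * y / 2) 0 with h0 | h0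
    · have : {h : CrystalHeight | (h.borderStep t : ℝ) ≤ N - x * y / 2} = ∅ := by
        refine Set.eq_empty_of_forall_notMem fun h hh => ?_
        have h1 : (h.borderStep t : ℝ) ≤ N - x * y / 2 := hh
        have h2 : (0 : ℝ) ≤ h.borderStep t := Nat.cast_nonneg _
        linarith
      rw [this, measure_empty]
      exact zero_le
    · have hsub : {h : CrystalHeight | (h.borderStep t : ℝ) ≤ N - x * y / 2} ⊆
          {h | h.borderStep t ≤ ⌊N - x * y / 2⌋₊} := fun h hh => Nat.le_floor hh
      refine (measure_mono hsub).trans ?_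
      -- Of the margin xy/2, one eighth of xy each goes to the number m of ratios and to their
      -- distance s from the edge; the rest covers the errors. Each gain is at least y/(512x)
      -- because y ≥ 128, so the exponent is at least y²/8192 ≥ y/64.
      refine (law_borderStep_le_exp (s := x * y / 8) (m := ⌊x * y / 8⌋₊) hT hη ha hε0 hε1
        (by positivity) ?_).trans ?_
      · rw [mul_assoc 6, hεT]
        have h1 := Nat.floor_le h0
        have h2 := Nat.floor_le (by positivity : 0 ≤ x * y / 8)
        have h3 : 0 < x * (1 / η ^ 3) := by positivity
        linarith
      · refine ENNReal.ofReal_le_ofReal ?_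
        have h1 : x * y / 16 ≤ ⌊x * y / 8⌋₊ := by
          have := Nat.lt_floor_add_one (x * y / 8)
          linarith
        have h2 : x⁻¹ * (y / 512) ≤ x⁻¹ ^ 2 / 32 * (x * y / 8) - x⁻¹ / 4 := by
          have e1 : x⁻¹ ^ 2 / 32 * (x * y / 8) - x⁻¹ / 4 = x⁻¹ * (y / 256 - 1 / 4) := by
            field_simp; ring
          rw [e1]
          gcongr
          linarith
        have h3 : x * y / 16 * (x⁻¹ * (y / 512)) ≤
            ⌊x * y / 8⌋₊ * (x⁻¹ ^ 2 / 32 * (x * y / 8) - x⁻¹ / 4) := by gcongr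
        have h4 : x * y / 16 * (x⁻¹ * (y / 512)) = y * y / 8192 := by field_simp; ring
        have h5 : y / 64 ≤ y * y / 8192 := by nlinarith
        calc _ ≤ Real.exp (-(y / 64)) := Real.exp_le_exp.2 (by linarith)
          _ ≤ _ := le_mul_of_one_le_left (Real.exp_pos _).le hx1.le
  have hsub : {h : CrystalHeight | 3 / 4 * (x * y) ≤ |(h.borderStep t : ℝ) - N|} ⊆
      {h | ⌊N + x * y / 4⌋₊ < h.borderStep t} ∪
        {h | (h.borderStep t : ℝ) ≤ N - x * y / 2} := by
    intro h hh
    have hh' : 3 / 4 * (x * y) ≤ |(h.borderStep t : ℝ) - N| := hh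
    have hxy0 : 0 < x * y := by positivity
    rcases le_abs.1 hh' with h1 | h1
    · left
      rw [Set.mem_ofPred_eq]
      rw [Nat.floor_lt (by positivity)]
      linarith
    · right
      rw [Set.mem_ofPred_eq]
      linarith
  calc _ ≤ _ := measure_mono hsub
    _ ≤ _ := measure_union_le _ _
    _ ≤ _ := add_le_add hup hlow
    _ = _ := by
        rw [← ENNReal.ofReal_add (by positivity) (by positivity)]
        congr 1
        ring

end Tails

/-- The set of height functions whose border step deviates from the limit shape. -/
lemma law_exists_le {c δ u₁ u₂ T : ℝ} (hu₁ : 0 < u₁) (hu₂ : u₁ < u₂) (hT : 2 ≤ T)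
    (hxη : 2 ≤ T ^ (1 / 3 : ℝ) * (1 - Real.exp (-u₁ / 2))) (hy : 128 ≤ c * T ^ δ)
    (hy1 : 8 * (2 / (1 - Real.exp (-u₁ / 2)) + 20 / (1 - Real.exp (-u₁ / 2)) ^ 3 + 3) ≤ c * T ^ δ)
    (hy2 : 4 * (2 * (u₂ + 1) / (1 - Real.exp (-u₁ / 2))) ≤ c * T ^ δ) :
    law T {h : CrystalHeight | ∃ u ∈ Set.Icc u₁ u₂, c * T ^ (-2 / 3 + δ : ℝ) ≤
      |T⁻¹ * (h.borderStep ⌊u * T⌋₊ : ℝ) - borderLimit u|} ≤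
      ENNReal.ofReal (2 * (u₂ + 1) * (T ^ (2 : ℝ) * Real.exp (-(c / 64) * T ^ δ))) := by
  have hT0 : 0 < T := by linarith
  set η := 1 - Real.exp (-u₁ / 2) with hη
  have hη0 : 0 < η := by
    have : Real.exp (-u₁ / 2) < 1 := by rw [Real.exp_lt_one_iff]; linarith
    linarith
  set x := T ^ (1 / 3 : ℝ) with hxdef
  set y := c * T ^ δ with hydef
  have hx : x ^ 3 = T := by
    rw [hxdef, ← Real.rpow_natCast, ← Real.rpow_mul hT0.le]; norm_num
  have hx1 : 1 < x := Real.one_lt_rpow (by linarith) (by norm_num)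
  have hxT : x ≤ T := by
    have : 1 ≤ x ^ 2 := one_le_pow₀ hx1.le
    nlinarith
  have hσ : T * (c * T ^ (-2 / 3 + δ : ℝ)) = x * y := by
    have : T * T ^ (-2 / 3 + δ : ℝ) = T ^ (1 / 3 : ℝ) * T ^ δ := by
      nth_rewrite 1 [← Real.rpow_one T]
      rw [← Real.rpow_add hT0, ← Real.rpow_add hT0]
      congr 1
      ring
    calc _ = c * (T * T ^ (-2 / 3 + δ : ℝ)) := by ring
      _ = _ := by rw [this]; ring
  -- All u with the same integer part of uT share one column t and one centering, so finitely many
  -- one-point events cover the deviation event.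
  set A : ℕ → Set CrystalHeight := fun t => {h | ∃ u ∈ Set.Icc u₁ u₂, ⌊u * T⌋₊ = t ∧
    c * T ^ (-2 / 3 + δ : ℝ) ≤ |T⁻¹ * (h.borderStep t : ℝ) - borderLimit u|} with hA
  have hAle : ∀ t, law T (A t) ≤ ENNReal.ofReal (2 * x * Real.exp (-(y / 64))) := by
    intro t
    by_cases ht : ∃ u ∈ Set.Icc u₁ u₂, ⌊u * T⌋₊ = t
    · obtain ⟨u₀, hu₀, rfl⟩ := ht
      have h0 := (abs_borderLimit_sub_le hT hu₁ hu₀.1 hu₀.2).1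
      refine (measure_mono fun h hh => ?_).trans
        (law_abs_borderStep_sub_le (by linarith) hη0 h0 hx hx1 hxη hy hy1)
      obtain ⟨u, hu, hut, hle⟩ := hh
      have h1 := (abs_borderLimit_sub_le hT hu₁ hu.1 hu.2).2
      rw [hut] at h1
      rw [Set.mem_ofPred_eq]
      set b := (h.borderStep ⌊u₀ * T⌋₊ : ℝ)
      set N := 2 * (T * -Real.log (1 - √(1 - 1 / T) ^ (⌊u₀ * T⌋₊ + 1)))
      have h2 := mul_le_mul_of_nonneg_left hle hT0.le
      have e : T * |T⁻¹ * b - borderLimit u| = |b - T * borderLimit u| := by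
        rw [← abs_of_pos hT0, ← abs_mul, abs_of_pos hT0, mul_sub, mul_inv_cancel_left₀ hT0.ne']
      rw [hσ, e] at h2
      -- Replacing T b_∞(u) by the centering N costs at most y/4 ≤ xy/4, which leaves three quarters
      -- of xy.
      have h3 := abs_sub_le b N (T * borderLimit u)
      rw [abs_sub_comm N] at h3
      have h4 : y ≤ x * y := le_mul_of_one_le_left (by linarith) hx1.le
      linarith
    · have : A t = ∅ := Set.eq_empty_of_forall_notMem fun h ⟨u, hu, hut, _⟩ => ht ⟨u, hu, hut⟩
      rw [this, measure_empty]
      exact zero_le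
  have hsub : {h : CrystalHeight | ∃ u ∈ Set.Icc u₁ u₂, c * T ^ (-2 / 3 + δ : ℝ) ≤
      |T⁻¹ * (h.borderStep ⌊u * T⌋₊ : ℝ) - borderLimit u|} ⊆
      ⋃ t ∈ Finset.range (⌊u₂ * T⌋₊ + 1), A t := by
    rintro h ⟨u, hu, hle⟩
    refine Set.mem_iUnion₂.2 ⟨⌊u * T⌋₊, ?_, u, hu, rfl, hle⟩
    rw [Finset.mem_range, Nat.lt_succ_iff]
    exact Nat.floor_le_floor (mul_le_mul_of_nonneg_right hu.2 hT0.le)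
  calc _ ≤ _ := measure_mono hsub
    _ ≤ ∑ t ∈ Finset.range (⌊u₂ * T⌋₊ + 1), law T (A t) := measure_biUnion_finset_le _ _
    _ ≤ ∑ t ∈ Finset.range (⌊u₂ * T⌋₊ + 1), ENNReal.ofReal (2 * x * Real.exp (-(y / 64))) :=
        Finset.sum_le_sum fun t _ => hAle t
    _ = ENNReal.ofReal ((⌊u₂ * T⌋₊ + 1 : ℕ) * (2 * x * Real.exp (-(y / 64)))) := by
        rw [Finset.sum_const, Finset.card_range, nsmul_eq_mul,
          ENNReal.ofReal_mul (Nat.cast_nonneg _), ENNReal.ofReal_natCast]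
    _ ≤ _ := by
        refine ENNReal.ofReal_le_ofReal ?_
        have h1 : ((⌊u₂ * T⌋₊ + 1 : ℕ) : ℝ) ≤ (u₂ + 1) * T := by
          have := Nat.floor_le (show 0 ≤ u₂ * T by nlinarith)
          push_cast
          linarith
        have h2 : -(y / 64) = -(c / 64) * T ^ δ := by rw [hydef]; ring
        have h3 : T ^ (2 : ℝ) = T * T := by rw [Real.rpow_two, sq]
        rw [h2, h3]
        have h4 : 0 < u₂ + 1 := by linarith
        calc _ ≤ (u₂ + 1) * T * (2 * T * Real.exp (-(c / 64) * T ^ δ)) := by gcongr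
          _ = _ := by ring

end CrystalHeight

end

theorem mainTheorem5 :
    (∀ T : ℝ, 1 < T → IsProbabilityMeasure (CrystalHeight.law T)) ∧
    ∀ δ c u₁ u₂ : ℝ, 0 < δ → 0 < c → 0 < u₁ → u₁ < u₂ →
      Tendsto
        (fun T : ℝ => CrystalHeight.law T
          {h : CrystalHeight | ∃ u ∈ Set.Icc u₁ u₂,
            c * T ^ (-2 / 3 + δ : ℝ) ≤
              |T⁻¹ * (h.borderStep ⌊u * T⌋₊ : ℝ) - borderLimit u|})
        atTop (𝓝 0) := by
  refine ⟨fun T hT => CrystalHeight.isProbabilityMeasure_law hT, fun δ c u₁ u₂ hδ hc hu₁ hu₂ => ?_⟩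
  have hη0 : 0 < 1 - Real.exp (-u₁ / 2) := by
    have : Real.exp (-u₁ / 2) < 1 := by rw [Real.exp_lt_one_iff]; linarith
    linarith
  have hy : Tendsto (fun T : ℝ => c * T ^ δ) atTop atTop :=
    (tendsto_rpow_atTop hδ).const_mul_atTop hc
  have hx : Tendsto (fun T : ℝ => T ^ (1 / 3 : ℝ) * (1 - Real.exp (-u₁ / 2))) atTop atTop :=
    (tendsto_rpow_atTop (by norm_num)).atTop_mul_const hη0
  -- The factor T² collects the O(T) columns and the prefactor T^(1/3) ≤ T. Written as (T^δ)^(2/δ),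
  -- it is beaten by the exponential in T^δ.
  have hlim : Tendsto (fun T : ℝ => ENNReal.ofReal
      (2 * (u₂ + 1) * (T ^ (2 : ℝ) * Real.exp (-(c / 64) * T ^ δ)))) atTop (𝓝 0) := by
    have h1 := (tendsto_rpow_mul_exp_neg_mul_atTop_nhds_zero (2 / δ) (c / 64)
      (by positivity)).comp (tendsto_rpow_atTop hδ)
    have h2 : Tendsto (fun T : ℝ => T ^ (2 : ℝ) * Real.exp (-(c / 64) * T ^ δ)) atTop (𝓝 0) := by
      refine h1.congr' ?_
      filter_upwards [eventually_ge_atTop 0] with T hT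
      simp only [Function.comp]
      rw [← Real.rpow_mul hT, mul_div_cancel₀ _ hδ.ne']
    have h3 := ENNReal.tendsto_ofReal (h2.const_mul (2 * (u₂ + 1)))
    simpa using h3
  refine tendsto_of_tendsto_of_tendsto_of_le_of_le' tendsto_const_nhds hlim
    (Eventually.of_forall fun _ => zero_le) ?_
  filter_upwards [eventually_ge_atTop 2, hx.eventually_ge_atTop _, hy.eventually_ge_atTop _,
    hy.eventually_ge_atTop _, hy.eventually_ge_atTop _] with T h1 h2 h3 h4 h5
  exact CrystalHeight.law_exists_le hu₁ hu₂ h1 h2 h3 h4 h5
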